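/- Theorem 2.1 (Wellposedness). Let $n\ge 2$, $\epsilon>0$, $\mathbb R^n_+=\{x\in\mathbb R^n: x^n>0\}$ with outer unit normal $\nu=(0,\dots,0,-1)$, $Q=\mathbb R^n_+\times\mathbb S^{n-1}$, $\Gamma_\pm=\{(x,\theta)\in\partial\mathbb R^n_+\times\mathbb S^{n-1}:\pm\,\theta\cdot\nu>0\}$ and $\Gamma_0=\{(x,\theta)\in\partial\mathbb R^n_+\times\mathbb S^{n-1}:\theta\cdot\nu=0\}$. Let $L^2(\Gamma_\pm)$ be taken with respect to the measure $|\theta\cdot\nu|\,dS(x)\,d\theta$, $dS(x)=dx'$. Let $\sigma,\lambda$ be measurable functions on $\mathbb R^n_+$ with $0<\sigma_0\le\sigma\le\sigma_1$ and $0<\lambda_0\le\lambda\le\lambda_1$ a.e., for constants $\sigma_0,\sigma_1,\lambda_0,\lambda_1$. Write $T=\theta\cdot\nabla_x$, and let $$\mathcal H=\{u\in L^2(Q):\nabla_\theta u\in L^2(Q)\},\quad \|u\|_{\mathcal H}^2=\|u\|_{L^2}^2+\epsilon^2\|\nabla_\theta u\|_{L^2}^2,$$ $$\mathcal Y=\{u\in\mathcal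 H: Tu\in\mathcal H'\},\quad \|u\|_{\mathcal Y}^2=\|u\|_{\mathcal H}^2+\|Tu\|_{\mathcal H'}^2,$$ where $\mathcal H'$ is the dual of $\mathcal H$, and $\nabla_\theta u$, $Tu$ are understood in the sense of distributions in $Q$. For $f\in L^2(Q)$ and $g\in L^2(\Gamma_-)$, a weak solution of $$-\epsilon^2\sigma\Delta_\theta u+\theta\cdot\nabla_xu+\lambda u=f\ \text{ in } Q,\qquad u=g\ \text{ on }\Gamma_-,$$ is a function $u\in\mathcal Y$ such that $$\int_Q\big(\epsilon^2\sigma\nabla_\theta u\cdot\nabla_\theta\varphi-u\,T\varphi+\lambda u\varphi\big)\,dx\,d\theta=\int_Qf\varphi\,dx\,d\theta+\int_{\Gamma_-}g\varphi\,|\theta\cdot\nu|\,dS(x)\,d\theta$$ for all $\varphi\in C^\infty(\bar Q)$ with $\varphi=0$ on $\Gamma_+$, $\varphi,\nabla_\theta\varphi,T\varphi\in L^2(Q)$ and $\varphi|_{\Gamma_-}\in L^2(\Gamma_-)$. A function $h\in L^2(\Gamma_\pm)$ is called a trace of $u\in\mathcal Y$ on $\Gamma_\pm$ if there are $\varphi_k\in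 C_c^\infty(\bar Q\setminus\Gamma_0)$ with $\varphi_k\to u$ in $\mathcal Y$ and $\varphi_k|_{\Gamma_\pm}\to h$ in $L^2(\Gamma_\pm)$. For any $f\in L^2(Q)$ and $g\in L^2(\Gamma_-)$ there is a unique weak solution $u\in\mathcal Y$, and $$\|u\|_{\mathcal Y}\le C\big(\|f\|_{L^2(Q)}+\|g\|_{L^2(\Gamma_-)}\big)$$ with a constant $C>0$ that depends only on $\sigma_0,\sigma_1,\lambda_0,\lambda_1$ (in particular, not on $\epsilon$). Furthermore, the traces of $u$ on $\Gamma_-$ and $\Gamma_+$ are well defined: $u$ has exactly one trace $u|_{\Gamma_-}\in L^2(\Gamma_-)$ on $\Gamma_-$ and exactly one trace $u|_{\Gamma_+}\in L^2(\Gamma_+)$ on $\Gamma_+$, and $u|_{\Gamma_-}=g$. -/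

import Mathlib

open MeasureTheory Filter Topology
open scoped ContDiff

noncomputable section

namespace FokkerPlanck

/-! The dimension of space is `n = d + 1`; the last coordinate `x (Fin.last d)` is `xⁿ`. -/

/-- Euclidean space `ℝⁿ`, `n = d + 1`. -/
abbrev E (d : ℕ) : Type := EuclideanSpace ℝ (Fin (d + 1))

/-- The unit sphere `𝕊ⁿ⁻¹` of `ℝⁿ`. -/
abbrev S (d : ℕ) : Type := Metric.sphere (0 : E d) 1

/-- The surface measure `dθ` of the unit sphere. -/
def sphereMeasure (d : ℕ) : Measure (S d) := (volume : Measure (E d)).toSphere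

/-- The open half-space `ℝⁿ₊ = {xⁿ > 0}`. -/
def halfSpace (d : ℕ) : Set (E d) := {x | 0 < x (Fin.last d)}

/-- The measure `dx dθ` of the phase space `Q = ℝⁿ₊ × 𝕊ⁿ⁻¹`. -/
def measQ (d : ℕ) : Measure (E d × S d) :=
  ((volume : Measure (E d)).restrict (halfSpace d)).prod (sphereMeasure d)

/-- A point of `ℝⁿ × 𝕊ⁿ⁻¹` seen in `ℝⁿ × ℝⁿ`. -/
def amb {d : ℕ} (p : E d × S d) : E d × E d := (p.1, (p.2 : E d))

/-! ### The boundary -/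

/-- The outer unit normal `ν = (0, …, 0, -1)` of the half-space. -/
def normal (d : ℕ) : E d := -EuclideanSpace.single (Fin.last d) (1 : ℝ)

/-- The parametrization `x' ↦ (x', 0)` of the boundary of the half-space. -/
def bdryEmb (d : ℕ) (x' : EuclideanSpace ℝ (Fin d)) : E d :=
  WithLp.toLp 2 (Fin.snoc (α := fun _ => ℝ) (fun i => x' i) 0)

/-- The surface measure `dS(x) = dx'` of the boundary of the half-space, as a measure on `ℝⁿ`. -/
def surfMeasure (d : ℕ) : Measure (E d) :=
  Measure.map (bdryEmb d) (volume : Measure (EuclideanSpace ℝ (Fin d)))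

/-- The incoming boundary `Γ₋`. -/
def GammaMinus (d : ℕ) : Set (E d × S d) :=
  {p | p.1 (Fin.last d) = 0 ∧ inner ℝ (p.2 : E d) (normal d) < 0}

/-- The outgoing boundary `Γ₊`. -/
def GammaPlus (d : ℕ) : Set (E d × S d) :=
  {p | p.1 (Fin.last d) = 0 ∧ 0 < inner ℝ (p.2 : E d) (normal d)}

/-- The grazing set `Γ₀` (as a subset of `ℝⁿ × ℝⁿ`). -/
def GammaZero (d : ℕ) : Set (E d × E d) :=
  {p | p.1 (Fin.last d) = 0 ∧ ‖p.2‖ = 1 ∧ inner ℝ p.2 (normal d) = 0}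

/-- The measure `|θ·ν(x)| dS(x) dθ` restricted to a part `G` of the boundary. -/
def bdryMeasure (d : ℕ) (G : Set (E d × S d)) : Measure (E d × S d) :=
  (((surfMeasure d).prod (sphereMeasure d)).restrict G).withDensity
    (fun p => ENNReal.ofReal |inner ℝ (p.2 : E d) (normal d)|)

/-- `L²(Q)`. -/
abbrev L2Q (d : ℕ) : Type := Lp ℝ 2 (measQ d)

/-- `L²(Q; ℝⁿ)`, in which the angular gradients live. -/
abbrev L2QVec (d : ℕ) : Type := Lp (E d) 2 (measQ d)

/-- `L²(Γ₋)`, with the measure `|θ·ν(x)| dS(x) dθ`. -/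
abbrev L2Minus (d : ℕ) : Type := Lp ℝ 2 (bdryMeasure d (GammaMinus d))

/-- `L²(Γ₊)`, with the measure `|θ·ν(x)| dS(x) dθ`. -/
abbrev L2Plus (d : ℕ) : Type := Lp ℝ 2 (bdryMeasure d (GammaPlus d))

/-! ### Classical derivatives

Smooth functions on (parts of) `ℝⁿ × 𝕊ⁿ⁻¹` are the restrictions of smooth functions on `ℝⁿ × ℝⁿ`;
the operators below depend, on the sphere, only on these restrictions (`angDiv` for tangential
fields). -/

/-- The angular gradient `∇_θ φ`: the tangential part of the gradient in the second variable. -/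
def angGrad {d : ℕ} (φ : E d × E d → ℝ) (q : E d × E d) : E d :=
  gradient (fun η => φ (q.1, η)) q.2
    - (inner ℝ q.2 (gradient (fun η => φ (q.1, η)) q.2)) • q.2

/-- The transport operator `Tφ = θ·∇ₓφ`. -/
def transport {d : ℕ} (φ : E d × E d → ℝ) (q : E d × E d) : ℝ :=
  fderiv ℝ (fun y => φ (y, q.2)) q.1 q.2

/-- The divergence on the sphere of a tangential field: the trace of the derivative in the second
variable over the tangent space of the sphere. -/
def angDiv {d : ℕ} (Φ : E d × E d → E d) (q : E d × E d) : ℝ :=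
  LinearMap.trace ℝ (E d) (fderiv ℝ (fun η => Φ (q.1, η)) q.2).toLinearMap
    - inner ℝ (fderiv ℝ (fun η => Φ (q.1, η)) q.2 q.2) q.2

/-- `C_c^∞(Q)`, with values in `F`. -/
structure IsTestQ {d : ℕ} {F : Type*} [NormedAddCommGroup F] [NormedSpace ℝ F]
    (φ : E d × E d → F) : Prop where
  smooth : ContDiff ℝ ∞ φ
  compact : HasCompactSupport φ
  supp : tsupport φ ⊆ {q | q.1 ∈ halfSpace d}

/-- `C_c^∞(Q̄ \ Γ₀)`. -/
structure IsTestNoGrazing {d : ℕ} (φ : E d × E d → ℝ) : Prop where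
  smooth : ContDiff ℝ ∞ φ
  compact : HasCompactSupport φ
  supp : Disjoint (tsupport φ) (GammaZero d)

/-! ### Weak derivatives -/

/-- `w = ∇_θ u` weakly in `Q`: `w` is tangential to the sphere, and
`∫ w·Φ = - ∫ u div_θ Φ` for all smooth, compactly supported tangential fields `Φ`. -/
def IsAngGrad {d : ℕ} (u : L2Q d) (w : L2QVec d) : Prop :=
  (∀ᵐ p ∂(measQ d), inner ℝ (w p) (p.2 : E d) = 0) ∧
  ∀ Φ : E d × E d → E d, IsTestQ Φ → (∀ p : E d × S d, inner ℝ (Φ (amb p)) (p.2 : E d) = 0) →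
    ∫ p, inner ℝ (w p) (Φ (amb p)) ∂(measQ d) = - ∫ p, u p * angDiv Φ (amb p) ∂(measQ d)

/-! ### Integrability facts needed for the linear structure -/

theorem isClosedEmbedding_amb (d : ℕ) : IsClosedEmbedding (amb (d := d)) :=
  IsClosedEmbedding.prodMap .id (Metric.isClosed_sphere.isClosedEmbedding_subtypeVal)

instance (d : ℕ) : IsFiniteMeasure (sphereMeasure d) := by
  unfold sphereMeasure; infer_instance

instance (d : ℕ) : IsFiniteMeasureOnCompacts (measQ d) := by
  unfold measQ; infer_instance

theorem memLp_comp_amb {d : ℕ} {F : Type*} [NormedAddCommGroup F] {g : E d × E d → F}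
    (hg : Continuous g) (hc : HasCompactSupport g) :
    MemLp (fun p => g (amb p)) 2 (measQ d) :=
  (hg.comp (isClosedEmbedding_amb d).continuous).memLp_of_hasCompactSupport
    (hc.comp_isClosedEmbedding (isClosedEmbedding_amb d))

theorem fderiv_snd {d : ℕ} {F : Type*} [NormedAddCommGroup F] [NormedSpace ℝ F]
    {Φ : E d × E d → F} (h : ContDiff ℝ ∞ Φ) (q : E d × E d) :
    fderiv ℝ (fun η => Φ (q.1, η)) q.2 =
      (fderiv ℝ Φ q).comp (ContinuousLinearMap.inr ℝ (E d) (E d)) := by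
  have h1 : HasFDerivAt Φ (fderiv ℝ Φ q) (q.1, q.2) :=
    (h.differentiable (by simp) q).hasFDerivAt
  exact (h1.comp q.2 (hasFDerivAt_prodMk_right q.1 q.2)).fderiv

theorem fderiv_fst {d : ℕ} {F : Type*} [NormedAddCommGroup F] [NormedSpace ℝ F]
    {Φ : E d × E d → F} (h : ContDiff ℝ ∞ Φ) (q : E d × E d) :
    fderiv ℝ (fun y => Φ (y, q.2)) q.1 =
      (fderiv ℝ Φ q).comp (ContinuousLinearMap.inl ℝ (E d) (E d)) := by
  have h1 : HasFDerivAt Φ (fderiv ℝ Φ q) (q.1, q.2) :=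
    (h.differentiable (by simp) q).hasFDerivAt
  exact (h1.comp q.1 (hasFDerivAt_prodMk_left q.1 q.2)).fderiv

theorem memLp_angDiv {d : ℕ} {Φ : E d × E d → E d} (h : IsTestQ Φ) :
    MemLp (fun p => angDiv Φ (amb p)) 2 (measQ d) := by
  have hD : Continuous (fderiv ℝ Φ) := h.smooth.continuous_fderiv (by simp)
  refine memLp_comp_amb ?_ (HasCompactSupport.intro h.compact fun q hq => ?_)
  · have hA : Continuous fun q : E d × E d =>
        (fderiv ℝ Φ q).comp (ContinuousLinearMap.inr ℝ (E d) (E d)) := by fun_prop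
    have hT : Continuous fun L : E d →L[ℝ] E d => LinearMap.trace ℝ (E d) L.toLinearMap :=
      ((LinearMap.trace ℝ (E d)).comp
        (ContinuousLinearMap.coeLM ℝ)).continuous_of_finiteDimensional
    unfold angDiv
    simp only [fderiv_snd h.smooth]
    exact (hT.comp hA).sub ((hA.clm_apply continuous_snd).inner continuous_snd)
  · simp [angDiv, fderiv_snd h.smooth, fderiv_of_notMem_tsupport (𝕜 := ℝ) hq]

theorem memLp_transport {d : ℕ} {φ : E d × E d → ℝ} (h : IsTestQ φ) :
    MemLp (fun p => transport φ (amb p)) 2 (measQ d) := by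
  have hD : Continuous (fderiv ℝ φ) := h.smooth.continuous_fderiv (by simp)
  refine memLp_comp_amb ?_ (HasCompactSupport.intro h.compact fun q hq => ?_)
  · unfold transport
    simp only [fderiv_fst h.smooth]
    fun_prop
  · simp [transport, fderiv_fst h.smooth, fderiv_of_notMem_tsupport (𝕜 := ℝ) hq]

theorem integral_add_mul {d : ℕ} (u v : L2Q d) {G : E d × S d → ℝ} (hG : MemLp G 2 (measQ d)) :
    ∫ p, (u + v : L2Q d) p * G p ∂(measQ d)
      = ∫ p, u p * G p ∂(measQ d) + ∫ p, v p * G p ∂(measQ d) := by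
  have hu : Integrable (fun p => u p * G p) (measQ d) := (Lp.memLp u).integrable_mul hG
  have hv : Integrable (fun p => v p * G p) (measQ d) := (Lp.memLp v).integrable_mul hG
  rw [← integral_add hu hv]
  refine integral_congr_ae ?_
  filter_upwards [Lp.coeFn_add u v] with p hp
  rw [hp, Pi.add_apply, add_mul]

theorem integral_smul_mul {d : ℕ} (c : ℝ) (u : L2Q d) (G : E d × S d → ℝ) :
    ∫ p, (c • u : L2Q d) p * G p ∂(measQ d) = c * ∫ p, u p * G p ∂(measQ d) := by
  rw [← integral_const_mul]
  refine integral_congr_ae ?_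
  filter_upwards [Lp.coeFn_smul c u] with p hp
  rw [hp, Pi.smul_apply, smul_eq_mul, mul_assoc]

theorem IsTestQ.memLp {d : ℕ} {Φ : E d × E d → E d} (h : IsTestQ Φ) :
    MemLp (fun p => Φ (amb p)) 2 (measQ d) :=
  memLp_comp_amb h.smooth.continuous h.compact

theorem IsAngGrad.add {d : ℕ} {u v : L2Q d} {w z : L2QVec d} (hu : IsAngGrad u w)
    (hv : IsAngGrad v z) : IsAngGrad (u + v) (w + z) := by
  refine ⟨?_, fun Φ hΦ ht => ?_⟩
  · filter_upwards [hu.1, hv.1, Lp.coeFn_add w z] with p h1 h2 h3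
    rw [h3, Pi.add_apply, inner_add_left, h1, h2, add_zero]
  · have key : ∀ y : L2QVec d, Integrable (fun p => inner ℝ (y p) (Φ (amb p))) (measQ d) := by
      intro y
      refine (L2.integrable_inner (𝕜 := ℝ) y hΦ.memLp.toLp).congr ?_
      filter_upwards [hΦ.memLp.coeFn_toLp] with p hp
      rw [hp]
    rw [integral_add_mul u v (memLp_angDiv hΦ), neg_add, ← hu.2 Φ hΦ ht, ← hv.2 Φ hΦ ht,
      ← integral_add (key w) (key z)]
    refine integral_congr_ae ?_
    filter_upwards [Lp.coeFn_add w z] with p hp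
    rw [hp, Pi.add_apply, inner_add_left]

theorem IsAngGrad.smul {d : ℕ} {u : L2Q d} {w : L2QVec d} (c : ℝ) (hu : IsAngGrad u w) :
    IsAngGrad (c • u) (c • w) := by
  refine ⟨?_, fun Φ hΦ ht => ?_⟩
  · filter_upwards [hu.1, Lp.coeFn_smul c w] with p h1 h3
    rw [h3, Pi.smul_apply, real_inner_smul_left, h1, mul_zero]
  · rw [integral_smul_mul, ← mul_neg, ← hu.2 Φ hΦ ht, ← integral_const_mul]
    refine integral_congr_ae ?_
    filter_upwards [Lp.coeFn_smul c w] with p hp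
    rw [hp, Pi.smul_apply, real_inner_smul_left]

theorem isAngGrad_zero (d : ℕ) : IsAngGrad (0 : L2Q d) 0 := by
  have h0 : ∀ᵐ p ∂(measQ d), (0 : L2Q d) p = 0 := Lp.coeFn_zero ℝ 2 (measQ d)
  have h1 : ∀ᵐ p ∂(measQ d), (0 : L2QVec d) p = 0 := Lp.coeFn_zero (E d) 2 (measQ d)
  refine ⟨h1.mono fun p hp => by rw [hp, inner_zero_left], fun Φ _ _ => ?_⟩
  rw [integral_eq_zero_of_ae (h1.mono fun p hp => by rw [hp, inner_zero_left]; rfl),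
    integral_eq_zero_of_ae (h0.mono fun p hp => by rw [hp, zero_mul]; rfl), neg_zero]

/-! ### The function spaces -/

/-- The Hilbert space `𝓗 = {u ∈ L²(Q) : ∇_θ u ∈ L²(Q)}`, an element being stored as the pair
`(u, ε ∇_θ u)`, so that `‖u‖² = ‖u‖²_{L²} + ε² ‖∇_θ u‖²_{L²}`. -/
def H (d : ℕ) (ε : ℝ) : Submodule ℝ (WithLp 2 (L2Q d × L2QVec d)) where
  carrier := {p | ∃ w, IsAngGrad p.fst w ∧ p.snd = ε • w}
  zero_mem' := ⟨0, isAngGrad_zero d, by simp⟩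
  add_mem' := by
    rintro p q ⟨w, hw, hp⟩ ⟨z, hz, hq⟩
    exact ⟨w + z, hw.add hz, by simp [hp, hq]⟩
  smul_mem' := by
    rintro c p ⟨w, hw, hp⟩
    exact ⟨c • w, hw.smul c, by
      rw [WithLp.smul_snd, hp, smul_comm]⟩

/-- The underlying `L²` function of an element of `𝓗`. -/
def hFn {d : ℕ} {ε : ℝ} (u : H d ε) : L2Q d := u.1.fst

/-- The angular gradient of an element of `𝓗` (for `ε ≠ 0`). -/
def hGrad {d : ℕ} {ε : ℝ} (u : H d ε) : L2QVec d := ε⁻¹ • u.1.snd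

/-- The dual `𝓗'`, with the dual norm. -/
abbrev HDual (d : ℕ) (ε : ℝ) : Type := StrongDual ℝ (H d ε)

/-- `ℓ ∈ 𝓗'` is the distribution `Tu = θ·∇ₓu`: its value at every `φ ∈ C_c^∞(Q) ⊆ 𝓗` is
`- ∫ u Tφ`. -/
def IsTransport {d : ℕ} {ε : ℝ} (u : H d ε) (ℓ : HDual d ε) : Prop :=
  ∀ φ : E d × E d → ℝ, IsTestQ φ → ∀ h : H d ε,
    (∀ᵐ p ∂(measQ d), hFn h p = φ (amb p)) →
      ℓ h = - ∫ p, hFn u p * transport φ (amb p) ∂(measQ d)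

/-- The space `𝓨 = {u ∈ 𝓗 : Tu ∈ 𝓗'}`, an element being stored as the pair `(u, Tu)`, so that
`‖u‖²_𝓨 = ‖u‖²_𝓗 + ‖Tu‖²_{𝓗'}`. -/
def Y (d : ℕ) (ε : ℝ) : Submodule ℝ (WithLp 2 (H d ε × HDual d ε)) where
  carrier := {p | IsTransport p.fst p.snd}
  zero_mem' := by
    intro φ hφ h _
    have h0 : ∀ᵐ p ∂(measQ d), (0 : L2Q d) p = 0 := Lp.coeFn_zero ℝ 2 (measQ d)
    have e : hFn (0 : WithLp 2 (H d ε × HDual d ε)).fst = 0 := rfl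
    rw [e, integral_congr_ae (g := fun _ => (0 : ℝ))
      (h0.mono fun p hp => by simp only [hp, zero_mul]), integral_zero, neg_zero]
    rfl
  add_mem' := by
    intro p q hp hq φ hφ h hh
    have e : hFn (p + q).fst = hFn p.fst + hFn q.fst := rfl
    rw [e, integral_add_mul _ _ (memLp_transport hφ), neg_add, ← hp φ hφ h hh, ← hq φ hφ h hh]
    rfl
  smul_mem' := by
    intro c p hp φ hφ h hh
    have e : hFn (c • p).fst = c • hFn p.fst := rfl
    rw [e, integral_smul_mul, ← mul_neg, ← hp φ hφ h hh]
    rfl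

/-- The underlying `L²` function of an element of `𝓨`. -/
def yFn {d : ℕ} {ε : ℝ} (u : Y d ε) : L2Q d := hFn u.1.fst

/-- The angular gradient of an element of `𝓨` (for `ε ≠ 0`). -/
def yGrad {d : ℕ} {ε : ℝ} (u : Y d ε) : L2QVec d := hGrad u.1.fst

/-! ### Weak solutions and traces -/

/-- The test functions of the weak formulation: `φ ∈ C^∞(Q̄)`, `φ = 0` on `Γ₊`, for which the
integrals of the weak formulation make sense (as `Q` is unbounded). -/
structure IsTestIn {d : ℕ} (φ : E d × E d → ℝ) : Prop where
  smooth : ContDiff ℝ ∞ φ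
  zero_out : ∀ p ∈ GammaPlus d, φ (amb p) = 0
  memLp : MemLp (fun p => φ (amb p)) 2 (measQ d)
  memLp_grad : MemLp (fun p => angGrad φ (amb p)) 2 (measQ d)
  memLp_transport : MemLp (fun p => transport φ (amb p)) 2 (measQ d)
  memLp_in : MemLp (fun p => φ (amb p)) 2 (bdryMeasure d (GammaMinus d))

/-- `u ∈ 𝓨` is a weak solution of `-ε²σ Δ_θ u + θ·∇ₓu + lam u = f` in `Q`, `u = g` on `Γ₋`. -/
def IsWeakSolution {d : ℕ} {ε : ℝ} (σ lam : E d → ℝ) (f : L2Q d) (g : L2Minus d)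
    (u : Y d ε) : Prop :=
  ∀ φ : E d × E d → ℝ, IsTestIn φ →
    ∫ p, (ε ^ 2 * σ p.1 * inner ℝ (yGrad u p) (angGrad φ (amb p))
        - yFn u p * transport φ (amb p) + lam p.1 * yFn u p * φ (amb p)) ∂(measQ d)
      = ∫ p, f p * φ (amb p) ∂(measQ d)
        + ∫ p, g p * φ (amb p) ∂(bdryMeasure d (GammaMinus d))

/-- `h` is the trace of `u ∈ 𝓨` on the part `G` of the boundary: `u` is the limit in `𝓨` of
functions of `C_c^∞(Q̄ \ Γ₀)` whose boundary values converge to `h` in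
`L²(G, |θ·ν(x)| dS(x) dθ)`. -/
def HasTrace {d : ℕ} {ε : ℝ} (G : Set (E d × S d)) (u : Y d ε)
    (h : Lp ℝ 2 (bdryMeasure d G)) : Prop :=
  ∃ (φ : ℕ → E d × E d → ℝ) (v : ℕ → Y d ε),
    (∀ k, IsTestNoGrazing (φ k) ∧ ∀ᵐ p ∂(measQ d), yFn (v k) p = φ k (amb p)) ∧
    Tendsto v atTop (𝓝 u) ∧
    Tendsto (fun k => eLpNorm (fun p => φ k (amb p) - h p) 2 (bdryMeasure d G)) atTop (𝓝 0)

end FokkerPlanck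

end

open FokkerPlanck

noncomputable section

namespace FokkerPlanck

/-! ### The sphere -/

/-- The action of a linear isometry on the sphere. -/
def sphereMap {d : ℕ} (g : E d ≃ₗᵢ[ℝ] E d) (θ : S d) : S d :=
  ⟨g θ, by simp⟩

theorem continuous_sphereMap {d : ℕ} (g : E d ≃ₗᵢ[ℝ] E d) : Continuous (sphereMap g) :=
  (g.continuous.comp continuous_subtype_val).subtype_mk _

open scoped Pointwise in
theorem measurePreserving_sphereMap {d : ℕ} (g : E d ≃ₗᵢ[ℝ] E d) :
    MeasurePreserving (sphereMap g) (sphereMeasure d) (sphereMeasure d) := by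
  refine ⟨(continuous_sphereMap g).measurable, ?_⟩
  ext A hA
  rw [Measure.map_apply (continuous_sphereMap g).measurable hA]
  unfold sphereMeasure
  rw [Measure.toSphere_apply' _ hA,
    Measure.toSphere_apply' _ ((continuous_sphereMap g).measurable hA)]
  congr 1
  have : Set.Ioo (0 : ℝ) 1 • ((fun θ : S d => (θ : E d)) '' (sphereMap g ⁻¹' A))
      = g ⁻¹' (Set.Ioo (0 : ℝ) 1 • ((fun θ : S d => (θ : E d)) '' A)) := by
    ext y
    simp only [Set.mem_smul, Set.mem_image, Set.mem_preimage]
    constructor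
    · rintro ⟨r, hr, _, ⟨θ, hθ, rfl⟩, rfl⟩
      exact ⟨r, hr, _, ⟨_, hθ, rfl⟩, by simp [sphereMap]⟩
    · rintro ⟨r, hr, _, ⟨θ, hθ, rfl⟩, h⟩
      refine ⟨r, hr, _, ⟨sphereMap g.symm θ, ?_, rfl⟩, ?_⟩
      · convert hθ
        ext1
        simp [sphereMap]
      · apply g.injective
        simp [sphereMap, h]
  rw [this]
  exact g.measurePreserving.measure_preimage_emb g.toHomeomorph.measurableEmbedding _

theorem integral_sphereMap {d : ℕ} (g : E d ≃ₗᵢ[ℝ] E d) (f : S d → ℝ) :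
    ∫ θ, f (sphereMap g θ) ∂(sphereMeasure d) = ∫ θ, f θ ∂(sphereMeasure d) := by
  let e : S d ≃ₜ S d :=
    { toFun := sphereMap g
      invFun := sphereMap g.symm
      left_inv := fun θ => by ext1; simp [sphereMap]
      right_inv := fun θ => by ext1; simp [sphereMap]
      continuous_toFun := continuous_sphereMap g
      continuous_invFun := continuous_sphereMap g.symm }
  exact (measurePreserving_sphereMap g).integral_comp e.measurableEmbedding f

/-- The infinitesimal rotation `η ↦ ηᵢ eⱼ - ηⱼ eᵢ`. -/
def rotVec {d : ℕ} (i j : Fin (d + 1)) : E d →L[ℝ] E d :=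
  (EuclideanSpace.proj i).smulRight (EuclideanSpace.single j (1 : ℝ))
    - (EuclideanSpace.proj j).smulRight (EuclideanSpace.single i (1 : ℝ))

theorem rotVec_apply {d : ℕ} (i j : Fin (d + 1)) (η : E d) :
    rotVec i j η = η i • EuclideanSpace.single j (1 : ℝ) - η j • EuclideanSpace.single i (1 : ℝ) :=
  rfl

theorem inner_rotVec {d : ℕ} (i j : Fin (d + 1)) (a η : E d) :
    inner ℝ a (rotVec i j η) = η i * a j - η j * a i := by
  simp [rotVec_apply, inner_sub_right, inner_smul_right, EuclideanSpace.inner_single_right]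

theorem inner_rotVec_self {d : ℕ} (i j : Fin (d + 1)) (η : E d) :
    inner ℝ η (rotVec i j η) = 0 := by
  rw [inner_rotVec]; ring

theorem rotVec_self {d : ℕ} (i : Fin (d + 1)) : rotVec (d := d) i i = 0 := by
  ext η : 1
  rw [rotVec_apply, sub_self]; rfl

theorem norm_rotVec_le {d : ℕ} (i j : Fin (d + 1)) (η : E d) : ‖rotVec i j η‖ ≤ 2 * ‖η‖ := by
  rw [rotVec_apply]
  refine (norm_sub_le _ _).trans ?_
  simp only [norm_smul, PiLp.norm_single, norm_one, mul_one]
  linarith [PiLp.norm_apply_le η i, PiLp.norm_apply_le η j]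

theorem sum_inner_rotVec {d : ℕ} (θ a b : E d) :
    ∑ i, ∑ j, inner ℝ a (rotVec i j θ) * inner ℝ b (rotVec i j θ)
      = 2 * (inner ℝ θ θ * inner ℝ a b - inner ℝ θ a * inner ℝ θ b) := by
  have h : ∀ x y : E d, inner ℝ x y = ∑ i, x i * y i := fun x y => by
    simp [PiLp.inner_apply, mul_comm]
  simp only [inner_rotVec]
  simp only [h]
  have e : ∀ i j, (θ i * a j - θ j * a i) * (θ i * b j - θ j * b i)
      = (θ i * θ i) * (a j * b j) + (a i * b i) * (θ j * θ j)
        - (θ i * b i) * (θ j * a j) - (θ i * a i) * (θ j * b j) := fun i j => by ring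
  simp only [e, Finset.sum_add_distrib, Finset.sum_sub_distrib, ← Finset.sum_mul_sum]
  ring

theorem sum_inner_rotVec_sphere {d : ℕ} (θ : S d) {a b : E d} (ha : inner ℝ a (θ : E d) = 0) :
    inner ℝ a b
      = (1 / 2) * ∑ i, ∑ j, inner ℝ a (rotVec i j (θ : E d)) * inner ℝ b (rotVec i j (θ : E d)) := by
  rw [sum_inner_rotVec, real_inner_self_eq_norm_sq, norm_eq_of_mem_sphere,
    real_inner_comm a (θ : E d), ha]
  ring

theorem exists_rotation_curve {d : ℕ} {i j : Fin (d + 1)} (hij : i ≠ j) :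
    ∃ γ : ℝ → E d → E d, (∀ t, ∃ g : E d ≃ₗᵢ[ℝ] E d, ∀ x, g x = γ t x) ∧
      (Continuous fun p : ℝ × E d => γ p.1 p.2) ∧
      (∀ t x, HasDerivAt (fun s => γ s x) ((2 : ℝ) • rotVec i j (γ t x)) t) ∧
      ∀ x, γ (2 * Real.pi) x = γ 0 x := by
  let v : ℝ → E d := fun t =>
    Real.cos t • EuclideanSpace.single i (1 : ℝ) + Real.sin t • EuclideanSpace.single j (1 : ℝ)
  let v' : ℝ → E d := fun t =>
    (-Real.sin t) • EuclideanSpace.single i (1 : ℝ) + Real.cos t • EuclideanSpace.single j (1 : ℝ)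
  have hv : ∀ t, HasDerivAt v (v' t) t := fun t =>
    ((Real.hasDerivAt_cos t).smul_const _).add ((Real.hasDerivAt_sin t).smul_const _)
  have hvi : ∀ t x, inner ℝ (v t) x = Real.cos t * x i + Real.sin t * x j := by
    intro t x
    simp [v, inner_add_left, inner_smul_left, EuclideanSpace.inner_single_left]
  have hvn : ∀ t, ‖v t‖ = 1 := by
    intro t
    have : inner ℝ (v t) (v t) = 1 := by
      rw [hvi]
      simp only [v, PiLp.add_apply, PiLp.smul_apply, PiLp.single_apply, hij, hij.symm, if_true,
        if_false, smul_eq_mul]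
      linear_combination Real.sin_sq_add_cos_sq t
    rw [real_inner_self_eq_norm_sq] at this
    nlinarith [norm_nonneg (v t)]
  let γ : ℝ → E d → E d := fun t x => (2 * inner ℝ (v t) x) • v t - x
  have hvi' : ∀ t x, inner ℝ (v' t) x = -Real.sin t * x i + Real.cos t * x j := by
    intro t x
    simp [v', inner_add_left, inner_smul_left, EuclideanSpace.inner_single_left]
  have hγ : ∀ t x, HasDerivAt (fun s => γ s x) ((2 : ℝ) • rotVec i j (γ t x)) t := by
    intro t x
    have h1 : HasDerivAt (fun s => 2 * inner ℝ (v s) x) (2 * inner ℝ (v' t) x) t := by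
      have := ((hv t).inner ℝ (hasDerivAt_const t x)).const_mul 2
      simpa using this
    have h2 := (h1.smul (hv t)).sub_const x
    refine HasDerivAt.congr_deriv h2 ?_
    have hs := Real.sin_sq_add_cos_sq t
    ext k
    simp only [γ, rotVec_apply, hvi, hvi', v, v']
    rcases eq_or_ne k i with rfl | hki
    · simp [hij, hij.symm]
      linear_combination (2 * x j) * hs
    · rcases eq_or_ne k j with rfl | hkj
      · simp [hij, hij.symm]
        linear_combination (-2 * x i) * hs
      · simp [hki, hkj]
  let g : ℝ → E d ≃ₗᵢ[ℝ] E d := fun t => (ℝ ∙ v t).reflection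
  have hg : ∀ t x, g t x = γ t x := by
    intro t x
    simp only [g, γ]
    rw [Submodule.reflection_singleton_apply, hvn]
    simp [two_smul, add_smul, two_mul]
  have hγc : Continuous fun p : ℝ × E d => γ p.1 p.2 := by
    have : Continuous v := continuous_iff_continuousAt.2 fun t => (hv t).continuousAt
    fun_prop
  exact ⟨γ, fun t => ⟨g t, hg t⟩, hγc, hγ, fun x => by simp [γ, v]⟩

/-- The integral of the rotational derivative of a smooth function over the sphere vanishes. -/
theorem integral_fderiv_rotVec {d : ℕ} {f : E d → ℝ} (hf : ContDiff ℝ 1 f) (i j : Fin (d + 1)) :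
    ∫ θ : S d, fderiv ℝ f θ (rotVec i j θ) ∂(sphereMeasure d) = 0 := by
  rcases eq_or_ne i j with rfl | hij
  · simp [rotVec_self]
  obtain ⟨γ, hγg, hγc, hγ, hper⟩ := exists_rotation_curve hij
  have hD : Continuous fun x : E d => fderiv ℝ f x (rotVec i j x) := by
    have := hf.continuous_fderiv (by simp)
    fun_prop
  have key : ∀ x, ∫ t in (0 : ℝ)..(2 * Real.pi), fderiv ℝ f (γ t x) (rotVec i j (γ t x)) = 0 := by
    intro x
    have hd : ∀ t, HasDerivAt (fun s => f (γ s x))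
        (2 * fderiv ℝ f (γ t x) (rotVec i j (γ t x))) t := by
      intro t
      have := ((hf.differentiable (by simp) (γ t x)).hasFDerivAt).comp_hasDerivAt t (hγ t x)
      refine HasDerivAt.congr_deriv this ?_
      simp
    have hc : Continuous fun t => 2 * fderiv ℝ f (γ t x) (rotVec i j (γ t x)) :=
      (hD.comp (hγc.comp (Continuous.prodMk_left x))).const_mul 2 
    have := intervalIntegral.integral_eq_sub_of_hasDerivAt (a := 0) (b := 2 * Real.pi)
      (fun t _ => hd t) (hc.intervalIntegrable _ _)
    rw [intervalIntegral.integral_const_mul] at this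
    rw [hper, sub_self] at this
    linarith
  have hcont : Continuous fun p : ℝ × S d =>
      fderiv ℝ f (γ p.1 p.2) (rotVec i j (γ p.1 p.2)) :=
    hD.comp (hγc.comp (continuous_id.prodMap continuous_subtype_val))
  have swap : ∫ θ : S d, (∫ t in (0 : ℝ)..(2 * Real.pi),
        fderiv ℝ f (γ t θ) (rotVec i j (γ t θ))) ∂(sphereMeasure d)
      = ∫ t in (0 : ℝ)..(2 * Real.pi), ∫ θ : S d,
        fderiv ℝ f (γ t θ) (rotVec i j (γ t θ)) ∂(sphereMeasure d) := by
    have h2 : (0 : ℝ) ≤ 2 * Real.pi := by positivity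
    simp only [intervalIntegral.integral_of_le h2]
    refine integral_integral_swap (f := fun (θ : S d) (t : ℝ) =>
      fderiv ℝ f (γ t θ) (rotVec i j (γ t θ))) ?_
    obtain ⟨C, hC⟩ := (isCompact_Icc (a := (0 : ℝ)) (b := 2 * Real.pi)).prod
      (isCompact_univ (X := S d)) |>.exists_bound_of_continuousOn hcont.continuousOn
    refine Integrable.of_bound (C := C) ?_ ?_
    · exact (hcont.comp continuous_swap).aestronglyMeasurable
    · rw [← Measure.restrict_univ (μ := sphereMeasure d), Measure.prod_restrict]
      refine ae_restrict_of_forall_mem (MeasurableSet.univ.prod measurableSet_Ioc) fun p hp => ?_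
      exact hC (p.2, p.1) ⟨⟨hp.2.1.le, hp.2.2⟩, trivial⟩
  have inv : ∀ t, ∫ θ : S d, fderiv ℝ f (γ t θ) (rotVec i j (γ t θ)) ∂(sphereMeasure d)
      = ∫ θ : S d, fderiv ℝ f θ (rotVec i j θ) ∂(sphereMeasure d) := by
    intro t
    obtain ⟨g, hg⟩ := hγg t
    rw [← integral_sphereMap g fun θ : S d => fderiv ℝ f θ (rotVec i j θ)]
    simp only [sphereMap, hg]
  simp only [key, inv, intervalIntegral.integral_const] at swap
  simp only [integral_zero, smul_eq_mul, sub_zero] at swap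
  have := Real.pi_pos
  rcases mul_eq_zero.1 swap.symm with h | h
  · linarith
  · exact h

/-! ### Angular derivatives -/

/-- The derivative along an infinitesimal rotation of the angular variable. -/
def rot {d : ℕ} (i j : Fin (d + 1)) (φ : E d × E d → ℝ) (q : E d × E d) : ℝ :=
  fderiv ℝ φ q (0, rotVec i j q.2)

/-- `C_c^∞(ℝⁿ × ℝⁿ)`. -/
structure IsTestV {d : ℕ} {F : Type*} [NormedAddCommGroup F] [NormedSpace ℝ F]
    (φ : E d × E d → F) : Prop where
  smooth : ContDiff ℝ ∞ φ
  compact : HasCompactSupport φ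

section Calculus

variable {d : ℕ} {F : Type*} [NormedAddCommGroup F] [NormedSpace ℝ F]

theorem IsTestQ.toV {φ : E d × E d → F} (h : IsTestQ φ) : IsTestV φ := ⟨h.smooth, h.compact⟩

theorem IsTestNoGrazing.toV {φ : E d × E d → ℝ} (h : IsTestNoGrazing φ) : IsTestV φ :=
  ⟨h.smooth, h.compact⟩

theorem hasFDerivAt_of_smooth {φ : E d × E d → F} (h : ContDiff ℝ ∞ φ) (q : E d × E d) :
    HasFDerivAt φ (fderiv ℝ φ q) q :=
  (h.differentiable (by simp) q).hasFDerivAt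

theorem continuous_fderiv_of_smooth {φ : E d × E d → F} (h : ContDiff ℝ ∞ φ) :
    Continuous (fderiv ℝ φ) :=
  h.continuous_fderiv (by simp)

theorem contDiff_fderiv_of_smooth {φ : E d × E d → F} (h : ContDiff ℝ ∞ φ) :
    ContDiff ℝ ∞ (fderiv ℝ φ) :=
  h.fderiv_right (by simp)

theorem contDiff_rot {φ : E d × E d → ℝ} (h : ContDiff ℝ ∞ φ) (i j : Fin (d + 1)) :
    ContDiff ℝ ∞ (rot i j φ) := by
  have h1 : ContDiff ℝ ∞ fun q : E d × E d => ((0 : E d), rotVec i j q.2) := by fun_prop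
  exact (contDiff_fderiv_of_smooth h).clm_apply h1

theorem transport_eq {φ : E d × E d → ℝ} (h : ContDiff ℝ ∞ φ) (q : E d × E d) :
    transport φ q = fderiv ℝ φ q (q.2, 0) := by
  simp [transport, fderiv_fst h]

theorem contDiff_transport {φ : E d × E d → ℝ} (h : ContDiff ℝ ∞ φ) :
    ContDiff ℝ ∞ (transport φ) := by
  have h1 : ContDiff ℝ ∞ fun q : E d × E d => (q.2, (0 : E d)) := by fun_prop
  have : transport φ = fun q => fderiv ℝ φ q (q.2, 0) := funext (transport_eq h)
  rw [this]
  exact (contDiff_fderiv_of_smooth h).clm_apply h1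

theorem IsTestV.rot {φ : E d × E d → ℝ} (h : IsTestV φ) (i j : Fin (d + 1)) :
    IsTestV (rot i j φ) :=
  ⟨contDiff_rot h.smooth i j, HasCompactSupport.intro h.compact fun q hq => by
    simp [FokkerPlanck.rot, fderiv_of_notMem_tsupport (𝕜 := ℝ) hq]⟩

theorem IsTestV.transport {φ : E d × E d → ℝ} (h : IsTestV φ) : IsTestV (transport φ) :=
  ⟨contDiff_transport h.smooth, HasCompactSupport.intro h.compact fun q hq => by
    simp [transport_eq h.smooth, fderiv_of_notMem_tsupport (𝕜 := ℝ) hq]⟩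

theorem IsTestV.mul_left {φ χ : E d × E d → ℝ} (h : IsTestV φ) (hχ : ContDiff ℝ ∞ χ) :
    IsTestV (fun q => χ q * φ q) :=
  ⟨hχ.mul h.smooth, h.compact.mul_left⟩

theorem IsTestV.mul_right {φ χ : E d × E d → ℝ} (h : IsTestV φ) (hχ : ContDiff ℝ ∞ χ) :
    IsTestV (fun q => φ q * χ q) :=
  ⟨h.smooth.mul hχ, h.compact.mul_right⟩

theorem rot_mul {φ χ : E d × E d → ℝ} (h : ContDiff ℝ ∞ φ) (hχ : ContDiff ℝ ∞ χ)
    (i j : Fin (d + 1)) (q : E d × E d) :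
    rot i j (fun q => φ q * χ q) q = φ q * rot i j χ q + χ q * rot i j φ q := by
  have := ((hasFDerivAt_of_smooth h q).mul (hasFDerivAt_of_smooth hχ q)).fderiv
  simp only [rot]
  erw [this]
  simp

theorem transport_mul {φ χ : E d × E d → ℝ} (h : ContDiff ℝ ∞ φ) (hχ : ContDiff ℝ ∞ χ)
    (q : E d × E d) :
    transport (fun q => φ q * χ q) q = φ q * transport χ q + χ q * transport φ q := by
  have := ((hasFDerivAt_of_smooth h q).mul (hasFDerivAt_of_smooth hχ q)).fderiv
  rw [transport_eq h, transport_eq hχ, transport_eq (h.mul hχ)]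
  erw [this]
  simp

theorem rot_comp_fst {h : E d → ℝ} (hh : ContDiff ℝ ∞ h) (i j : Fin (d + 1)) (q : E d × E d) :
    rot i j (fun q => h q.1) q = 0 := by
  have h1 : HasFDerivAt h (fderiv ℝ h q.1) q.1 := (hh.differentiable (by simp) _).hasFDerivAt
  have := (h1.comp q hasFDerivAt_fst).fderiv
  simp only [rot]
  erw [this]
  simp

theorem inner_angGrad {φ : E d × E d → ℝ} (h : ContDiff ℝ ∞ φ) (q : E d × E d) (a : E d) :
    inner ℝ (angGrad φ q) a = fderiv ℝ φ q (0, a - (inner ℝ q.2 a) • q.2) := by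
  have e : ∀ b, inner ℝ (gradient (fun η => φ (q.1, η)) q.2) b = fderiv ℝ φ q (0, b) := by
    intro b
    rw [gradient, InnerProductSpace.toDual_symm_apply, fderiv_snd h]
    simp
  have e2 : ((0 : E d), a - (inner ℝ q.2 a) • q.2) = (0, a) - (inner ℝ q.2 a) • (0, q.2) := by
    ext <;> simp
  rw [angGrad, inner_sub_left, inner_smul_left, real_inner_comm _ q.2, e, e, e2, map_sub, map_smul]
  simp [mul_comm]

theorem inner_angGrad_rotVec {φ : E d × E d → ℝ} (h : ContDiff ℝ ∞ φ) (i j : Fin (d + 1))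
    (q : E d × E d) : inner ℝ (angGrad φ q) (rotVec i j q.2) = rot i j φ q := by
  rw [inner_angGrad h, inner_rotVec_self]
  simp [rot]

theorem inner_angGrad_self {φ : E d × E d → ℝ} (h : ContDiff ℝ ∞ φ) (p : E d × S d) :
    inner ℝ (angGrad φ (amb p)) (p.2 : E d) = 0 := by
  rw [inner_angGrad h]
  simp only [amb, real_inner_self_eq_norm_sq, norm_eq_of_mem_sphere, one_pow, one_smul, sub_self]
  exact map_zero _

theorem continuous_angGrad {φ : E d × E d → ℝ} (h : ContDiff ℝ ∞ φ) : Continuous (angGrad φ) := by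
  have hD := continuous_fderiv_of_smooth h
  have e : angGrad φ = fun q => (InnerProductSpace.toDual ℝ (E d)).symm
      ((fderiv ℝ φ q).comp (ContinuousLinearMap.inr ℝ (E d) (E d)))
      - (inner ℝ q.2 ((InnerProductSpace.toDual ℝ (E d)).symm
      ((fderiv ℝ φ q).comp (ContinuousLinearMap.inr ℝ (E d) (E d))))) • q.2 := by
    ext1 q
    simp only [angGrad, gradient, fderiv_snd h]
  rw [e]
  have h1 : Continuous fun q : E d × E d => (InnerProductSpace.toDual ℝ (E d)).symm
      ((fderiv ℝ φ q).comp (ContinuousLinearMap.inr ℝ (E d) (E d))) :=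
    (LinearIsometryEquiv.continuous _).comp (by fun_prop)
  fun_prop

theorem angGrad_of_notMem_tsupport {φ : E d × E d → ℝ} (h : ContDiff ℝ ∞ φ) {q : E d × E d}
    (hq : q ∉ tsupport φ) : angGrad φ q = 0 := by
  refine ext_inner_right ℝ fun a => ?_
  rw [inner_angGrad h, fderiv_of_notMem_tsupport (𝕜 := ℝ) hq]
  simp

/-- A tangential field is determined by its components along the infinitesimal rotations. -/
theorem eq_of_inner_rotVec {θ : S d} {a b : E d} (ha : inner ℝ a (θ : E d) = 0)
    (hb : inner ℝ b (θ : E d) = 0)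
    (h : ∀ i j, inner ℝ a (rotVec i j (θ : E d)) = inner ℝ b (rotVec i j (θ : E d))) : a = b := by
  refine ext_inner_right ℝ fun c => ?_
  rw [sum_inner_rotVec_sphere θ ha, sum_inner_rotVec_sphere θ hb]
  simp only [h]

theorem sum_inner_clm_rotVec (L : E d →L[ℝ] E d) (θ : E d) :
    ∑ i, ∑ j, inner ℝ (L (rotVec i j θ)) (rotVec i j θ)
      = 2 * (inner ℝ θ θ * LinearMap.trace ℝ (E d) L.toLinearMap - inner ℝ (L θ) θ) := by
  have h : ∀ x y : E d, inner ℝ x y = ∑ i, x i * y i := fun x y => by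
    simp [PiLp.inner_apply, mul_comm]
  rw [LinearMap.trace_eq_sum_inner _ (EuclideanSpace.basisFun (Fin (d + 1)) ℝ)]
  have hL : inner ℝ (L θ) θ = ∑ i, ∑ j, (θ i * θ j) * (L (EuclideanSpace.single j 1)) i := by
    have : θ = ∑ j, θ j • EuclideanSpace.single j (1 : ℝ) := by
      ext k; simp [Pi.single_apply]
    rw [h]
    refine Finset.sum_congr rfl fun i _ => ?_
    conv_lhs => rw [this]
    rw [map_sum]
    simp only [WithLp.ofLp_sum, Finset.sum_apply, map_smul, PiLp.smul_apply, smul_eq_mul,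
      Finset.sum_mul]
    refine Finset.sum_congr rfl fun j _ => ?_
    simp [PiLp.single_apply]
    ring
  simp only [inner_rotVec]
  rw [hL, h θ θ]
  simp only [rotVec_apply, map_sub, map_smul, PiLp.sub_apply, PiLp.smul_apply, smul_eq_mul]
  have e : ∀ i j, θ i * (θ i * (L (EuclideanSpace.single j 1)) j
        - θ j * (L (EuclideanSpace.single i 1)) j)
      - θ j * (θ i * (L (EuclideanSpace.single j 1)) i - θ j * (L (EuclideanSpace.single i 1)) i)
      = (θ i * θ i) * (L (EuclideanSpace.single j 1)) j
        + (L (EuclideanSpace.single i 1)) i * (θ j * θ j)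
        - (θ j * θ i) * (L (EuclideanSpace.single i 1)) j
        - (θ i * θ j) * (L (EuclideanSpace.single j 1)) i := fun i j => by ring
  simp only [e, Finset.sum_add_distrib, Finset.sum_sub_distrib, ← Finset.sum_mul_sum]
  rw [Finset.sum_comm (f := fun i j => θ j * θ i * (L (EuclideanSpace.single i 1)) j)]
  have t : ∑ i, inner ℝ ((EuclideanSpace.basisFun (Fin (d + 1)) ℝ) i)
      (L.toLinearMap ((EuclideanSpace.basisFun (Fin (d + 1)) ℝ) i))
      = ∑ i, (L (EuclideanSpace.single i 1)) i := by
    simp [EuclideanSpace.inner_single_left]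
  rw [t]
  ring

theorem sum_inner_rotVec_rotVec (a θ : E d) :
    ∑ i, ∑ j, inner ℝ a (rotVec i j (rotVec i j θ)) = - (2 * d) * inner ℝ a θ := by
  have h : inner ℝ a θ = ∑ i, a i * θ i := by
    simp [PiLp.inner_apply, mul_comm]
  have e : ∀ i j, inner ℝ a (rotVec i j (rotVec i j θ))
      = (if i = j then 2 * (a i * θ i) else 0) - a i * θ i - a j * θ j := by
    intro i j
    rw [inner_rotVec, rotVec_apply]
    rcases eq_or_ne i j with rfl | hij
    · simp; ring
    · simp [hij, hij.symm]; ring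
  simp only [e, Finset.sum_sub_distrib, Finset.sum_ite_eq, Finset.mem_univ, if_true,
    Finset.sum_const, Finset.card_univ, Fintype.card_fin, nsmul_eq_mul, ← Finset.mul_sum]
  rw [← h]
  push_cast
  ring

theorem rot_inner_rotVec {Φ : E d × E d → E d} (hΦ : ContDiff ℝ ∞ Φ) (i j : Fin (d + 1))
    (q : E d × E d) :
    rot i j (fun q => inner ℝ (Φ q) (rotVec i j q.2)) q
      = inner ℝ (fderiv ℝ Φ q (0, rotVec i j q.2)) (rotVec i j q.2)
        + inner ℝ (Φ q) (rotVec i j (rotVec i j q.2)) := by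
  have h2 : HasFDerivAt (fun q : E d × E d => rotVec i j q.2)
      ((rotVec i j).comp (ContinuousLinearMap.snd ℝ (E d) (E d))) q :=
    ((rotVec i j).comp (ContinuousLinearMap.snd ℝ (E d) (E d))).hasFDerivAt
  have := ((hasFDerivAt_of_smooth hΦ q).inner ℝ h2).fderiv
  simp only [rot, this]
  simp [fderivInnerCLM_apply, add_comm]

/-- The divergence of a tangential field in terms of infinitesimal rotations. -/
theorem angDiv_eq_sum_rot {Φ : E d × E d → E d} (hΦ : ContDiff ℝ ∞ Φ) (p : E d × S d)
    (ht : inner ℝ (Φ (amb p)) (p.2 : E d) = 0) :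
    angDiv Φ (amb p)
      = (1 / 2) * ∑ i, ∑ j, rot i j (fun q => inner ℝ (Φ q) (rotVec i j q.2)) (amb p) := by
  simp only [rot_inner_rotVec hΦ, Finset.sum_add_distrib]
  rw [sum_inner_rotVec_rotVec]
  have e : (amb p).2 = (p.2 : E d) := rfl
  have h1 := sum_inner_clm_rotVec (fderiv ℝ (fun η => Φ ((amb p).1, η)) (amb p).2) (amb p).2
  rw [angDiv]
  rw [real_inner_self_eq_norm_sq, e, norm_eq_of_mem_sphere, ← e, fderiv_snd hΦ] at h1
  rw [fderiv_snd hΦ]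
  have h3 : ∀ i j, ((fderiv ℝ Φ (amb p)).comp (ContinuousLinearMap.inr ℝ (E d) (E d)))
      (rotVec i j (amb p).2) = fderiv ℝ Φ (amb p) (0, rotVec i j (amb p).2) := fun i j => by simp
  simp only [h3] at h1
  rw [h1, e, ht]
  simp

theorem inner_angGrad_add_mul_angDiv {φ : E d × E d → ℝ} (hφ : ContDiff ℝ ∞ φ)
    {Φ : E d × E d → E d} (hΦ : ContDiff ℝ ∞ Φ) (p : E d × S d)
    (ht : inner ℝ (Φ (amb p)) (p.2 : E d) = 0) :
    inner ℝ (angGrad φ (amb p)) (Φ (amb p)) + φ (amb p) * angDiv Φ (amb p)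
      = (1 / 2) * ∑ i, ∑ j,
        rot i j (fun q => φ q * inner ℝ (Φ q) (rotVec i j q.2)) (amb p) := by
  have hG : ∀ i j, ContDiff ℝ ∞ fun q : E d × E d => inner ℝ (Φ q) (rotVec i j q.2) := by
    intro i j
    exact hΦ.inner ℝ (by fun_prop)
  simp only [rot_mul hφ (hG _ _), Finset.sum_add_distrib]
  rw [angDiv_eq_sum_rot hΦ p ht, sum_inner_rotVec_sphere p.2 (inner_angGrad_self hφ p)]
  have e : (amb p).2 = (p.2 : E d) := rfl
  simp only [← e, inner_angGrad_rotVec hφ, Finset.mul_sum]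
  rw [add_comm (∑ i, ∑ j, _)]
  simp only [← Finset.sum_add_distrib]
  rw [Finset.mul_sum]
  refine Finset.sum_congr rfl fun i _ => ?_
  rw [Finset.mul_sum]
  refine Finset.sum_congr rfl fun j _ => ?_
  ring

end Calculus

/-! ### Integration by parts on the sphere -/

section Parts

variable {d : ℕ}

theorem integrable_comp_amb {F : Type*} [NormedAddCommGroup F] {μ : Measure (E d × S d)}
    [IsFiniteMeasureOnCompacts μ] {g : E d × E d → F} (hg : Continuous g)
    (hc : HasCompactSupport g) : Integrable (fun p => g (amb p)) μ :=
  (hg.comp (isClosedEmbedding_amb d).continuous).integrable_of_hasCompactSupport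
    (hc.comp_isClosedEmbedding (isClosedEmbedding_amb d))

theorem IsTestV.integrable {φ : E d × E d → ℝ} (h : IsTestV φ) (μ : Measure (E d × S d))
    [IsFiniteMeasureOnCompacts μ] : Integrable (fun p => φ (amb p)) μ :=
  integrable_comp_amb h.smooth.continuous h.compact

theorem integral_rot {φ : E d × E d → ℝ} (h : IsTestV φ) (i j : Fin (d + 1)) (ν : Measure (E d))
    [IsFiniteMeasureOnCompacts ν] [SFinite ν] :
    ∫ p, rot i j φ (amb p) ∂(ν.prod (sphereMeasure d)) = 0 := by
  rw [integral_prod _ ((h.rot i j).integrable _)]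
  refine integral_eq_zero_of_ae (Eventually.of_forall fun x => ?_)
  have hs : ContDiff ℝ 1 fun η => φ (x, η) := by
    have := h.smooth.of_le (show (1 : WithTop ℕ∞) ≤ ∞ by simp)
    fun_prop
  have := integral_fderiv_rotVec hs i j
  rw [Pi.zero_apply, ← this]
  refine integral_congr_ae (Eventually.of_forall fun θ => ?_)
  simp only [rot, amb]
  rw [show fderiv ℝ (fun η => φ (x, η)) (θ : E d) = _ from fderiv_snd h.smooth (x, (θ : E d))]
  simp

theorem isAngGrad_of_smooth {φ : E d × E d → ℝ} (hφ : ContDiff ℝ ∞ φ) {u : L2Q d} {w : L2QVec d}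
    (hu : ∀ᵐ p ∂(measQ d), u p = φ (amb p)) (hw : ∀ᵐ p ∂(measQ d), w p = angGrad φ (amb p)) :
    IsAngGrad u w := by
  refine ⟨hw.mono fun p hp => by rw [hp, inner_angGrad_self hφ], fun Φ hΦ ht => ?_⟩
  have hT : ∀ i j, IsTestV fun q : E d × E d => φ q * inner ℝ (Φ q) (rotVec i j q.2) := by
    intro i j
    refine ⟨hφ.mul (hΦ.smooth.inner ℝ (by fun_prop)), HasCompactSupport.intro hΦ.compact ?_⟩
    intro q hq
    rw [image_eq_zero_of_notMem_tsupport hq]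
    simp
  have h0 : ∫ p, (inner ℝ (angGrad φ (amb p)) (Φ (amb p)) + φ (amb p) * angDiv Φ (amb p))
      ∂(measQ d) = 0 := by
    simp only [inner_angGrad_add_mul_angDiv hφ hΦ.smooth _ (ht _)]
    rw [integral_const_mul, integral_finsetSum]
    · rw [Finset.sum_eq_zero, mul_zero]
      intro i _
      rw [integral_finsetSum _ fun j _ => ((hT i j).rot i j).integrable _]
      exact Finset.sum_eq_zero fun j _ => integral_rot (hT i j) i j _
    · intro i _
      exact integrable_finsetSum _ fun j _ => ((hT i j).rot i j).integrable _
  have e1 : ∫ p, inner ℝ (w p) (Φ (amb p)) ∂(measQ d)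
      = ∫ p, inner ℝ (angGrad φ (amb p)) (Φ (amb p)) ∂(measQ d) :=
    integral_congr_ae (hw.mono fun p hp => by simp only [hp])
  have e2 : ∫ p, u p * angDiv Φ (amb p) ∂(measQ d)
      = ∫ p, φ (amb p) * angDiv Φ (amb p) ∂(measQ d) :=
    integral_congr_ae (hu.mono fun p hp => by simp only [hp])
  have i2 : Integrable (fun p => φ (amb p) * angDiv Φ (amb p)) (measQ d) :=
    ((Lp.memLp u).integrable_mul (memLp_angDiv hΦ)).congr (hu.mono fun p hp => by
      simp only [Pi.mul_apply, hp])
  have i1 : Integrable (fun p => inner ℝ (angGrad φ (amb p)) (Φ (amb p))) (measQ d) := by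
    refine integrable_comp_amb (g := fun q => inner ℝ (angGrad φ q) (Φ q))
      ((continuous_angGrad hφ).inner hΦ.smooth.continuous)
      (HasCompactSupport.intro hΦ.compact fun q hq => ?_)
    rw [image_eq_zero_of_notMem_tsupport hq, inner_zero_right]
  rw [integral_add i1 i2] at h0
  rw [e1, e2]
  linarith

end Parts

section Extension

variable {d : ℕ}

theorem continuous_last {d : ℕ} : Continuous fun x : E d => x (Fin.last d) := by fun_prop

theorem measurableSet_halfSpace (d : ℕ) : MeasurableSet (halfSpace d) :=
  (isOpen_lt continuous_const continuous_last).measurableSet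

theorem ae_measQ_mem (d : ℕ) : ∀ᵐ p ∂(measQ d), p.1 ∈ halfSpace d := by
  have : ∀ᵐ x ∂((volume : Measure (E d)).restrict (halfSpace d)), x ∈ halfSpace d :=
    ae_restrict_mem (measurableSet_halfSpace d)
  exact Measure.quasiMeasurePreserving_fst.ae this

/-- Multiplication of a test function by a cutoff vanishing near the boundary. -/
theorem IsTestV.mul_cutoff {φ : E d × E d → ℝ} (h : IsTestV φ) {k : ℝ} (hk : 0 < k) :
    IsTestQ (fun q : E d × E d => Real.smoothTransition (k * q.1 (Fin.last d) - 1) * φ q) := by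
  have hs : ContDiff ℝ ∞ fun q : E d × E d =>
      Real.smoothTransition (k * q.1 (Fin.last d) - 1) :=
    Real.smoothTransition.contDiff.comp (by fun_prop)
  refine ⟨hs.mul h.smooth, h.compact.mul_left, ?_⟩
  have hc : IsClosed {q : E d × E d | 1 / k ≤ q.1 (Fin.last d)} :=
    isClosed_le continuous_const (by fun_prop)
  refine (closure_minimal (fun q hq => ?_) hc).trans fun q hq => ?_
  · by_contra hlt
    refine hq ?_
    have : q.1 (Fin.last d) < 1 / k := not_le.1 hlt
    rw [lt_div_iff₀ hk] at this
    simp only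
    rw [Real.smoothTransition.zero_of_nonpos (by linarith), zero_mul]
  · have : 1 / k ≤ q.1 (Fin.last d) := hq
    exact lt_of_lt_of_le (by positivity) this

theorem tendsto_cutoff {t : ℝ} (ht : 0 < t) :
    Tendsto (fun k : ℕ => Real.smoothTransition (((k : ℝ) + 1) * t - 1)) atTop (𝓝 1) := by
  refine tendsto_const_nhds.congr' ?_
  filter_upwards [eventually_ge_atTop ⌈2 / t⌉₊] with k hk
  rw [Real.smoothTransition.one_of_one_le]
  have h1 : 2 / t ≤ (k : ℝ) := (Nat.le_ceil _).trans (by exact_mod_cast hk)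
  rw [div_le_iff₀ ht] at h1
  linarith

theorem tendsto_integral_cutoff {G : E d × S d → ℝ} (hG : Integrable G (measQ d)) :
    Tendsto (fun k : ℕ => ∫ p, Real.smoothTransition (((k : ℝ) + 1) * p.1 (Fin.last d) - 1) * G p
      ∂(measQ d)) atTop (𝓝 (∫ p, G p ∂(measQ d))) := by
  have hm : ∀ k : ℕ, Continuous fun p : E d × S d =>
      Real.smoothTransition (((k : ℝ) + 1) * p.1 (Fin.last d) - 1) := fun k =>
    Real.smoothTransition.continuous.comp (by fun_prop)
  refine tendsto_integral_of_dominated_convergence (fun p => ‖G p‖)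
    (fun k => (hm k).aestronglyMeasurable.mul hG.1) hG.norm (fun k => ?_) ?_
  · refine Eventually.of_forall fun p => ?_
    rw [norm_mul, Real.norm_of_nonneg (Real.smoothTransition.nonneg _)]
    exact mul_le_of_le_one_left (norm_nonneg _) (Real.smoothTransition.le_one _)
  · filter_upwards [ae_measQ_mem d] with p hp
    simpa using (tendsto_cutoff hp).mul_const (G p)

theorem integrable_L2_mul (u : L2Q d) {G : E d × S d → ℝ} (hG : MemLp G 2 (measQ d)) :
    Integrable (fun p => u p * G p) (measQ d) :=
  (Lp.memLp u).integrable_mul hG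

theorem IsTestV.memLp {F : Type*} [NormedAddCommGroup F] [NormedSpace ℝ F] {φ : E d × E d → F}
    (h : IsTestV φ) (μ : Measure (E d × S d)) [IsFiniteMeasureOnCompacts μ] :
    MemLp (fun p => φ (amb p)) 2 μ :=
  (h.smooth.continuous.comp (isClosedEmbedding_amb d).continuous).memLp_of_hasCompactSupport
    (h.compact.comp_isClosedEmbedding (isClosedEmbedding_amb d))

theorem memLp_inner_rotVec (w : L2QVec d) (i j : Fin (d + 1)) :
    MemLp (fun p => inner ℝ (w p) (rotVec i j (p.2 : E d))) 2 (measQ d) := by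
  have hm : AEStronglyMeasurable (fun p => inner ℝ (w p) (rotVec i j (p.2 : E d))) (measQ d) :=
    (Lp.memLp w).1.inner (by
      have : Continuous fun p : E d × S d => rotVec i j (p.2 : E d) := by fun_prop
      exact this.aestronglyMeasurable)
  refine (Lp.memLp w).of_le_mul (c := 2) hm (Eventually.of_forall fun p => ?_)
  refine (norm_inner_le_norm _ _).trans ?_
  have := norm_rotVec_le i j (p.2 : E d)
  rw [norm_eq_of_mem_sphere, mul_one] at this
  rw [mul_comm]
  gcongr

theorem angDiv_smul_rotVec {φ : E d × E d → ℝ} (hφ : ContDiff ℝ ∞ φ) (i j : Fin (d + 1))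
    (p : E d × S d) :
    angDiv (fun q => φ q • rotVec i j q.2) (amb p) = rot i j φ (amb p) := by
  have h1 : ContDiff ℝ ∞ fun q : E d × E d => rotVec i j q.2 := by fun_prop
  have hd : fderiv ℝ (fun η => φ ((amb p).1, η) • rotVec i j η) (amb p).2
      = φ (amb p) • rotVec i j
        + ((fderiv ℝ φ (amb p)).comp (ContinuousLinearMap.inr ℝ (E d) (E d))).smulRight
          (rotVec i j (amb p).2) := by
    have a := ((hasFDerivAt_of_smooth hφ (amb p)).comp (amb p).2
      (hasFDerivAt_prodMk_right (amb p).1 (amb p).2)).smul (rotVec i j).hasFDerivAt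
    exact a.fderiv
  have e : (amb p).2 = (p.2 : E d) := rfl
  rw [angDiv]
  simp only [hd]
  have tr : ∀ L : E d →L[ℝ] ℝ, ∀ a : E d,
      LinearMap.trace ℝ (E d) (L.smulRight a).toLinearMap = L a := by
    intro L a
    exact LinearMap.trace_smulRight _ _
  have tr2 : LinearMap.trace ℝ (E d) (rotVec (d := d) i j).toLinearMap = 0 := by
    rw [LinearMap.trace_eq_sum_inner _ (EuclideanSpace.basisFun (Fin (d + 1)) ℝ)]
    refine Finset.sum_eq_zero fun k _ => inner_rotVec_self i j _
  have hi : inner ℝ (rotVec i j (p.2 : E d)) (p.2 : E d) = 0 := by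
    rw [real_inner_comm, inner_rotVec_self]
  rw [ContinuousLinearMap.toLinearMap_add, ContinuousLinearMap.toLinearMap_smul, map_add, map_smul,
    tr, tr2]
  simp [e, inner_add_left, inner_smul_left, hi, rot]

/-- The weak angular gradient tested against infinitesimal rotations; the test functions need not
vanish near the boundary of the half-space. -/
theorem IsAngGrad.integral_rot {u : L2Q d} {w : L2QVec d} (h : IsAngGrad u w)
    {φ : E d × E d → ℝ} (hφ : IsTestV φ) (i j : Fin (d + 1)) :
    ∫ p, u p * rot i j φ (amb p) ∂(measQ d)
      = - ∫ p, inner ℝ (w p) (rotVec i j (p.2 : E d)) * φ (amb p) ∂(measQ d) := by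
  have key : ∀ ψ : E d × E d → ℝ, IsTestQ ψ → ∫ p, u p * rot i j ψ (amb p) ∂(measQ d)
      = - ∫ p, inner ℝ (w p) (rotVec i j (p.2 : E d)) * ψ (amb p) ∂(measQ d) := by
    intro ψ hψ
    have hT : IsTestQ fun q : E d × E d => ψ q • rotVec i j q.2 :=
      ⟨hψ.smooth.smul (by fun_prop), hψ.compact.smul_right,
        (closure_mono (Function.support_smul_subset_left _ _)).trans hψ.supp⟩
    have := h.2 _ hT fun p => by
      rw [inner_smul_left, real_inner_comm]
      simp [amb, inner_rotVec_self]
    simp only [angDiv_smul_rotVec hψ.smooth] at this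
    rw [eq_neg_iff_add_eq_zero, add_comm, ← eq_neg_iff_add_eq_zero, ← this]
    refine integral_congr_ae (Eventually.of_forall fun p => ?_)
    simp only [inner_smul_right, mul_comm, amb]
  have hs : ∀ k : ℕ, ContDiff ℝ ∞ fun x : E d =>
      Real.smoothTransition (((k : ℝ) + 1) * x (Fin.last d) - 1) := fun k =>
    Real.smoothTransition.contDiff.comp (by fun_prop)
  have hs' : ∀ k : ℕ, ContDiff ℝ ∞ fun q : E d × E d =>
      Real.smoothTransition (((k : ℝ) + 1) * q.1 (Fin.last d) - 1) := fun k =>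
    (hs k).comp contDiff_fst
  have l1 := tendsto_integral_cutoff (integrable_L2_mul u ((hφ.rot i j).memLp (measQ d)))
  have l2 := tendsto_integral_cutoff
    ((memLp_inner_rotVec w i j).integrable_mul (hφ.memLp (measQ d)))
  refine tendsto_nhds_unique l1 (l2.neg.congr fun k => ?_)
  have := key _ (hφ.mul_cutoff (k := (k : ℝ) + 1) (by positivity))
  have e : ∀ p : E d × S d, rot i j (fun q : E d × E d =>
      Real.smoothTransition (((k : ℝ) + 1) * q.1 (Fin.last d) - 1) * φ q) (amb p)
      = Real.smoothTransition (((k : ℝ) + 1) * p.1 (Fin.last d) - 1) * rot i j φ (amb p) := by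
    intro p
    rw [rot_mul (hs' k) hφ.smooth, rot_comp_fst (hs k)]
    simp [amb]
  simp only [e] at this
  rw [neg_eq_iff_eq_neg]
  refine Eq.trans ?_ ((neg_eq_iff_eq_neg.2 this).symm.trans ?_)
  · refine integral_congr_ae (Eventually.of_forall fun p => ?_)
    simp only [Pi.mul_apply, amb]
    ring
  · congr 1
    refine integral_congr_ae (Eventually.of_forall fun p => ?_)
    simp only
    ring

end Extension

/-! ### Green's formula in the half-space -/

section Green

variable {d : ℕ}

theorem isClosedEmbedding_prodMkLeft {A B : Type*} [TopologicalSpace A] [TopologicalSpace B]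
    [T1Space B] (b : B) : IsClosedEmbedding fun a : A => (a, b) :=
  ⟨isEmbedding_prodMkLeft b, by
    have : Set.range (fun a : A => (a, b)) = Prod.snd ⁻¹' {b} := by
      ext ⟨x, y⟩
      simp [eq_comm]
    rw [this]
    exact isClosed_singleton.preimage continuous_snd⟩

theorem isClosedEmbedding_prodMkRight {A B : Type*} [TopologicalSpace A] [TopologicalSpace B]
    [T1Space A] (a : A) : IsClosedEmbedding fun b : B => (a, b) :=
  ⟨isEmbedding_prodMkRight a, by
    have : Set.range (fun b : B => (a, b)) = Prod.fst ⁻¹' {a} := by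
      ext ⟨x, y⟩
      simp [eq_comm]
    rw [this]
    exact isClosed_singleton.preimage continuous_fst⟩

/-- The coordinates `(xⁿ, x')` of the half-space. -/
def slab (d : ℕ) : (ℝ × EuclideanSpace ℝ (Fin d)) →L[ℝ] E d :=
  LinearMap.toContinuousLinearMap
    { toFun := fun p => WithLp.toLp 2 (Fin.snoc (α := fun _ => ℝ) (fun i => p.2 i) p.1)
      map_add' := fun p q => by
        ext i
        refine Fin.lastCases ?_ (fun i => ?_) i <;> simp
      map_smul' := fun c p => by
        ext i
        refine Fin.lastCases ?_ (fun i => ?_) i <;> simp }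

theorem slab_last (p : ℝ × EuclideanSpace ℝ (Fin d)) : slab d p (Fin.last d) = p.1 := by
  simp [slab]

theorem slab_castSucc (p : ℝ × EuclideanSpace ℝ (Fin d)) (i : Fin d) :
    slab d p i.castSucc = p.2 i := by
  simp [slab]

theorem bdryEmb_eq (x' : EuclideanSpace ℝ (Fin d)) : bdryEmb d x' = slab d (0, x') := rfl

theorem slab_injective (d : ℕ) : Function.Injective (slab d) := by
  intro p q h
  ext i
  · rw [← slab_last p, h, slab_last]
  · rw [← slab_castSucc p, h, slab_castSucc]

theorem slab_surjective (v : E d) : ∃ p, slab d p = v := by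
  refine ⟨(v (Fin.last d), WithLp.toLp 2 fun i => v i.castSucc), ?_⟩
  ext i
  refine Fin.lastCases ?_ (fun i => ?_) i
  · rw [slab_last]
  · rw [slab_castSucc]

theorem isClosedEmbedding_slab (d : ℕ) : IsClosedEmbedding (slab d) :=
  LinearMap.isClosedEmbedding_of_injective (f := (slab d).toLinearMap)
    (LinearMap.ker_eq_bot.2 (slab_injective d))

theorem isClosedEmbedding_bdryEmb (d : ℕ) : IsClosedEmbedding (bdryEmb d) := by
  have : IsClosedEmbedding fun x' : EuclideanSpace ℝ (Fin d) => ((0 : ℝ), x') :=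
    isClosedEmbedding_prodMkRight 0
  exact (isClosedEmbedding_slab d).comp this

theorem measurePreserving_slab (d : ℕ) :
    MeasurePreserving (slab d) ((volume : Measure ℝ).prod volume) volume := by
  have h1 := (MeasurePreserving.id (volume : Measure ℝ)).prod (PiLp.volume_preserving_ofLp (Fin d))
  have h2 := (volume_preserving_piFinSuccAbove (fun _ : Fin (d + 1) => ℝ) (Fin.last d)).symm
  have h3 := PiLp.volume_preserving_toLp (Fin (d + 1))
  have h4 := h3.comp (h2.comp h1)
  have e : (slab d : (ℝ × EuclideanSpace ℝ (Fin d)) → E d) = WithLp.toLp 2 ∘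
      (MeasurableEquiv.piFinSuccAbove (fun _ : Fin (d + 1) => ℝ) (Fin.last d)).symm ∘
      Prod.map id WithLp.ofLp := by
    funext p
    ext i
    refine Fin.lastCases ?_ (fun i => ?_) i
    · rw [slab_last]
      simp [MeasurableEquiv.piFinSuccAbove]
    · rw [slab_castSucc]
      simp [MeasurableEquiv.piFinSuccAbove]
  rw [e]
  exact h4

theorem integral_fderiv_eq_zero {G : Type*} [NormedAddCommGroup G] [NormedSpace ℝ G]
    [FiniteDimensional ℝ G] [MeasurableSpace G] [BorelSpace G] (μ : Measure G)
    [μ.IsAddHaarMeasure] {f : G → ℝ} (hf : ContDiff ℝ 1 f) (hc : HasCompactSupport f) (v : G) :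
    ∫ x, fderiv ℝ f x v ∂μ = 0 := by
  have hi : Integrable (fun x => fderiv ℝ f x v) μ := by
    refine Continuous.integrable_of_hasCompactSupport ?_ ?_
    · have := hf.continuous_fderiv (by simp)
      fun_prop
    · exact hc.fderiv_apply (𝕜 := ℝ) v
  have := integral_mul_fderiv_eq_neg_fderiv_mul_of_integrable (μ := μ) (f := fun _ => (1 : ℝ))
    (g := f) (v := v) (by simp) (by simpa using hi)
    (by simpa using hf.continuous.integrable_of_hasCompactSupport hc) (by simp)
    (fun x _ => hf.differentiable (by simp) x)
  simpa using this

theorem setIntegral_halfSpace_fderiv {f : E d → ℝ} (hf : ContDiff ℝ 1 f)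
    (hc : HasCompactSupport f) (v : E d) :
    ∫ x in halfSpace d, fderiv ℝ f x v = - v (Fin.last d) * ∫ x', f (bdryEmb d x') := by
  obtain ⟨⟨a, v'⟩, rfl⟩ := slab_surjective v
  have hemb := (isClosedEmbedding_slab d).measurableEmbedding
  rw [← (measurePreserving_slab d).setIntegral_preimage_emb hemb]
  have hpre : slab d ⁻¹' halfSpace d = Set.Ioi 0 ×ˢ Set.univ := by
    ext p
    simp [halfSpace, slab_last]
  rw [hpre, ← Measure.prod_restrict, Measure.restrict_univ, slab_last]
  let F : ℝ × EuclideanSpace ℝ (Fin d) → ℝ := f ∘ slab d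
  have hF : ContDiff ℝ 1 F := hf.comp (slab d).contDiff
  have hFc : HasCompactSupport F := hc.comp_isClosedEmbedding (isClosedEmbedding_slab d)
  have hFd : ∀ p w, fderiv ℝ f (slab d p) (slab d w) = fderiv ℝ F p w := by
    intro p w
    have := ((hf.differentiable (by simp) (slab d p)).hasFDerivAt.comp p
      (slab d).hasFDerivAt).fderiv
    rw [show fderiv ℝ F p = _ from this]
    rfl
  simp only [hFd]
  have hsplit : ∀ p, fderiv ℝ F p (a, v') = a * fderiv ℝ F p (1, 0) + fderiv ℝ F p (0, v') := by
    intro p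
    have : ((a, v') : ℝ × EuclideanSpace ℝ (Fin d)) = a • (1, 0) + (0, v') := by
      ext <;> simp
    rw [this, map_add, map_smul, smul_eq_mul]
  have hi : ∀ w, Integrable (fun p => fderiv ℝ F p w)
      (((volume : Measure ℝ).restrict (Set.Ioi 0)).prod volume) := by
    intro w
    refine Continuous.integrable_of_hasCompactSupport ?_ (hFc.fderiv_apply (𝕜 := ℝ) w)
    have := hF.continuous_fderiv (by simp)
    fun_prop
  have hsl1 : ∀ t, HasCompactSupport fun x' => F (t, x') := fun t =>
    hFc.comp_isClosedEmbedding (isClosedEmbedding_prodMkRight t)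
  have hsl2 : ∀ x', HasCompactSupport fun t => F (t, x') := fun x' =>
    hFc.comp_isClosedEmbedding (isClosedEmbedding_prodMkLeft x')
  simp only [hsplit]
  rw [integral_add ((hi _).const_mul a) (hi _), integral_const_mul]
  have e2 : ∫ p, fderiv ℝ F p (0, v')
      ∂(((volume : Measure ℝ).restrict (Set.Ioi 0)).prod volume) = 0 := by
    rw [integral_prod _ (hi _)]
    refine integral_eq_zero_of_ae (Eventually.of_forall fun t => ?_)
    have hd : ∀ x', fderiv ℝ F (t, x') (0, v') = fderiv ℝ (fun x' => F (t, x')) x' v' := by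
      intro x'
      have := ((hF.differentiable (by simp) (t, x')).hasFDerivAt.comp x'
        (hasFDerivAt_prodMk_right t x')).fderiv
      rw [show fderiv ℝ (fun x' => F (t, x')) x' = _ from this]
      simp
    simp only [hd]
    exact integral_fderiv_eq_zero volume (hF.comp (contDiff_const.prodMk contDiff_id)) (hsl1 t) v'
  have e1 : ∫ p, fderiv ℝ F p (1, 0)
      ∂(((volume : Measure ℝ).restrict (Set.Ioi 0)).prod volume) = - ∫ x', F (0, x') := by
    rw [integral_prod_symm _ (hi _), ← integral_neg]
    refine integral_congr_ae (Eventually.of_forall fun x' => ?_)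
    have hd : ∀ t, fderiv ℝ F (t, x') (1, 0) = deriv (fun t => F (t, x')) t := by
      intro t
      have := ((hF.differentiable (by simp) (t, x')).hasFDerivAt.comp t
        (hasFDerivAt_prodMk_left t x')).hasDerivAt.deriv
      rw [show deriv (fun t => F (t, x')) t = _ from this]
      simp
    simp only [hd]
    exact (hsl2 x').integral_Ioi_deriv_eq (hF.comp (contDiff_id.prodMk contDiff_const)) 0
  rw [e1, e2]
  simp only [F, Function.comp, bdryEmb_eq]
  ring

instance (d : ℕ) : SFinite (surfMeasure d) := by
  unfold surfMeasure; infer_instance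

instance (d : ℕ) : IsFiniteMeasureOnCompacts (surfMeasure d) := by
  refine ⟨fun K hK => ?_⟩
  rw [surfMeasure, (isClosedEmbedding_bdryEmb d).measurableEmbedding.map_apply]
  exact ((isClosedEmbedding_bdryEmb d).isCompact_preimage hK).measure_lt_top

theorem bdryMeasure_le (d : ℕ) (G : Set (E d × S d)) :
    bdryMeasure d G ≤ (surfMeasure d).prod (sphereMeasure d) := by
  refine le_trans ?_ (Measure.restrict_le_self (s := G))
  unfold bdryMeasure
  conv_rhs => rw [← withDensity_one (μ := ((surfMeasure d).prod (sphereMeasure d)).restrict G)]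
  refine withDensity_mono (Eventually.of_forall fun p => ?_)
  rw [Pi.one_apply, ENNReal.ofReal_le_one]
  refine (abs_real_inner_le_norm _ _).trans ?_
  rw [norm_eq_of_mem_sphere]
  simp [normal]

instance (d : ℕ) (G : Set (E d × S d)) : IsFiniteMeasureOnCompacts (bdryMeasure d G) :=
  ⟨fun K hK => (bdryMeasure_le d G K).trans_lt hK.measure_lt_top⟩

theorem inner_normal (η : E d) : inner ℝ η (normal d) = - η (Fin.last d) := by
  simp [normal, inner_neg_right, EuclideanSpace.inner_single_right]

theorem measurableSet_GammaPlus (d : ℕ) : MeasurableSet (GammaPlus d) :=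
  (measurableSet_eq_fun (f := fun p : E d × S d => p.1 (Fin.last d)) (g := fun _ => 0)
    (Continuous.measurable (by fun_prop)) measurable_const).inter
    (isOpen_lt (f := fun _ : E d × S d => (0 : ℝ))
      (g := fun p : E d × S d => inner ℝ (p.2 : E d) (normal d)) continuous_const
      (by fun_prop)).measurableSet

theorem measurableSet_GammaMinus (d : ℕ) : MeasurableSet (GammaMinus d) :=
  (measurableSet_eq_fun (f := fun p : E d × S d => p.1 (Fin.last d)) (g := fun _ => 0)
    (Continuous.measurable (by fun_prop)) measurable_const).inter
    (isOpen_lt (g := fun _ : E d × S d => (0 : ℝ))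
      (f := fun p : E d × S d => inner ℝ (p.2 : E d) (normal d)) (by fun_prop)
      continuous_const).measurableSet

theorem integral_bdryMeasure {G : Set (E d × S d)} (hG : MeasurableSet G) (f : E d × S d → ℝ) :
    ∫ p, f p ∂(bdryMeasure d G)
      = ∫ p, G.indicator (fun p => |inner ℝ (p.2 : E d) (normal d)| * f p) p
        ∂((surfMeasure d).prod (sphereMeasure d)) := by
  rw [bdryMeasure, integral_withDensity_eq_integral_toReal_smul, integral_indicator hG]
  · refine integral_congr_ae (Eventually.of_forall fun p => ?_)
    simp
  · exact (Continuous.measurable (by fun_prop)).ennreal_ofReal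
  · exact Eventually.of_forall fun p => ENNReal.ofReal_lt_top

theorem integral_transport {F : E d × E d → ℝ} (hF : IsTestV F) :
    ∫ p, transport F (amb p) ∂(measQ d)
      = ∫ p, F (amb p) ∂(bdryMeasure d (GammaPlus d))
        - ∫ p, F (amb p) ∂(bdryMeasure d (GammaMinus d)) := by
  have hslice : ∀ θ : S d, ContDiff ℝ 1 fun y : E d => F (y, (θ : E d)) := fun θ =>
    (hF.smooth.of_le (by simp)).comp (contDiff_id.prodMk contDiff_const)
  have hslc : ∀ θ : S d, HasCompactSupport fun y : E d => F (y, (θ : E d)) := fun θ =>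
    hF.compact.comp_isClosedEmbedding (isClosedEmbedding_prodMkLeft (θ : E d))
  have h1 : ∫ p, transport F (amb p) ∂(measQ d)
      = ∫ p, F (amb p) * inner ℝ (p.2 : E d) (normal d)
        ∂((surfMeasure d).prod (sphereMeasure d)) := by
    have hi : Integrable (fun p : E d × S d => F (amb p) * inner ℝ (p.2 : E d) (normal d))
        ((surfMeasure d).prod (sphereMeasure d)) :=
      (hF.mul_right (χ := fun q => inner ℝ q.2 (normal d))
        (contDiff_snd.inner ℝ contDiff_const)).integrable _
    rw [integral_prod_symm _ hi, measQ, integral_prod_symm _ (hF.transport.integrable _)]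
    refine integral_congr_ae (Eventually.of_forall fun θ => ?_)
    simp only
    rw [integral_mul_const, inner_normal, surfMeasure,
      (isClosedEmbedding_bdryEmb d).measurableEmbedding.integral_map]
    refine (setIntegral_halfSpace_fderiv (hslice θ) (hslc θ) (θ : E d)).trans ?_
    rw [mul_comm]
    rfl
  have hae : ∀ᵐ p ∂((surfMeasure d).prod (sphereMeasure d)), p.1 (Fin.last d) = 0 := by
    have : ∀ᵐ x ∂(surfMeasure d), x (Fin.last d) = 0 := by
      rw [surfMeasure, (isClosedEmbedding_bdryEmb d).measurableEmbedding.ae_map_iff]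
      exact Eventually.of_forall fun x' => by rw [bdryEmb_eq, slab_last]
    exact Measure.quasiMeasurePreserving_fst.ae this
  have hi : Integrable (fun p : E d × S d => |inner ℝ (p.2 : E d) (normal d)| * F (amb p))
      ((surfMeasure d).prod (sphereMeasure d)) :=
    integrable_comp_amb (g := fun q => |inner ℝ q.2 (normal d)| * F q)
      ((by fun_prop : Continuous fun q : E d × E d => |inner ℝ q.2 (normal d)|).mul
        hF.smooth.continuous) hF.compact.mul_left
  rw [h1, integral_bdryMeasure (measurableSet_GammaPlus d),
    integral_bdryMeasure (measurableSet_GammaMinus d),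
    ← integral_sub (hi.indicator (measurableSet_GammaPlus d))
      (hi.indicator (measurableSet_GammaMinus d))]
  refine integral_congr_ae ?_
  filter_upwards [hae] with p hp
  simp only [Set.indicator, GammaPlus, GammaMinus, Set.mem_ofPred_eq, hp, true_and]
  rcases lt_trichotomy (inner ℝ (p.2 : E d) (normal d)) 0 with h | h | h
  · rw [if_neg h.not_gt, if_pos h, abs_of_neg h]; ring
  · simp [h]
  · rw [if_pos h, if_neg h.not_gt, abs_of_pos h]; ring

end Green

/-! ### Integral operators on `L²` -/

section Schur

variable {X : Type*} [MeasurableSpace X] {m : Measure X}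

theorem sq_eLpNorm_two {F : Type*} [NormedAddCommGroup F] (f : X → F) :
    eLpNorm f 2 m ^ 2 = ∫⁻ x, ‖f x‖ₑ ^ 2 ∂m := by
  have := eLpNorm_nnreal_pow_eq_lintegral (f := f) (p := 2) (μ := m) (by simp)
  simpa using this

theorem sq_lintegral_mul_le {k f : X → ENNReal} (hk : AEMeasurable k m) (hf : AEMeasurable f m) :
    (∫⁻ p, k p * f p ∂m) ^ 2 ≤ (∫⁻ p, k p ∂m) * ∫⁻ p, k p * f p ^ 2 ∂m := by
  have h := ENNReal.lintegral_mul_le_Lp_mul_Lq m Real.HolderConjugate.two_two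
    (hk.pow_const (1 / 2 : ℝ)) ((hk.pow_const (1 / 2 : ℝ)).mul hf)
  have e1 : ∀ a : ENNReal, a ^ (1 / 2 : ℝ) * a ^ (1 / 2 : ℝ) = a := fun a => by
    rw [← ENNReal.rpow_add_of_nonneg _ _ (by norm_num) (by norm_num)]; norm_num
  have e2 : ∀ a : ENNReal, (a ^ (1 / 2 : ℝ)) ^ (2 : ℝ) = a := fun a => by
    rw [← ENNReal.rpow_mul]; norm_num
  simp only [Pi.mul_apply, ← mul_assoc, e1, e2] at h
  have e3 : ∀ a : ENNReal, (a ^ (1 / 2 : ℝ)) ^ 2 = a := fun a => by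
    rw [← ENNReal.rpow_natCast, ← ENNReal.rpow_mul]; norm_num
  have e4 : ∀ p, (k p ^ (1 / 2 : ℝ) * f p) ^ (2 : ℝ) = k p * f p ^ 2 := fun p => by
    rw [ENNReal.mul_rpow_of_nonneg _ _ (by norm_num), e2]
    norm_num
  simp only [e4] at h
  refine (pow_le_pow_left' h 2).trans_eq ?_
  rw [mul_pow, e3, e3]

theorem sq_lintegral_kernel_le [SFinite m] {k : X → X → ENNReal}
    (hk : Measurable (Function.uncurry k))
    {A : ENNReal} (h1 : ∀ q, ∫⁻ p, k q p ∂m ≤ A) (h2 : ∀ p, ∫⁻ q, k q p ∂m ≤ A) {f : X → ENNReal}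
    (hf : AEMeasurable f m) :
    ∫⁻ q, (∫⁻ p, k q p * f p ∂m) ^ 2 ∂m ≤ A ^ 2 * ∫⁻ p, f p ^ 2 ∂m := by
  have hkq : ∀ q, Measurable (k q) := fun q => hk.comp measurable_prodMk_left
  have hkp : ∀ p, Measurable fun q => k q p := fun p => hk.comp measurable_prodMk_right
  calc ∫⁻ q, (∫⁻ p, k q p * f p ∂m) ^ 2 ∂m
      ≤ ∫⁻ q, A * ∫⁻ p, k q p * f p ^ 2 ∂m ∂m := by
        refine lintegral_mono fun q => ?_
        refine (sq_lintegral_mul_le (hkq q).aemeasurable hf).trans ?_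
        gcongr
        exact h1 q
    _ = A * ∫⁻ p, ∫⁻ q, k q p * f p ^ 2 ∂m ∂m := by
        have hm : AEMeasurable (Function.uncurry fun q p => k q p * f p ^ 2) (m.prod m) :=
          hk.aemeasurable.mul ((hf.pow_const 2).comp_quasiMeasurePreserving
            Measure.quasiMeasurePreserving_snd)
        rw [← lintegral_lintegral_swap hm]
        exact lintegral_const_mul'' _ hm.lintegral_prod_right'
    _ ≤ A * ∫⁻ p, A * f p ^ 2 ∂m := by
        gcongr with p
        rw [lintegral_mul_const _ (hkp p)]
        gcongr
        exact h2 p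
    _ = A ^ 2 * ∫⁻ p, f p ^ 2 ∂m := by
        rw [lintegral_const_mul'' _ (hf.pow_const 2), ← mul_assoc, sq]

theorem eLpNorm_integral_kernel_le [SFinite m] {k : X → X → ℝ}
    (hk : Measurable (Function.uncurry k))
    {A : ENNReal} (h1 : ∀ q, ∫⁻ p, ‖k q p‖ₑ ∂m ≤ A) (h2 : ∀ p, ∫⁻ q, ‖k q p‖ₑ ∂m ≤ A) {f : X → ℝ}
    (hf : AEStronglyMeasurable f m) :
    eLpNorm (fun q => ∫ p, f p * k q p ∂m) 2 m ≤ A * eLpNorm f 2 m := by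
  rw [← ENNReal.pow_le_pow_left_iff two_ne_zero, mul_pow, sq_eLpNorm_two, sq_eLpNorm_two]
  refine le_trans (lintegral_mono fun q => ?_)
    (sq_lintegral_kernel_le (k := fun q p => ‖k q p‖ₑ) hk.enorm h1 h2 hf.enorm)
  gcongr
  refine (enorm_integral_le_lintegral_enorm _).trans (lintegral_mono fun p => ?_)
  simp [enorm_mul, mul_comm]

theorem integrable_kernel_mul [SFinite m] {k : X → X → ℝ}
    (hk : Measurable (Function.uncurry k))
    {A : ENNReal} (hA : A ≠ ⊤) (h1 : ∀ q, ∫⁻ p, ‖k q p‖ₑ ∂m ≤ A)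
    (h2 : ∀ p, ∫⁻ q, ‖k q p‖ₑ ∂m ≤ A) {f g : X → ℝ}
    (hf : MemLp f 2 m) (hg : MemLp g 2 m) :
    Integrable (fun z : X × X => g z.1 * (f z.2 * k z.1 z.2)) (m.prod m) := by
  have hmeas : AEStronglyMeasurable (fun z : X × X => g z.1 * (f z.2 * k z.1 z.2)) (m.prod m) :=
    hg.1.comp_fst.mul (hf.1.comp_snd.mul hk.aestronglyMeasurable)
  refine ⟨hmeas, ?_⟩
  rw [HasFiniteIntegral, lintegral_prod _ hmeas.enorm]
  have hB := sq_lintegral_kernel_le (k := fun q p => ‖k q p‖ₑ) hk.enorm h1 h2 hf.1.enorm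
  rw [← sq_eLpNorm_two] at hB
  have hin : AEMeasurable (fun q => ∫⁻ p, ‖k q p‖ₑ * ‖f p‖ₑ ∂m) m := by
    have : AEMeasurable (Function.uncurry fun q p => ‖k q p‖ₑ * ‖f p‖ₑ) (m.prod m) :=
      hk.enorm.aemeasurable.mul hf.1.comp_snd.enorm
    exact this.lintegral_prod_right'
  have h3 := ENNReal.lintegral_mul_le_Lp_mul_Lq m Real.HolderConjugate.two_two hg.1.enorm hin
  have e : ∀ q, ∫⁻ p, ‖g q * (f p * k q p)‖ₑ ∂m = ‖g q‖ₑ * ∫⁻ p, ‖k q p‖ₑ * ‖f p‖ₑ ∂m := by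
    intro q
    have hkq : Measurable (k q) := hk.comp measurable_prodMk_left
    have := lintegral_const_mul'' (μ := m) ‖g q‖ₑ (hkq.enorm.aemeasurable.mul hf.1.enorm)
    simp only [Pi.mul_apply] at this
    rw [← this]
    refine lintegral_congr fun p => ?_
    rw [enorm_mul, enorm_mul, mul_comm ‖f p‖ₑ]
  simp only [e]
  refine lt_of_le_of_lt h3 (ENNReal.mul_lt_top ?_ ?_)
  · refine ENNReal.rpow_lt_top_of_nonneg (by norm_num) ?_
    have : ∫⁻ q, ‖g q‖ₑ ^ (2 : ℝ) ∂m = eLpNorm g 2 m ^ 2 := by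
      rw [sq_eLpNorm_two]
      exact lintegral_congr fun q => by norm_num
    rw [this]
    exact ENNReal.pow_ne_top hg.2.ne
  · refine ENNReal.rpow_lt_top_of_nonneg (by norm_num) ?_
    have : ∫⁻ q, (∫⁻ p, ‖k q p‖ₑ * ‖f p‖ₑ ∂m) ^ (2 : ℝ) ∂m
        = ∫⁻ q, (∫⁻ p, ‖k q p‖ₑ * ‖f p‖ₑ ∂m) ^ 2 ∂m := lintegral_congr fun q => by norm_num
    rw [this]
    exact (lt_of_le_of_lt hB (ENNReal.mul_lt_top (ENNReal.pow_lt_top hA.lt_top)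
      (ENNReal.pow_lt_top hf.2))).ne

end Schur

section Limits

variable {X : Type*} [MeasurableSpace X] {m : Measure X}

/-- Convergence in `L²` of representatives. -/
def TendstoL2 (m : Measure X) (f : ℕ → X → ℝ) (g : X → ℝ) : Prop :=
  Tendsto (fun k => eLpNorm (fun x => f k x - g x) 2 m) atTop (𝓝 0)

theorem TendstoL2.integral_mul {f f' : ℕ → X → ℝ} {g g' : X → ℝ} (hf : ∀ k, MemLp (f k) 2 m)
    (hf' : ∀ k, MemLp (f' k) 2 m) (hg : MemLp g 2 m) (hg' : MemLp g' 2 m)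
    (h : TendstoL2 m f g) (h' : TendstoL2 m f' g') :
    Tendsto (fun k => ∫ x, f k x * f' k x ∂m) atTop (𝓝 (∫ x, g x * g' x ∂m)) := by
  have a : Tendsto (fun k => (hf k).toLp) atTop (𝓝 hg.toLp) :=
    (Lp.tendsto_Lp_iff_tendsto_eLpNorm'' _ hf _ hg).2 h
  have a' : Tendsto (fun k => (hf' k).toLp) atTop (𝓝 hg'.toLp) :=
    (Lp.tendsto_Lp_iff_tendsto_eLpNorm'' _ hf' _ hg').2 h'
  have key : ∀ {u v : X → ℝ} (hu : MemLp u 2 m) (hv : MemLp v 2 m),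
      inner ℝ hu.toLp hv.toLp = ∫ x, u x * v x ∂m := by
    intro u v hu hv
    rw [L2.inner_def]
    refine integral_congr_ae ?_
    filter_upwards [hu.coeFn_toLp, hv.coeFn_toLp] with x h1 h2
    rw [h1, h2]
    simp [mul_comm]
  have := a.inner (𝕜 := ℝ) a'
  simpa only [key] using this

theorem TendstoL2.const (g : X → ℝ) : TendstoL2 m (fun _ => g) g := by
  simp [TendstoL2]

theorem TendstoL2.of_le {f : ℕ → X → ℝ} {g : X → ℝ} (h : TendstoL2 m f g) {u : ℕ → X → ℝ}
    {v : X → ℝ} (c : ℝ)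
    (hle : ∀ k, ∀ᵐ x ∂m, ‖u k x - v x‖ ≤ c * ‖f k x - g x‖) : TendstoL2 m u v := by
  have h2 : Tendsto (fun k => ENNReal.ofReal c * eLpNorm (fun x => f k x - g x) 2 m) atTop
      (𝓝 (ENNReal.ofReal c * 0)) := ENNReal.Tendsto.const_mul h (by simp)
  rw [mul_zero] at h2
  refine tendsto_of_tendsto_of_tendsto_of_le_of_le tendsto_const_nhds h2 (fun _ => zero_le) ?_
  intro k
  exact eLpNorm_le_mul_eLpNorm_of_ae_le_mul (hle k) 2

theorem TendstoL2.add {f f' : ℕ → X → ℝ} {g g' : X → ℝ} (hf : ∀ k, MemLp (f k) 2 m)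
    (hf' : ∀ k, MemLp (f' k) 2 m) (hg : MemLp g 2 m) (hg' : MemLp g' 2 m)
    (h : TendstoL2 m f g) (h' : TendstoL2 m f' g') :
    TendstoL2 m (fun k x => f k x + f' k x) (fun x => g x + g' x) := by
  have h2 := Tendsto.add h h'
  rw [add_zero] at h2
  refine tendsto_of_tendsto_of_tendsto_of_le_of_le tendsto_const_nhds h2 (fun _ => zero_le) ?_
  intro k
  have e : (fun x => f k x + f' k x - (g x + g' x))
      = (fun x => f k x - g x) + fun x => f' k x - g' x := by
    funext x; simp only [Pi.add_apply]; ring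
  simp only [e]
  exact eLpNorm_add_le ((hf k).1.sub hg.1) ((hf' k).1.sub hg'.1) (by norm_num)

end Limits

/-! ### Mollification on `ℝⁿ × 𝕊ⁿ⁻¹` -/

/-- The measure `dx dθ` on the whole of `ℝⁿ × 𝕊ⁿ⁻¹`. -/
def fullMeasure (d : ℕ) : Measure (E d × S d) := (volume : Measure (E d)).prod (sphereMeasure d)

instance (d : ℕ) : IsFiniteMeasureOnCompacts (fullMeasure d) := by
  unfold fullMeasure; infer_instance

instance (d : ℕ) : SigmaFinite (fullMeasure d) := by
  unfold fullMeasure; infer_instance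

instance (d : ℕ) : IsLocallyFiniteMeasure (fullMeasure d) := by
  infer_instance

/-- The phase space `Q`. -/
def phase (d : ℕ) : Set (E d × S d) := {p | p.1 ∈ halfSpace d}

theorem measurableSet_phase (d : ℕ) : MeasurableSet (phase d) :=
  measurable_fst (measurableSet_halfSpace d)

theorem measQ_eq (d : ℕ) : measQ d = (fullMeasure d).restrict (phase d) := by
  rw [measQ, fullMeasure, ← Measure.restrict_univ (μ := sphereMeasure d), Measure.prod_restrict,
    Measure.restrict_univ]
  congr 1
  ext p
  simp [phase]

/-- The convolution of a function on `ℝⁿ × 𝕊ⁿ⁻¹` with a kernel on `ℝⁿ × ℝⁿ`. -/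
def moll {d : ℕ} (j : E d × E d → ℝ) (f : E d × S d → ℝ) (q : E d × E d) : ℝ :=
  ∫ p, f p * j (q - amb p) ∂(fullMeasure d)

section Moll

variable {d : ℕ}

theorem integrable_mul_kernel {j : E d × E d → ℝ} (hj : Continuous j) (hc : HasCompactSupport j)
    {f : E d × S d → ℝ} (hf : LocallyIntegrable f (fullMeasure d)) (q : E d × E d) :
    Integrable (fun p => f p * j (q - amb p)) (fullMeasure d) := by
  have hcont : Continuous fun p : E d × S d => j (q - amb p) :=
    hj.comp (continuous_const.sub (isClosedEmbedding_amb d).continuous)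
  have hcs : HasCompactSupport fun p : E d × S d => j (q - amb p) := by
    have h1 : HasCompactSupport fun x => j (q - x) :=
      hc.comp_homeomorph (Homeomorph.subLeft q)
    exact h1.comp_isClosedEmbedding (isClosedEmbedding_amb d)
  simpa [mul_comm] using hf.integrable_smul_left_of_hasCompactSupport hcont hcs

theorem moll_eq_convolution (j : E d × E d → ℝ) (f : E d × S d → ℝ) :
    moll j f = convolution (Function.extend amb f 0) j (ContinuousLinearMap.mul ℝ ℝ)
      (Measure.map amb (fullMeasure d)) := by
  funext q
  rw [moll, convolution_def, (isClosedEmbedding_amb d).measurableEmbedding.integral_map]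
  simp [(isClosedEmbedding_amb d).injective.extend_apply]

theorem locallyIntegrable_extend {f : E d × S d → ℝ} (hf : LocallyIntegrable f (fullMeasure d)) :
    LocallyIntegrable (Function.extend amb f 0) (Measure.map amb (fullMeasure d)) := by
  rw [locallyIntegrable_iff]
  intro K hK
  rw [(isClosedEmbedding_amb d).measurableEmbedding.integrableOn_map_iff]
  have : (Function.extend amb f 0) ∘ amb = f := by
    funext p
    simp [(isClosedEmbedding_amb d).injective.extend_apply]
  rw [this]
  exact hf.integrableOn_isCompact ((isClosedEmbedding_amb d).isCompact_preimage hK)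

theorem contDiff_moll {j : E d × E d → ℝ} (hj : IsTestV j) {f : E d × S d → ℝ}
    (hf : LocallyIntegrable f (fullMeasure d)) : ContDiff ℝ ∞ (moll j f) := by
  rw [moll_eq_convolution]
  exact hj.compact.contDiff_convolution_right _ (locallyIntegrable_extend hf) hj.smooth

open scoped Pointwise in
theorem fderiv_moll {j : E d × E d → ℝ} (hj : IsTestV j) {f : E d × S d → ℝ}
    (hf : LocallyIntegrable f (fullMeasure d)) (q v : E d × E d) :
    fderiv ℝ (moll j f) q v = ∫ p, f p * fderiv ℝ j (q - amb p) v ∂(fullMeasure d) := by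
  have hD := continuous_fderiv_of_smooth hj.smooth
  have hDc : HasCompactSupport (fderiv ℝ j) := hj.compact.fderiv (𝕜 := ℝ)
  obtain ⟨C, hC⟩ := hD.bounded_above_of_compact_support hDc
  have hamb : Continuous (amb (d := d)) := (isClosedEmbedding_amb d).continuous
  have hK : IsCompact (amb (d := d) ⁻¹' (Metric.closedBall q 1 - tsupport (fderiv ℝ j))) :=
    (isClosedEmbedding_amb d).isCompact_preimage
      (by
        rw [sub_eq_add_neg]
        exact IsCompact.add (isCompact_closedBall q 1) (IsCompact.neg hDc))
  set K := amb (d := d) ⁻¹' (Metric.closedBall q 1 - tsupport (fderiv ℝ j))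
  have hF' : ∀ x, AEStronglyMeasurable (fun p => f p • fderiv ℝ j (x - amb p)) (fullMeasure d) :=
    fun x => hf.aestronglyMeasurable.smul
      (hD.comp (continuous_const.sub hamb)).aestronglyMeasurable
  have key := hasFDerivAt_integral_of_dominated_of_fderiv_le (𝕜 := ℝ) (μ := fullMeasure d)
    (F := fun x p => f p * j (x - amb p)) (F' := fun x p => f p • fderiv ℝ j (x - amb p))
    (x₀ := q) (s := Metric.ball q 1) (bound := K.indicator fun p => ‖f p‖ * C)
    (Metric.ball_mem_nhds _ one_pos)
    (Eventually.of_forall fun x => hf.aestronglyMeasurable.mul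
      (hj.smooth.continuous.comp (continuous_const.sub hamb)).aestronglyMeasurable)
    (integrable_mul_kernel hj.smooth.continuous hj.compact hf q) (hF' q)
    (Eventually.of_forall fun p x hx => by
      by_cases hp : p ∈ K
      · rw [Set.indicator_of_mem hp, norm_smul]
        gcongr
        exact hC _
      · rw [Set.indicator_of_notMem hp]
        have : fderiv ℝ j (x - amb p) = 0 := by
          refine image_eq_zero_of_notMem_tsupport fun h => hp ?_
          exact ⟨x, Metric.ball_subset_closedBall hx, _, h, by simp⟩
        rw [this, smul_zero, norm_zero])
    ((integrable_indicator_iff hK.measurableSet).2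
      ((hf.integrableOn_isCompact hK).norm.mul_const C))
    (Eventually.of_forall fun p x _ => by
      have h3 : HasFDerivAt (fun x => j (x - amb p)) (fderiv ℝ j (x - amb p)) x := by
        have := (hasFDerivAt_of_smooth hj.smooth (x - amb p)).comp x
          ((hasFDerivAt_id x).sub_const (amb p))
        rw [ContinuousLinearMap.comp_id] at this
        exact this
      exact h3.const_mul (f p))
  have hint : Integrable (fun p => f p • fderiv ℝ j (q - amb p)) (fullMeasure d) := by
    refine Integrable.mono' ((integrable_indicator_iff hK.measurableSet).2
      ((hf.integrableOn_isCompact hK).norm.mul_const C)) (hF' q) (Eventually.of_forall fun p => ?_)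
    by_cases hp : p ∈ K
    · rw [Set.indicator_of_mem hp, norm_smul]
      gcongr
      exact hC _
    · rw [Set.indicator_of_notMem hp]
      have : fderiv ℝ j (q - amb p) = 0 := by
        refine image_eq_zero_of_notMem_tsupport fun h => hp ?_
        exact ⟨q, Metric.mem_closedBall_self zero_le_one, _, h, by simp⟩
      rw [this, smul_zero, norm_zero]
  rw [show fderiv ℝ (moll j f) q = _ from key.fderiv, ContinuousLinearMap.integral_apply hint]
  rfl

theorem measurable_kernel {j : E d × E d → ℝ} (hj : Continuous j) :
    Measurable (Function.uncurry fun q p : E d × S d => j (amb q - amb p)) :=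
  (hj.comp (((isClosedEmbedding_amb d).continuous.comp continuous_fst).sub
    ((isClosedEmbedding_amb d).continuous.comp continuous_snd))).measurable

/-- A sequence of kernels forming a mollifier, whose supports lie on one side in the last variable,
that commutes with rotations and almost commutes with the transport operator. -/
structure MollSeq (s : ℝ) (j : ℕ → E d × E d → ℝ) : Prop where
  test : ∀ k, IsTestV (j k)
  nonneg : ∀ k y, 0 ≤ j k y
  mass_right : ∀ k (q : E d × S d), ∫ p, j k (amb q - amb p) ∂(fullMeasure d) = 1
  mass_left : ∀ k (p : E d × S d), ∫ q, j k (amb q - amb p) ∂(fullMeasure d) = 1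
  norm_le : ∀ (k : ℕ) y, j k y ≠ 0 → ‖y‖ ≤ 2 / ((k : ℝ) + 1)
  side : ∀ (k : ℕ) y, j k y ≠ 0 → 1 / (2 * ((k : ℝ) + 1)) ≤ s * y.1 (Fin.last d)
  rot : ∀ k (i l : Fin (d + 1)) y, fderiv ℝ (j k) y (0, rotVec i l y.2) = 0
  comm_right : ∀ (k : ℕ) (q : E d × S d), ∫⁻ p, ‖fderiv ℝ (j k) (amb q - amb p)
    ((amb q - amb p).2, 0)‖ₑ ∂(fullMeasure d) ≤ ENNReal.ofReal (1 / ((k : ℝ) + 1))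
  comm_left : ∀ (k : ℕ) (p : E d × S d), ∫⁻ q, ‖fderiv ℝ (j k) (amb q - amb p)
    ((amb q - amb p).2, 0)‖ₑ ∂(fullMeasure d) ≤ ENNReal.ofReal (1 / ((k : ℝ) + 1))

variable {s : ℝ} {j : ℕ → E d × E d → ℝ}

theorem MollSeq.integrable_right (hj : MollSeq s j) (k : ℕ) (q : E d × S d) :
    Integrable (fun p => j k (amb q - amb p)) (fullMeasure d) := by
  by_contra h
  have := hj.mass_right k q
  rw [integral_undef h] at this
  exact zero_ne_one this

theorem MollSeq.integrable_left (hj : MollSeq s j) (k : ℕ) (p : E d × S d) :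
    Integrable (fun q => j k (amb q - amb p)) (fullMeasure d) := by
  by_contra h
  have := hj.mass_left k p
  rw [integral_undef h] at this
  exact zero_ne_one this

theorem MollSeq.lmass_right (hj : MollSeq s j) (k : ℕ) (q : E d × S d) :
    ∫⁻ p, ‖j k (amb q - amb p)‖ₑ ∂(fullMeasure d) ≤ 1 := by
  have h := ofReal_integral_norm_eq_lintegral_enorm (hj.integrable_right k q)
  rw [← h]
  simp only [Real.norm_of_nonneg (hj.nonneg k _), hj.mass_right k q]
  simp

theorem MollSeq.lmass_left (hj : MollSeq s j) (k : ℕ) (p : E d × S d) :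
    ∫⁻ q, ‖j k (amb q - amb p)‖ₑ ∂(fullMeasure d) ≤ 1 := by
  have h := ofReal_integral_norm_eq_lintegral_enorm (hj.integrable_left k p)
  rw [← h]
  simp only [Real.norm_of_nonneg (hj.nonneg k _), hj.mass_left k p]
  simp

theorem locallyIntegrable_of_memLp {f : E d × S d → ℝ} (hf : MemLp f 2 (fullMeasure d)) :
    LocallyIntegrable f (fullMeasure d) :=
  hf.locallyIntegrable (by norm_num)

theorem MollSeq.eLpNorm_le (hj : MollSeq s j) (k : ℕ) {f : E d × S d → ℝ}
    (hf : AEStronglyMeasurable f (fullMeasure d)) :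
    eLpNorm (fun q => moll (j k) f (amb q)) 2 (fullMeasure d) ≤ eLpNorm f 2 (fullMeasure d) := by
  have := eLpNorm_integral_kernel_le (k := fun q p => j k (amb q - amb p))
    (measurable_kernel (hj.test k).smooth.continuous) (hj.lmass_right k) (hj.lmass_left k) hf
  rwa [one_mul] at this

theorem MollSeq.memLp (hj : MollSeq s j) (k : ℕ) {f : E d × S d → ℝ}
    (hf : MemLp f 2 (fullMeasure d)) :
    MemLp (fun q => moll (j k) f (amb q)) 2 (fullMeasure d) :=
  ⟨((contDiff_moll (hj.test k) (locallyIntegrable_of_memLp hf)).continuous.comp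
    (isClosedEmbedding_amb d).continuous).aestronglyMeasurable,
    (hj.eLpNorm_le k hf.1).trans_lt hf.2⟩

theorem dist_eq_norm_amb (q p : E d × S d) : dist q p = ‖amb q - amb p‖ := by
  rw [← dist_eq_norm]; rfl

theorem MollSeq.tendstoL2_of_continuous (hj : MollSeq s j) {g : E d × S d → ℝ} (hg : Continuous g)
    (hc : HasCompactSupport g) :
    TendstoL2 (fullMeasure d) (fun k q => moll (j k) g (amb q)) g := by
  have hli : LocallyIntegrable g (fullMeasure d) := hg.locallyIntegrable
  have hcomp : IsCompact (Metric.cthickening 2 (tsupport g)) := IsCompact.cthickening hc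
  have huc : UniformContinuous g := hc.uniformContinuous_of_continuous hg
  set K := Metric.cthickening 2 (tsupport g) with hK
  set M : ENNReal := eLpNorm (K.indicator fun _ => (1 : ℝ)) 2 (fullMeasure d) with hM
  have hMt : M ≠ ⊤ := by
    rw [hM, eLpNorm_indicator_const hcomp.measurableSet (by norm_num) (by norm_num)]
    exact ENNReal.mul_ne_top (by simp)
      (ENNReal.rpow_ne_top_of_nonneg (by norm_num) hcomp.measure_lt_top.ne)
  have key : ∀ ε : ℝ, 0 < ε → ∀ᶠ k : ℕ in atTop, ∀ q,
      ‖moll (j k) g (amb q) - g q‖ ≤ ε * ‖K.indicator (fun _ => (1 : ℝ)) q‖ := by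
    intro ε hε
    obtain ⟨η, hη, hu⟩ := Metric.uniformContinuous_iff.1 huc ε hε
    have ht : Tendsto (fun k : ℕ => 2 * (1 / ((k : ℝ) + 1))) atTop (𝓝 (2 * 0)) :=
      tendsto_one_div_add_atTop_nhds_zero_nat.const_mul 2
    rw [mul_zero] at ht
    filter_upwards [ht.eventually_lt_const hη] with k hk q
    have hk2 : 2 / ((k : ℝ) + 1) < η := by rwa [mul_one_div] at hk
    have hle : 2 / ((k : ℝ) + 1) ≤ 2 := div_le_self (by norm_num) (by linarith [k.cast_nonneg (α := ℝ)])
    have hi := integrable_mul_kernel (hj.test k).smooth.continuous (hj.test k).compact hli (amb q)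
    have e : moll (j k) g (amb q) - g q
        = ∫ p, (g p - g q) * j k (amb q - amb p) ∂(fullMeasure d) := by
      simp only [sub_mul]
      rw [integral_sub hi ((hj.integrable_right k q).const_mul _), integral_const_mul,
        hj.mass_right, mul_one]
      rfl
    by_cases hq : q ∈ K
    · rw [Set.indicator_of_mem hq, norm_one, mul_one, e]
      calc ‖∫ p, (g p - g q) * j k (amb q - amb p) ∂(fullMeasure d)‖
          ≤ ∫ p, ε * j k (amb q - amb p) ∂(fullMeasure d) := by
            refine norm_integral_le_of_norm_le ((hj.integrable_right k q).const_mul ε)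
              (Eventually.of_forall fun p => ?_)
            rw [norm_mul, Real.norm_of_nonneg (hj.nonneg k _)]
            by_cases h0 : j k (amb q - amb p) = 0
            · simp [h0]
            · gcongr
              · exact hj.nonneg k _
              · have h1 := hj.norm_le k _ h0
                rw [← dist_eq_norm_amb] at h1
                have h2 := hu (lt_of_le_of_lt h1 hk2)
                rw [dist_comm, dist_eq_norm] at h2
                exact h2.le
        _ = ε := by rw [integral_const_mul, hj.mass_right, mul_one]
    · rw [Set.indicator_of_notMem hq, norm_zero, mul_zero, e]
      have hz : ∀ p, (g p - g q) * j k (amb q - amb p) = 0 := by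
        intro p
        by_cases h0 : j k (amb q - amb p) = 0
        · rw [h0, mul_zero]
        · have h1 := (hj.norm_le k _ h0).trans hle
          rw [← dist_eq_norm_amb] at h1
          have hp : g p = 0 := by
            refine image_eq_zero_of_notMem_tsupport fun hp => hq ?_
            exact Metric.mem_cthickening_of_dist_le q p 2 _ hp h1
          have hq0 : g q = 0 :=
            image_eq_zero_of_notMem_tsupport fun hp => hq (Metric.self_subset_cthickening _ hp)
          rw [hp, hq0, sub_zero, zero_mul]
      simp [hz]
  rw [TendstoL2, ENNReal.tendsto_nhds_zero]
  intro ε hε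
  by_cases htop : ε = ⊤
  · simp [htop]
  have hpos : 0 < (ε / (M + 1)).toReal := by
    refine ENNReal.toReal_pos (ENNReal.div_pos hε.ne' (by simp [hMt])).ne' ?_
    exact (ENNReal.div_lt_top htop (by simp)).ne
  filter_upwards [key _ hpos] with k hk
  refine (eLpNorm_le_mul_eLpNorm_of_ae_le_mul (Eventually.of_forall hk) 2).trans ?_
  rw [ENNReal.ofReal_toReal (ENNReal.div_lt_top htop (by simp)).ne, ← hM]
  calc ε / (M + 1) * M ≤ ε / (M + 1) * (M + 1) := by gcongr; exact le_self_add
    _ ≤ ε := by rw [mul_comm]; exact ENNReal.mul_div_le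

theorem MollSeq.tendstoL2 (hj : MollSeq s j) {f : E d × S d → ℝ}
    (hf : MemLp f 2 (fullMeasure d)) :
    TendstoL2 (fullMeasure d) (fun k q => moll (j k) f (amb q)) f := by
  rw [TendstoL2, ENNReal.tendsto_nhds_zero]
  intro ε hε
  have hε3 : ε / 3 ≠ 0 := (ENNReal.div_pos hε.ne' (by norm_num)).ne'
  obtain ⟨g, hgc, hfg, hg, hgL⟩ := hf.exists_hasCompactSupport_eLpNorm_sub_le (by norm_num) hε3
  have h1 := ENNReal.tendsto_nhds_zero.1 (hj.tendstoL2_of_continuous hg hgc) (ε / 3)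
    (pos_iff_ne_zero.2 hε3)
  filter_upwards [h1] with k hk
  have e : (fun q => moll (j k) f (amb q) - f q)
      = ((fun q => moll (j k) (f - g) (amb q)) + fun q => moll (j k) g (amb q) - g q)
        - (f - g) := by
    funext q
    have a1 := integrable_mul_kernel (hj.test k).smooth.continuous (hj.test k).compact
      (locallyIntegrable_of_memLp hf) (amb q)
    have a2 := integrable_mul_kernel (hj.test k).smooth.continuous (hj.test k).compact
      (locallyIntegrable_of_memLp hgL) (amb q)
    have : moll (j k) (f - g) (amb q) = moll (j k) f (amb q) - moll (j k) g (amb q) := by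
      simp only [moll]
      rw [← integral_sub a1 a2]
      simp [sub_mul]
    simp only [Pi.add_apply, Pi.sub_apply, this]
    ring
  have m1 := (hj.memLp k (hf.sub hgL)).1
  have m2 := ((hj.memLp k hgL).sub hgL).1
  rw [e]
  refine (eLpNorm_sub_le (m1.add m2) (hf.sub hgL).1 (by norm_num)).trans ?_
  refine (add_le_add (eLpNorm_add_le m1 m2 (by norm_num)) le_rfl).trans ?_
  refine (add_le_add (add_le_add ((hj.eLpNorm_le k (hf.sub hgL).1).trans hfg) hk) hfg).trans ?_
  exact (ENNReal.add_thirds ε).le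

end Moll

section MollSeqLemmas

variable {d : ℕ} {s : ℝ} {j : ℕ → E d × E d → ℝ}

theorem fderiv_reverse {h : E d × E d → ℝ} (hh : ContDiff ℝ ∞ h) (y v : E d × E d) :
    fderiv ℝ (fun y => h (-y)) y v = - fderiv ℝ h (-y) v := by
  have := (hasFDerivAt_of_smooth hh (-y)).comp y (hasFDerivAt_id y).neg
  rw [ContinuousLinearMap.comp_neg, ContinuousLinearMap.comp_id] at this
  rw [show fderiv ℝ (fun y => h (-y)) y = _ from this.fderiv]
  rfl

theorem MollSeq.reverse (hj : MollSeq s j) : MollSeq (-s) (fun k y => j k (-y)) where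
  test k := ⟨(hj.test k).smooth.comp contDiff_neg,
    (hj.test k).compact.comp_homeomorph (Homeomorph.neg _)⟩
  nonneg k y := hj.nonneg k _
  mass_right k q := by
    simp only [neg_sub]
    exact hj.mass_left k q
  mass_left k q := by
    simp only [neg_sub]
    exact hj.mass_right k q
  norm_le k y h := by
    rw [← norm_neg]; exact hj.norm_le k _ h
  side k y h := by
    have := hj.side k _ h
    simpa using this
  rot k i l y := by
    rw [fderiv_reverse (hj.test k).smooth]
    have e : ((0 : E d), rotVec i l y.2) = - (0, rotVec i l (-y).2) := by
      ext <;> simp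
    rw [e, map_neg, hj.rot, neg_zero, neg_zero]
  comm_right k q := by
    refine le_trans (le_of_eq ?_) (hj.comm_left k q)
    refine lintegral_congr fun p => ?_
    have e : (((amb q - amb p).2, 0) : E d × E d) = - ((amb p - amb q).2, 0) := by
      ext <;> simp
    rw [fderiv_reverse (hj.test k).smooth, neg_sub, e, map_neg, neg_neg]
  comm_left k q := by
    refine le_trans (le_of_eq ?_) (hj.comm_right k q)
    refine lintegral_congr fun p => ?_
    have e : (((amb p - amb q).2, 0) : E d × E d) = - ((amb q - amb p).2, 0) := by
      ext <;> simp
    rw [fderiv_reverse (hj.test k).smooth, neg_sub, e, map_neg, neg_neg]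

/-- `F` is the weak derivative of `f` along an infinitesimal rotation, on `ℝⁿ × 𝕊ⁿ⁻¹`. -/
def IsWeakRot (i l : Fin (d + 1)) (f F : E d × S d → ℝ) : Prop :=
  ∀ φ : E d × E d → ℝ, IsTestV φ →
    ∫ p, f p * rot i l φ (amb p) ∂(fullMeasure d) = - ∫ p, F p * φ (amb p) ∂(fullMeasure d)

theorem MollSeq.rot_moll (hj : MollSeq s j) (k : ℕ) {i l : Fin (d + 1)} {f F : E d × S d → ℝ}
    (hf : LocallyIntegrable f (fullMeasure d)) (h : IsWeakRot i l f F) (q : E d × E d) :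
    FokkerPlanck.rot i l (moll (j k) f) q = moll (j k) F q := by
  rw [FokkerPlanck.rot, fderiv_moll (hj.test k) hf]
  have hφ : IsTestV fun y => j k (q - y) :=
    ⟨(hj.test k).smooth.comp (contDiff_const.sub contDiff_id),
      (hj.test k).compact.comp_homeomorph (Homeomorph.subLeft q)⟩
  have e : ∀ p : E d × S d, FokkerPlanck.rot i l (fun y => j k (q - y)) (amb p)
      = - fderiv ℝ (j k) (q - amb p) (0, rotVec i l q.2) := by
    intro p
    have h1 : HasFDerivAt (fun y => j k (q - y)) (-(fderiv ℝ (j k) (q - amb p))) (amb p) := by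
      have := (hasFDerivAt_of_smooth (hj.test k).smooth (q - amb p)).comp (amb p)
        ((hasFDerivAt_id (amb p)).const_sub q)
      rw [ContinuousLinearMap.comp_neg, ContinuousLinearMap.comp_id] at this
      exact this
    rw [FokkerPlanck.rot, h1.fderiv]
    have e2 : ((0 : E d), rotVec i l q.2)
        = (0, rotVec i l (amb p).2) + (0, rotVec i l (q - amb p).2) := by
      ext <;> simp
    rw [e2, map_add, hj.rot, add_zero]
    rfl
  have := h _ hφ
  simp only [e, mul_neg, integral_neg, neg_inj] at this
  exact this

theorem exists_schur_bound {h : E d × E d → ℝ} (hh : Continuous h) (hc : HasCompactSupport h) :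
    ∃ A : ENNReal, A ≠ ⊤ ∧
      (∀ q : E d × S d, ∫⁻ p, ‖h (amb q - amb p)‖ₑ ∂(fullMeasure d) ≤ A) ∧
      ∀ p : E d × S d, ∫⁻ q, ‖h (amb q - amb p)‖ₑ ∂(fullMeasure d) ≤ A := by
  obtain ⟨C, hC⟩ := hh.bounded_above_of_compact_support hc
  obtain ⟨R, hR⟩ := hc.isCompact.isBounded.subset_closedBall (0 : E d × E d)
  have key : ∀ p q : E d × S d, ‖h (amb q - amb p)‖ₑ
      ≤ ((Metric.closedBall q.1 R) ×ˢ (Set.univ : Set (S d))).indicator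
        (fun _ => ENNReal.ofReal C) p := by
    intro p q
    by_cases h0 : h (amb q - amb p) = 0
    · simp [h0]
    · have h1 : amb q - amb p ∈ Metric.closedBall (0 : E d × E d) R := hR (subset_tsupport _ h0)
      rw [mem_closedBall_zero_iff] at h1
      have h2 : ‖q.1 - p.1‖ ≤ R := (norm_fst_le (amb q - amb p)).trans h1
      rw [Set.indicator_of_mem]
      · rw [← ofReal_norm]
        exact ENNReal.ofReal_le_ofReal (hC _)
      · refine ⟨?_, trivial⟩
        rw [Metric.mem_closedBall, dist_comm, dist_eq_norm]
        exact h2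
  have vol : ∀ q : E d × S d, fullMeasure d ((Metric.closedBall q.1 R) ×ˢ (Set.univ : Set (S d)))
      = volume (Metric.closedBall (0 : E d) R) * sphereMeasure d Set.univ := by
    intro q
    rw [fullMeasure, Measure.prod_prod, Measure.addHaar_closedBall_center]
  refine ⟨ENNReal.ofReal C * (volume (Metric.closedBall (0 : E d) R) * sphereMeasure d Set.univ),
    ENNReal.mul_ne_top (by simp) (ENNReal.mul_ne_top measure_closedBall_lt_top.ne
      (measure_ne_top _ _)), fun q => ?_, fun p => ?_⟩
  · refine (lintegral_mono fun p => key p q).trans ?_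
    rw [lintegral_indicator_const (Metric.isClosed_closedBall.measurableSet.prod .univ), vol]
  · have key2 : ∀ q : E d × S d, ‖h (amb q - amb p)‖ₑ
      ≤ ((Metric.closedBall p.1 R) ×ˢ (Set.univ : Set (S d))).indicator
        (fun _ => ENNReal.ofReal C) q := by
      intro q
      refine (key p q).trans (le_of_eq ?_)
      simp only [Set.indicator, Set.mem_prod, Metric.mem_closedBall, Set.mem_univ, and_true,
        dist_comm p.1]
    refine (lintegral_mono key2).trans ?_
    rw [lintegral_indicator_const (Metric.isClosed_closedBall.measurableSet.prod .univ), vol]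

theorem MollSeq.integral_mul_moll (hj : MollSeq s j) (k : ℕ) {f g : E d × S d → ℝ}
    (hf : MemLp f 2 (fullMeasure d)) (hg : MemLp g 2 (fullMeasure d)) :
    ∫ q, g q * moll (j k) f (amb q) ∂(fullMeasure d)
      = ∫ p, f p * moll (fun y => j k (-y)) g (amb p) ∂(fullMeasure d) := by
  have hi := integrable_kernel_mul (k := fun q p => j k (amb q - amb p))
    (measurable_kernel (hj.test k).smooth.continuous) ENNReal.one_ne_top (hj.lmass_right k)
    (hj.lmass_left k) hf hg
  have hs := integral_integral_swap (f := fun q p => g q * (f p * j k (amb q - amb p))) hi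
  simp only [moll, ← integral_const_mul]
  rw [hs]
  refine integral_congr_ae (Eventually.of_forall fun p => integral_congr_ae
    (Eventually.of_forall fun q => ?_))
  simp only [neg_sub]
  ring

/-- The commutator of the mollification with the transport operator is small. -/
theorem MollSeq.commutator_le (hj : MollSeq s j) (k : ℕ) {f g : E d × S d → ℝ}
    (hf : MemLp f 2 (fullMeasure d)) (hg : MemLp g 2 (fullMeasure d))
    (hgi : Integrable (fun q => g q * transport (moll (j k) f) (amb q)) (fullMeasure d)) :
    |∫ p, f p * transport (moll (fun y => j k (-y)) g) (amb p) ∂(fullMeasure d)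
      + ∫ q, g q * transport (moll (j k) f) (amb q) ∂(fullMeasure d)|
    ≤ 1 / ((k : ℝ) + 1) * ((eLpNorm f 2 (fullMeasure d)).toReal
      * (eLpNorm g 2 (fullMeasure d)).toReal) := by
  have hfl := locallyIntegrable_of_memLp hf
  have hgl := locallyIntegrable_of_memLp hg
  have hD := continuous_fderiv_of_smooth (hj.test k).smooth
  have hamb : Continuous (amb (d := d)) := (isClosedEmbedding_amb d).continuous
  have t1 : ∀ q, transport (moll (j k) f) (amb q)
      = ∫ p, f p * fderiv ℝ (j k) (amb q - amb p) ((amb q).2, 0) ∂(fullMeasure d) := fun q => by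
    rw [transport_eq (contDiff_moll (hj.test k) hfl), fderiv_moll (hj.test k) hfl]
  have t2 : ∀ p, transport (moll (fun y => j k (-y)) g) (amb p)
      = - ∫ q, g q * fderiv ℝ (j k) (amb q - amb p) ((amb p).2, 0) ∂(fullMeasure d) := fun p => by
    rw [transport_eq (contDiff_moll (hj.reverse.test k) hgl), fderiv_moll (hj.reverse.test k) hgl]
    simp only [fderiv_reverse (hj.test k).smooth, neg_sub, mul_neg, integral_neg]
  obtain ⟨A, hA, hA1, hA2⟩ := exists_schur_bound (h := fun y => ‖fderiv ℝ (j k) y‖) hD.norm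
    ((hj.test k).compact.fderiv (𝕜 := ℝ)).norm
  have hk2 : Measurable (Function.uncurry fun q p : E d × S d =>
      fderiv ℝ (j k) (amb q - amb p) ((amb p).2, 0)) := by
    have : Continuous (Function.uncurry fun q p : E d × S d =>
      fderiv ℝ (j k) (amb q - amb p) ((amb p).2, 0)) := by
      have h1 : Continuous fun z : (E d × S d) × (E d × S d) => fderiv ℝ (j k) (amb z.1 - amb z.2) :=
        hD.comp ((hamb.comp continuous_fst).sub (hamb.comp continuous_snd))
      exact h1.clm_apply (((continuous_snd.comp (hamb.comp continuous_snd))).prodMk continuous_const)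
    exact this.measurable
  have hbd : ∀ q p : E d × S d, ‖fderiv ℝ (j k) (amb q - amb p) ((amb p).2, 0)‖ₑ
      ≤ ‖‖fderiv ℝ (j k) (amb q - amb p)‖‖ₑ := by
    intro q p
    rw [enorm_le_iff_norm_le, norm_norm]
    refine (ContinuousLinearMap.le_opNorm _ _).trans (mul_le_of_le_one_right (norm_nonneg _) ?_)
    simp [Prod.norm_def, amb]
  have hi2 := integrable_kernel_mul hk2 hA
    (fun q => (lintegral_mono fun p => hbd q p).trans (hA1 q))
    (fun p => (lintegral_mono fun q => hbd q p).trans (hA2 p)) hf hg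
  have hs := integral_integral_swap
    (f := fun q p => g q * (f p * fderiv ℝ (j k) (amb q - amb p) ((amb p).2, 0))) hi2
  have e1 : ∫ p, f p * transport (moll (fun y => j k (-y)) g) (amb p) ∂(fullMeasure d)
      = - ∫ q, g q * ∫ p, f p * fderiv ℝ (j k) (amb q - amb p) ((amb p).2, 0) ∂(fullMeasure d)
        ∂(fullMeasure d) := by
    simp only [t2, mul_neg, integral_neg, ← integral_const_mul]
    rw [hs]
    congr 1
    refine integral_congr_ae (Eventually.of_forall fun p => integral_congr_ae
      (Eventually.of_forall fun q => ?_))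
    simp only
    ring
  have hi2' : Integrable (fun q => g q * ∫ p, f p * fderiv ℝ (j k) (amb q - amb p) ((amb p).2, 0)
      ∂(fullMeasure d)) (fullMeasure d) := by
    have := hi2.integral_prod_left
    simpa only [integral_const_mul] using this
  have hint : ∀ (v : E d × E d) (q : E d × S d),
      Integrable (fun p => f p * fderiv ℝ (j k) (amb q - amb p) v) (fullMeasure d) := fun v q =>
    integrable_mul_kernel (j := fun y => fderiv ℝ (j k) y v) (hD.clm_apply continuous_const)
      ((hj.test k).compact.fderiv_apply (𝕜 := ℝ) v) hfl (amb q)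
  have hD2 : Continuous fun y : E d × E d => fderiv ℝ (j k) y (y.2, 0) :=
    hD.clm_apply (continuous_snd.prodMk continuous_const)
  have hc2 : HasCompactSupport fun y : E d × E d => fderiv ℝ (j k) y (y.2, 0) :=
    HasCompactSupport.intro ((hj.test k).compact.fderiv (𝕜 := ℝ)) fun y hy => by
      rw [image_eq_zero_of_notMem_tsupport hy]; rfl
  have hcm := integrable_mul_kernel hD2 hc2 hfl
  have e2 : ∀ q : E d × S d, ∫ p, f p * fderiv ℝ (j k) (amb q - amb p) ((amb q).2, 0)
        ∂(fullMeasure d) - ∫ p, f p * fderiv ℝ (j k) (amb q - amb p) ((amb p).2, 0)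
        ∂(fullMeasure d)
      = ∫ p, f p * fderiv ℝ (j k) (amb q - amb p) ((amb q - amb p).2, 0) ∂(fullMeasure d) := by
    intro q
    have e3 : ∀ p : E d × S d, fderiv ℝ (j k) (amb q - amb p) ((amb p).2, 0)
        = fderiv ℝ (j k) (amb q - amb p) ((amb q).2, 0)
          - fderiv ℝ (j k) (amb q - amb p) ((amb q - amb p).2, 0) := by
      intro p
      rw [← map_sub]
      congr 1
      ext <;> simp
    simp only [e3, mul_sub]
    rw [integral_sub (hint _ q) (hcm (amb q))]
    ring
  rw [e1, neg_add_eq_sub, ← integral_sub hgi hi2']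
  simp only [t1, ← mul_sub, e2]
  have hkb := eLpNorm_integral_kernel_le (k := fun q p : E d × S d =>
    fderiv ℝ (j k) (amb q - amb p) ((amb q - amb p).2, 0)) (measurable_kernel hD2)
    (hj.comm_right k) (hj.comm_left k) hf.1
  have hmeasC : AEStronglyMeasurable (fun q : E d × S d => ∫ p, f p * fderiv ℝ (j k)
      (amb q - amb p) ((amb q - amb p).2, 0) ∂(fullMeasure d)) (fullMeasure d) := by
    have hm : AEStronglyMeasurable (fun z : (E d × S d) × (E d × S d) => f z.2 * fderiv ℝ (j k)
        (amb z.1 - amb z.2) ((amb z.1 - amb z.2).2, 0)) ((fullMeasure d).prod (fullMeasure d)) :=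
      hf.1.comp_snd.mul (measurable_kernel hD2).aestronglyMeasurable
    exact hm.integral_prod_right'
  have hL : MemLp (fun q : E d × S d => ∫ p, f p * fderiv ℝ (j k) (amb q - amb p)
      ((amb q - amb p).2, 0) ∂(fullMeasure d)) 2 (fullMeasure d) :=
    ⟨hmeasC, hkb.trans_lt (ENNReal.mul_lt_top ENNReal.ofReal_lt_top hf.2)⟩
  have cs := norm_inner_le_norm (𝕜 := ℝ) hL.toLp hg.toLp
  have ein : inner ℝ hL.toLp hg.toLp = ∫ q, g q * ∫ p, f p * fderiv ℝ (j k) (amb q - amb p)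
      ((amb q - amb p).2, 0) ∂(fullMeasure d) ∂(fullMeasure d) := by
    rw [L2.inner_def]
    refine integral_congr_ae ?_
    filter_upwards [hL.coeFn_toLp, hg.coeFn_toLp] with q h1 h2
    rw [h1, h2]
    simp
  rw [ein, Lp.norm_toLp, Lp.norm_toLp] at cs
  refine cs.trans ?_
  rw [← mul_assoc]
  gcongr
  have := ENNReal.toReal_mono (ENNReal.mul_ne_top ENNReal.ofReal_ne_top hf.2.ne) hkb
  rwa [ENNReal.toReal_mul, ENNReal.toReal_ofReal (by positivity)] at this

end MollSeqLemmas

section Existence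

variable {d : ℕ}

theorem integral_sphere_dist (h : ℝ → ℝ) (θ θ' : S d) :
    ∫ ϑ : S d, h ‖(θ : E d) - ϑ‖ ∂(sphereMeasure d)
      = ∫ ϑ : S d, h ‖(θ' : E d) - ϑ‖ ∂(sphereMeasure d) := by
  let g : E d ≃ₗᵢ[ℝ] E d := (ℝ ∙ ((θ : E d) - θ'))ᗮ.reflection
  have hg : g (θ : E d) = θ' := Submodule.reflection_sub (by
    rw [norm_eq_of_mem_sphere, norm_eq_of_mem_sphere])
  rw [← integral_sphereMap g fun ϑ : S d => h ‖(θ' : E d) - ϑ‖]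
  refine integral_congr_ae (Eventually.of_forall fun ϑ => ?_)
  simp only [sphereMap]
  rw [← hg, ← map_sub, g.norm_map]

/-- A radial bump function. -/
def radialBump (κ : ℝ) (y : E d) : ℝ := Real.smoothTransition (1 - ‖y‖ ^ 2 / κ ^ 2)

theorem contDiff_radialBump (κ : ℝ) : ContDiff ℝ ∞ (radialBump (d := d) κ) :=
  Real.smoothTransition.contDiff.comp (contDiff_const.sub ((contDiff_norm_sq ℝ).div_const _))

theorem radialBump_ne_zero {κ : ℝ} (hκ : 0 < κ) {y : E d} (h : radialBump κ y ≠ 0) : ‖y‖ ≤ κ := by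
  by_contra hlt
  refine h (Real.smoothTransition.zero_of_nonpos ?_)
  rw [sub_nonpos, one_le_div (by positivity)]
  have : κ < ‖y‖ := not_le.1 hlt
  gcongr

theorem fderiv_radialBump_rotVec (κ : ℝ) (i l : Fin (d + 1)) (y : E d) :
    fderiv ℝ (radialBump κ) y (rotVec i l y) = 0 := by
  have h1 : HasFDerivAt (fun y : E d => 1 - ‖y‖ ^ 2 / κ ^ 2)
      (-((κ ^ 2)⁻¹ • ((2 : ℝ) • innerSL ℝ y))) y := by
    have := ((hasStrictFDerivAt_norm_sq y).hasFDerivAt.mul_const ((κ ^ 2)⁻¹)).const_sub 1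
    simpa [div_eq_mul_inv, ← Nat.cast_smul_eq_nsmul ℝ] using this
  have h2 := ((Real.smoothTransition.contDiff (n := 1)).differentiable (by simp)
    (1 - ‖y‖ ^ 2 / κ ^ 2)).hasFDerivAt.comp y h1
  rw [show fderiv ℝ (radialBump κ) y = _ from h2.fderiv]
  simp [inner_rotVec_self]

theorem integral_radialBump_pos (κ : ℝ) (θ : S d) :
    0 < ∫ ϑ : S d, radialBump κ ((θ : E d) - (ϑ : E d)) ∂(sphereMeasure d) := by
  have hc : Continuous fun ϑ : S d => radialBump κ ((θ : E d) - (ϑ : E d)) :=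
    (contDiff_radialBump κ).continuous.comp (continuous_const.sub continuous_subtype_val)
  have : (sphereMeasure d).IsOpenPosMeasure := by unfold sphereMeasure; infer_instance
  refine hc.integral_pos_of_hasCompactSupport_nonneg_nonzero
    (HasCompactSupport.of_compactSpace _) (fun ϑ => Real.smoothTransition.nonneg _) (x := θ) ?_
  simp [radialBump]

/-- The bump function in the position variable. -/
def posBump (d k : ℕ) : ContDiffBump (0 : E d) where
  rIn := 1 / (4 * ((k : ℝ) + 1))
  rOut := 1 / (2 * ((k : ℝ) + 1))
  rIn_pos := by positivity
  rIn_lt_rOut := by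
    have : (0 : ℝ) < (k : ℝ) + 1 := by positivity
    gcongr
    norm_num

/-- The total mass of the radial bump function on the sphere. -/
def radialMass (d : ℕ) (κ : ℝ) : ℝ :=
  ∫ ϑ : S d, radialBump κ (EuclideanSpace.single (Fin.last d) (1 : ℝ) - (ϑ : E d))
    ∂(sphereMeasure d)

/-- The first moment of the derivative of the bump function in the position variable. -/
def posVar (d k : ℕ) : ℝ :=
  ∫ x : E d, ‖fderiv ℝ ((posBump d k).normed volume) x‖

/-- The angular scale of the kernel. -/
def angScale (d k : ℕ) : ℝ := 1 / ((k : ℝ) + 1) / (posVar d k + 1)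

/-- The mollification kernel. -/
def stdKernel (d : ℕ) (s : ℝ) (k : ℕ) (y : E d × E d) : ℝ :=
  (posBump d k).normed volume
      (y.1 - (s * (1 / ((k : ℝ) + 1))) • EuclideanSpace.single (Fin.last d) (1 : ℝ))
    * ((radialMass d (angScale d k))⁻¹ * radialBump (angScale d k) y.2)

theorem posVar_nonneg (d k : ℕ) : 0 ≤ posVar d k :=
  integral_nonneg fun _ => norm_nonneg _

theorem angScale_pos (d k : ℕ) : 0 < angScale d k := by
  have := posVar_nonneg d k
  unfold angScale
  positivity

theorem angScale_le (d k : ℕ) : angScale d k ≤ 1 / ((k : ℝ) + 1) :=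
  div_le_self (by positivity) (by linarith [posVar_nonneg d k])

theorem posVar_mul_angScale_le (d k : ℕ) : posVar d k * angScale d k ≤ 1 / ((k : ℝ) + 1) := by
  have := posVar_nonneg d k
  rw [angScale, mul_div_assoc']
  rw [div_le_iff₀ (by positivity), mul_comm]
  gcongr
  linarith

/-- The north pole of the sphere. -/
def pole (d : ℕ) : S d := ⟨EuclideanSpace.single (Fin.last d) (1 : ℝ), by simp⟩

theorem integral_radialBump (κ : ℝ) (θ : S d) :
    ∫ ϑ : S d, radialBump κ ((θ : E d) - (ϑ : E d)) ∂(sphereMeasure d) = radialMass d κ :=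
  integral_sphere_dist (fun t => Real.smoothTransition (1 - t ^ 2 / κ ^ 2)) θ (pole d)

theorem radialMass_pos (d k : ℕ) : 0 < radialMass d (angScale d k) :=
  integral_radialBump_pos (angScale d k) (pole d)

theorem stdKernel_ne_zero {s : ℝ} {k : ℕ} {y : E d × E d} (h : stdKernel d s k y ≠ 0) :
    ‖y.1 - (s * (1 / ((k : ℝ) + 1))) • EuclideanSpace.single (Fin.last d) (1 : ℝ)‖
      ≤ 1 / (2 * ((k : ℝ) + 1)) ∧ ‖y.2‖ ≤ 1 / ((k : ℝ) + 1) := by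
  unfold stdKernel at h
  constructor
  · have h1 := left_ne_zero_of_mul h
    have h2 : y.1 - (s * (1 / ((k : ℝ) + 1))) • EuclideanSpace.single (Fin.last d) (1 : ℝ)
        ∈ Function.support ((posBump d k).normed volume) := h1
    rw [ContDiffBump.support_normed_eq, mem_ball_zero_iff] at h2
    exact h2.le
  · exact (radialBump_ne_zero (angScale_pos d k)
      (right_ne_zero_of_mul (right_ne_zero_of_mul h))).trans (angScale_le d k)

theorem norm_le_of_stdKernel_ne_zero {s : ℝ} (hs : |s| = 1) {k : ℕ} {y : E d × E d}
    (h : stdKernel d s k y ≠ 0) : ‖y‖ ≤ 2 / ((k : ℝ) + 1) := by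
  obtain ⟨h1, h2⟩ := stdKernel_ne_zero h
  have hk : (0 : ℝ) < (k : ℝ) + 1 := by positivity
  have e1 : 1 / (2 * ((k : ℝ) + 1)) = 1 / 2 * (1 / ((k : ℝ) + 1)) := by field_simp
  have e2 : 2 / ((k : ℝ) + 1) = 2 * (1 / ((k : ℝ) + 1)) := by field_simp
  have hpos : 0 < 1 / ((k : ℝ) + 1) := by positivity
  rw [e1] at h1
  rw [e2]
  set δ := 1 / ((k : ℝ) + 1)
  refine max_le ?_ (by linarith)
  have h3 : ‖(s * δ) • EuclideanSpace.single (Fin.last d) (1 : ℝ)‖ = δ := by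
    rw [norm_smul, norm_mul, Real.norm_eq_abs, hs, Real.norm_of_nonneg hpos.le]
    simp
  have h4 := norm_le_norm_sub_add y.1 ((s * δ) • EuclideanSpace.single (Fin.last d) (1 : ℝ))
  rw [h3] at h4
  show ‖y.1‖ ≤ _
  linarith

theorem isTestV_stdKernel {s : ℝ} (hs : |s| = 1) (k : ℕ) : IsTestV (stdKernel d s k) := by
  refine ⟨?_, HasCompactSupport.intro (isCompact_closedBall 0 (2 / ((k : ℝ) + 1))) fun y hy => ?_⟩
  · have h1 : ContDiff ℝ ∞ fun y : E d × E d => (posBump d k).normed volume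
        (y.1 - (s * (1 / ((k : ℝ) + 1))) • EuclideanSpace.single (Fin.last d) (1 : ℝ)) :=
      ((posBump d k).contDiff_normed).comp (contDiff_fst.sub contDiff_const)
    have h2 : ContDiff ℝ ∞ fun y : E d × E d => radialBump (angScale d k) y.2 :=
      (contDiff_radialBump _).comp contDiff_snd
    exact h1.mul (contDiff_const.mul h2)
  · by_contra h
    exact hy (mem_closedBall_zero_iff.2 (norm_le_of_stdKernel_ne_zero hs h))

theorem fderiv_stdKernel {s : ℝ} (k : ℕ) (y : E d × E d) (v w : E d) :
    fderiv ℝ (stdKernel d s k) y (v, w)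
      = fderiv ℝ ((posBump d k).normed volume)
          (y.1 - (s * (1 / ((k : ℝ) + 1))) • EuclideanSpace.single (Fin.last d) (1 : ℝ)) v
          * ((radialMass d (angScale d k))⁻¹ * radialBump (angScale d k) y.2)
        + (posBump d k).normed volume
          (y.1 - (s * (1 / ((k : ℝ) + 1))) • EuclideanSpace.single (Fin.last d) (1 : ℝ))
          * ((radialMass d (angScale d k))⁻¹ * fderiv ℝ (radialBump (angScale d k)) y.2 w) := by
  have hd1 : Differentiable ℝ ((posBump d k).normed (volume : Measure (E d))) :=
    ((posBump d k).contDiff_normed (n := 1)).differentiable (by simp)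
  have hd2 : Differentiable ℝ (radialBump (d := d) (angScale d k)) :=
    (contDiff_radialBump _).differentiable (by simp)
  have h1 := (hd1 (y.1 - (s * (1 / ((k : ℝ) + 1))) •
    EuclideanSpace.single (Fin.last d) (1 : ℝ))).hasFDerivAt.comp y
    ((hasFDerivAt_fst (𝕜 := ℝ) (E := E d) (F := E d) (p := y)).sub_const _)
  have h2 := ((hd2 y.2).hasFDerivAt.comp y hasFDerivAt_snd).const_mul
    (radialMass d (angScale d k))⁻¹
  have := (h1.mul h2).fderiv
  rw [show fderiv ℝ (stdKernel d s k) y = _ from this]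
  simp
  ring

theorem exists_mollSeq (d : ℕ) {s : ℝ} (hs : |s| = 1) :
    ∃ j : ℕ → E d × E d → ℝ, MollSeq s j := by
  have hρc : ∀ k, Continuous (fderiv ℝ ((posBump d k).normed (volume : Measure (E d)))) := fun k =>
    ((posBump d k).contDiff_normed (n := 1)).continuous_fderiv (by simp)
  have hρi : ∀ k, Integrable (fun x => ‖fderiv ℝ ((posBump d k).normed (volume : Measure (E d))) x‖) := fun k =>
    ((hρc k).integrable_of_hasCompactSupport
      ((posBump d k).hasCompactSupport_normed.fderiv (𝕜 := ℝ))).norm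
  have hKr : ∀ k (θ : S d), ∫ ϑ : S d, (radialMass d (angScale d k))⁻¹
      * radialBump (angScale d k) ((θ : E d) - (ϑ : E d)) ∂(sphereMeasure d) = 1 := fun k θ => by
    rw [integral_const_mul, integral_radialBump, inv_mul_cancel₀ (radialMass_pos d k).ne']
  have hKl : ∀ k (θ : S d), ∫ ϑ : S d, (radialMass d (angScale d k))⁻¹
      * radialBump (angScale d k) ((ϑ : E d) - (θ : E d)) ∂(sphereMeasure d) = 1 := fun k θ => by
    refine Eq.trans ?_ (hKr k θ)
    refine integral_congr_ae (Eventually.of_forall fun ϑ => ?_)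
    simp only [radialBump, norm_sub_rev]
  have hKn : ∀ k (y : E d), 0 ≤ (radialMass d (angScale d k))⁻¹ * radialBump (angScale d k) y :=
    fun k y => mul_nonneg (inv_nonneg.2 (radialMass_pos d k).le) (Real.smoothTransition.nonneg _)
  have hcomm : ∀ k (y : E d × E d), ‖fderiv ℝ (stdKernel d s k) y (y.2, 0)‖
      ≤ ‖fderiv ℝ ((posBump d k).normed (volume : Measure (E d)))
          (y.1 - (s * (1 / ((k : ℝ) + 1))) • EuclideanSpace.single (Fin.last d) (1 : ℝ))‖
        * (angScale d k * ((radialMass d (angScale d k))⁻¹ * radialBump (angScale d k) y.2)) := by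
    intro k y
    rw [fderiv_stdKernel, map_zero, mul_zero, mul_zero, add_zero, norm_mul,
      Real.norm_of_nonneg (hKn k _), ← mul_assoc _ (angScale d k)]
    by_cases h : radialBump (angScale d k) y.2 = 0
    · simp [h]
    · refine mul_le_mul_of_nonneg_right ?_ (hKn k _)
      refine (ContinuousLinearMap.le_opNorm _ _).trans ?_
      gcongr
      exact radialBump_ne_zero (angScale_pos d k) h
  have hcb : Continuous fun ϑ : S d => (ϑ : E d) := continuous_subtype_val
  refine ⟨fun k => stdKernel d s k, fun k => isTestV_stdKernel hs k, fun k y =>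
    mul_nonneg ((posBump d k).nonneg_normed _) (hKn k _), fun k q => ?_, fun k p => ?_,
    fun k y h => norm_le_of_stdKernel_ne_zero hs h, fun k y h => ?_, fun k i l y => ?_,
    fun k q => ?_, fun k p => ?_⟩
  · have := integral_prod_mul (μ := (volume : Measure (E d))) (ν := sphereMeasure d)
      (fun x => (posBump d k).normed volume (q.1 - x - (s * (1 / ((k : ℝ) + 1))) •
        EuclideanSpace.single (Fin.last d) (1 : ℝ)))
      (fun ϑ : S d => (radialMass d (angScale d k))⁻¹
        * radialBump (angScale d k) ((q.2 : E d) - (ϑ : E d)))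
    refine Eq.trans this ?_
    rw [hKr, mul_one, integral_sub_left_eq_self (fun x => (posBump d k).normed volume
      (x - (s * (1 / ((k : ℝ) + 1))) • EuclideanSpace.single (Fin.last d) (1 : ℝ))),
      integral_sub_right_eq_self, (posBump d k).integral_normed]
  · have := integral_prod_mul (μ := (volume : Measure (E d))) (ν := sphereMeasure d)
      (fun x => (posBump d k).normed volume (x - p.1 - (s * (1 / ((k : ℝ) + 1))) •
        EuclideanSpace.single (Fin.last d) (1 : ℝ)))
      (fun ϑ : S d => (radialMass d (angScale d k))⁻¹
        * radialBump (angScale d k) ((ϑ : E d) - (p.2 : E d)))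
    refine Eq.trans this ?_
    rw [hKl, mul_one, integral_sub_right_eq_self (fun x => (posBump d k).normed volume
      (x - (s * (1 / ((k : ℝ) + 1))) • EuclideanSpace.single (Fin.last d) (1 : ℝ))),
      integral_sub_right_eq_self, (posBump d k).integral_normed]
  · obtain ⟨h1, -⟩ := stdKernel_ne_zero h
    have h2 := (PiLp.norm_apply_le (y.1 - (s * (1 / ((k : ℝ) + 1))) •
      EuclideanSpace.single (Fin.last d) (1 : ℝ)) (Fin.last d)).trans h1
    simp only [PiLp.sub_apply, PiLp.smul_apply, PiLp.single_apply, if_true, smul_eq_mul,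
      mul_one, Real.norm_eq_abs] at h2
    have hk : (0 : ℝ) < (k : ℝ) + 1 := by positivity
    have e1 : 1 / (2 * ((k : ℝ) + 1)) = 1 / 2 * (1 / ((k : ℝ) + 1)) := by field_simp
    rw [e1] at h2 ⊢
    have hpos : 0 < 1 / ((k : ℝ) + 1) := by positivity
    set δ := 1 / ((k : ℝ) + 1)
    have h3 := abs_le.1 h2
    rcases (abs_eq zero_le_one).1 hs with rfl | rfl
    · linarith [h3.1]
    · linarith [h3.2]
  · rw [fderiv_stdKernel, map_zero, fderiv_radialBump_rotVec]
    simp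
  · have hcq : Continuous fun ϑ : S d => (radialMass d (angScale d k))⁻¹
        * radialBump (angScale d k) ((q.2 : E d) - (ϑ : E d)) :=
      continuous_const.mul ((contDiff_radialBump _).continuous.comp (continuous_const.sub hcb))
    have hint : Integrable (fun p : E d × S d =>
        ‖fderiv ℝ ((posBump d k).normed (volume : Measure (E d)))
          (q.1 - p.1 - (s * (1 / ((k : ℝ) + 1))) • EuclideanSpace.single (Fin.last d) (1 : ℝ))‖
        * (angScale d k * ((radialMass d (angScale d k))⁻¹
          * radialBump (angScale d k) ((q.2 : E d) - (p.2 : E d))))) (fullMeasure d) :=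
      (((hρi k).comp_sub_right _).comp_sub_left q.1).mul_prod
        ((hcq.const_mul (angScale d k)).integrable_of_hasCompactSupport
          (HasCompactSupport.of_compactSpace _))
    refine (lintegral_mono fun p => ?_).trans ((ofReal_integral_eq_lintegral_ofReal hint
      (Eventually.of_forall fun p => (norm_nonneg _).trans (hcomm k (amb q - amb p)))).symm.le.trans
      (ENNReal.ofReal_le_ofReal ?_))
    · rw [← ofReal_norm]
      exact ENNReal.ofReal_le_ofReal (hcomm k (amb q - amb p))
    · refine (integral_prod_mul (μ := (volume : Measure (E d))) (ν := sphereMeasure d)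
        (fun x => ‖fderiv ℝ ((posBump d k).normed (volume : Measure (E d)))
          (q.1 - x - (s * (1 / ((k : ℝ) + 1))) • EuclideanSpace.single (Fin.last d) (1 : ℝ))‖)
        (fun ϑ : S d => angScale d k * ((radialMass d (angScale d k))⁻¹
          * radialBump (angScale d k) ((q.2 : E d) - (ϑ : E d))))).trans_le ?_
      rw [integral_const_mul, hKr, mul_one, integral_sub_left_eq_self (fun x =>
        ‖fderiv ℝ ((posBump d k).normed (volume : Measure (E d)))
          (x - (s * (1 / ((k : ℝ) + 1))) • EuclideanSpace.single (Fin.last d) (1 : ℝ))‖),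
        integral_sub_right_eq_self
          (fun x => ‖fderiv ℝ ((posBump d k).normed (volume : Measure (E d))) x‖)]
      exact posVar_mul_angScale_le d k
  · have hcq : Continuous fun ϑ : S d => (radialMass d (angScale d k))⁻¹
        * radialBump (angScale d k) ((ϑ : E d) - (p.2 : E d)) :=
      continuous_const.mul ((contDiff_radialBump _).continuous.comp (hcb.sub continuous_const))
    have hint : Integrable (fun q : E d × S d =>
        ‖fderiv ℝ ((posBump d k).normed (volume : Measure (E d)))
          (q.1 - p.1 - (s * (1 / ((k : ℝ) + 1))) • EuclideanSpace.single (Fin.last d) (1 : ℝ))‖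
        * (angScale d k * ((radialMass d (angScale d k))⁻¹
          * radialBump (angScale d k) ((q.2 : E d) - (p.2 : E d))))) (fullMeasure d) :=
      (((hρi k).comp_sub_right _).comp_sub_right p.1).mul_prod
        ((hcq.const_mul (angScale d k)).integrable_of_hasCompactSupport
          (HasCompactSupport.of_compactSpace _))
    refine (lintegral_mono fun q => ?_).trans ((ofReal_integral_eq_lintegral_ofReal hint
      (Eventually.of_forall fun q => (norm_nonneg _).trans (hcomm k (amb q - amb p)))).symm.le.trans
      (ENNReal.ofReal_le_ofReal ?_))
    · rw [← ofReal_norm]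
      exact ENNReal.ofReal_le_ofReal (hcomm k (amb q - amb p))
    · refine (integral_prod_mul (μ := (volume : Measure (E d))) (ν := sphereMeasure d)
        (fun x => ‖fderiv ℝ ((posBump d k).normed (volume : Measure (E d)))
          (x - p.1 - (s * (1 / ((k : ℝ) + 1))) • EuclideanSpace.single (Fin.last d) (1 : ℝ))‖)
        (fun ϑ : S d => angScale d k * ((radialMass d (angScale d k))⁻¹
          * radialBump (angScale d k) ((ϑ : E d) - (p.2 : E d))))).trans_le ?_
      rw [integral_const_mul, hKl, mul_one, integral_sub_right_eq_self (fun x =>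
        ‖fderiv ℝ ((posBump d k).normed (volume : Measure (E d)))
          (x - (s * (1 / ((k : ℝ) + 1))) • EuclideanSpace.single (Fin.last d) (1 : ℝ))‖),
        integral_sub_right_eq_self
          (fun x => ‖fderiv ℝ ((posBump d k).normed (volume : Measure (E d))) x‖)]
      exact posVar_mul_angScale_le d k

end Existence

/-! ### Zero extension -/

section ZeroExtension

variable {d : ℕ}

theorem memLp_zeroExt {f : E d × S d → ℝ} (hf : MemLp f 2 (measQ d)) :
    MemLp ((phase d).indicator f) 2 (fullMeasure d) := by
  rw [memLp_indicator_iff_restrict (measurableSet_phase d), ← measQ_eq]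
  exact hf

theorem integral_zeroExt_mul (f g : E d × S d → ℝ) :
    ∫ p, (phase d).indicator f p * g p ∂(fullMeasure d) = ∫ p, f p * g p ∂(measQ d) := by
  rw [measQ_eq, ← integral_indicator (measurableSet_phase d)]
  refine integral_congr_ae (Eventually.of_forall fun p => ?_)
  simp only
  rw [← Set.indicator_mul_left]

theorem ae_measQ_zeroExt (f : E d × S d → ℝ) :
    ∀ᵐ p ∂(measQ d), (phase d).indicator f p = f p := by
  filter_upwards [ae_measQ_mem d] with p hp
  exact Set.indicator_of_mem (show p ∈ phase d from hp) f

theorem IsAngGrad.isWeakRot {u : L2Q d} {w : L2QVec d} (h : IsAngGrad u w) (i l : Fin (d + 1)) :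
    IsWeakRot i l ((phase d).indicator u)
      ((phase d).indicator fun p => inner ℝ (w p) (rotVec i l (p.2 : E d))) := by
  intro φ hφ
  rw [integral_zeroExt_mul, integral_zeroExt_mul]
  exact h.integral_rot hφ i l

theorem isWeakRot_of_test {g : E d × E d → ℝ} (hg : IsTestV g) (i l : Fin (d + 1)) :
    IsWeakRot i l ((phase d).indicator fun p => g (amb p))
      ((phase d).indicator fun p => rot i l g (amb p)) := by
  intro φ hφ
  rw [integral_zeroExt_mul, integral_zeroExt_mul]
  have h0 := FokkerPlanck.integral_rot (hg.mul_right hφ.smooth) i l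
    ((volume : Measure (E d)).restrict (halfSpace d))
  simp only [rot_mul hg.smooth hφ.smooth] at h0
  have i1 : Integrable (fun p => g (amb p) * rot i l φ (amb p)) (measQ d) :=
    ((hφ.rot i l).mul_left hg.smooth).integrable _
  have i2 : Integrable (fun p => φ (amb p) * rot i l g (amb p)) (measQ d) :=
    ((hg.rot i l).mul_left hφ.smooth).integrable _
  have h1 := integral_add i1 i2
  rw [show ∫ p, (g (amb p) * rot i l φ (amb p) + φ (amb p) * rot i l g (amb p)) ∂(measQ d) = 0
    from h0] at h1
  simp only [mul_comm (rot i l g _)]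
  linarith

theorem MollSeq.tendstoL2_measQ {s : ℝ} {j : ℕ → E d × E d → ℝ} (hj : MollSeq s j)
    {f : E d × S d → ℝ} (hf : MemLp f 2 (measQ d)) :
    TendstoL2 (measQ d) (fun k q => moll (j k) ((phase d).indicator f) (amb q)) f := by
  have h := hj.tendstoL2 (memLp_zeroExt hf)
  refine tendsto_of_tendsto_of_tendsto_of_le_of_le tendsto_const_nhds h (fun _ => zero_le) ?_
  intro k
  refine le_trans (le_of_eq ?_) (eLpNorm_mono_measure _
    (measQ_eq d ▸ Measure.restrict_le_self : measQ d ≤ fullMeasure d))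
  refine eLpNorm_congr_ae ?_
  filter_upwards [ae_measQ_zeroExt f] with p hp
  rw [hp]

theorem MollSeq.memLp_measQ {s : ℝ} {j : ℕ → E d × E d → ℝ} (hj : MollSeq s j) (k : ℕ)
    {f : E d × S d → ℝ} (hf : MemLp f 2 (measQ d)) :
    MemLp (fun q => moll (j k) ((phase d).indicator f) (amb q)) 2 (measQ d) :=
  (hj.memLp k (memLp_zeroExt hf)).mono_measure
    (measQ_eq d ▸ Measure.restrict_le_self : measQ d ≤ fullMeasure d)

theorem exists_of_moll_ne_zero {j : E d × E d → ℝ} {f : E d × S d → ℝ} {q : E d × E d}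
    (h : moll j f q ≠ 0) : ∃ p, f p ≠ 0 ∧ j (q - amb p) ≠ 0 := by
  by_contra! hn
  refine h ?_
  rw [moll, integral_eq_zero_of_ae (Eventually.of_forall fun p => ?_)]
  by_cases hp : f p = 0
  · simp [hp]
  · simp [hn p hp]

end ZeroExtension

/-! ### A renormalization -/

/-- A bounded increasing function. -/
def beta (t : ℝ) : ℝ := t / Real.sqrt (1 + t ^ 2)

/-- The primitive of `beta`. -/
def betaPrim (t : ℝ) : ℝ := Real.sqrt (1 + t ^ 2) - 1

section Beta

theorem sqrt_one_add_sq_pos (t : ℝ) : 0 < Real.sqrt (1 + t ^ 2) :=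
  Real.sqrt_pos.2 (by positivity)

theorem one_le_sqrt_one_add_sq (t : ℝ) : 1 ≤ Real.sqrt (1 + t ^ 2) := by
  rw [Real.one_le_sqrt]
  nlinarith [sq_nonneg t]

theorem contDiff_sqrt_one_add_sq : ContDiff ℝ ∞ fun t : ℝ => Real.sqrt (1 + t ^ 2) :=
  (contDiff_const.add (contDiff_id.pow 2)).sqrt fun t => by simp only [id]; positivity

theorem contDiff_beta : ContDiff ℝ ∞ beta :=
  contDiff_id.div contDiff_sqrt_one_add_sq fun t => (sqrt_one_add_sq_pos t).ne'

theorem contDiff_betaPrim : ContDiff ℝ ∞ betaPrim :=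
  contDiff_sqrt_one_add_sq.sub contDiff_const

theorem hasDerivAt_sqrt_one_add_sq (t : ℝ) :
    HasDerivAt (fun t : ℝ => Real.sqrt (1 + t ^ 2)) (beta t) t := by
  have h1 : HasDerivAt (fun t : ℝ => 1 + t ^ 2) (2 * t) t := by
    simpa using (hasDerivAt_pow 2 t).const_add 1
  have := h1.sqrt (by positivity)
  refine this.congr_deriv ?_
  rw [beta]
  have := (sqrt_one_add_sq_pos t).ne'
  field_simp

theorem hasDerivAt_betaPrim (t : ℝ) : HasDerivAt betaPrim (beta t) t :=
  (hasDerivAt_sqrt_one_add_sq t).sub_const 1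

theorem hasDerivAt_beta (t : ℝ) :
    HasDerivAt beta (1 / (Real.sqrt (1 + t ^ 2) * (1 + t ^ 2))) t := by
  have := (hasDerivAt_id t).div (hasDerivAt_sqrt_one_add_sq t) (sqrt_one_add_sq_pos t).ne'
  refine this.congr_deriv ?_
  have h0 := (sqrt_one_add_sq_pos t).ne'
  have h1 : Real.sqrt (1 + t ^ 2) ^ 2 = 1 + t ^ 2 := Real.sq_sqrt (by positivity)
  have h2 : (1 + t ^ 2) ≠ 0 := by positivity
  rw [h1, beta]
  simp only [id]
  field_simp
  rw [h1]
  ring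

theorem deriv_beta_nonneg (t : ℝ) : 0 ≤ deriv beta t := by
  rw [(hasDerivAt_beta t).deriv]
  have := sqrt_one_add_sq_pos t
  positivity

theorem deriv_beta_le_one (t : ℝ) : deriv beta t ≤ 1 := by
  rw [(hasDerivAt_beta t).deriv, div_le_one (by have := sqrt_one_add_sq_pos t; positivity)]
  nlinarith [one_le_sqrt_one_add_sq t, sq_nonneg t]

theorem abs_beta_le_one (t : ℝ) : |beta t| ≤ 1 := by
  rw [beta, abs_div, abs_of_pos (sqrt_one_add_sq_pos t), div_le_one (sqrt_one_add_sq_pos t)]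
  exact Real.abs_le_sqrt (by linarith)

theorem beta_lipschitz (a b : ℝ) : |beta a - beta b| ≤ |a - b| := by
  have := Convex.norm_image_sub_le_of_norm_deriv_le (f := beta) (s := Set.univ) (C := 1)
    (fun x _ => (hasDerivAt_beta x).differentiableAt)
    (fun x _ => by
      rw [Real.norm_of_nonneg (deriv_beta_nonneg x)]
      exact deriv_beta_le_one x) convex_univ (Set.mem_univ b) (Set.mem_univ a)
  simpa using this

theorem betaPrim_lipschitz (a b : ℝ) : |betaPrim a - betaPrim b| ≤ |a - b| := by
  have := Convex.norm_image_sub_le_of_norm_deriv_le (f := betaPrim) (s := Set.univ) (C := 1)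
    (fun x _ => (hasDerivAt_betaPrim x).differentiableAt)
    (fun x _ => by
      rw [(hasDerivAt_betaPrim x).deriv]
      exact abs_beta_le_one x) convex_univ (Set.mem_univ b) (Set.mem_univ a)
  simpa using this

theorem beta_zero : beta 0 = 0 := by simp [beta]

theorem betaPrim_zero : betaPrim 0 = 0 := by simp [betaPrim]

theorem betaPrim_nonneg (t : ℝ) : 0 ≤ betaPrim t :=
  sub_nonneg.2 (one_le_sqrt_one_add_sq t)

theorem abs_beta_le (t : ℝ) : |beta t| ≤ |t| := by
  simpa [beta_zero] using beta_lipschitz t 0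

theorem abs_betaPrim_le (t : ℝ) : |betaPrim t| ≤ |t| := by
  simpa [betaPrim_zero] using betaPrim_lipschitz t 0

theorem betaPrim_le_sq (t : ℝ) : betaPrim t ≤ t ^ 2 := by
  have h1 : Real.sqrt (1 + t ^ 2) ≤ 1 + t ^ 2 := by
    rw [Real.sqrt_le_left (by positivity)]
    nlinarith [sq_nonneg t, sq_nonneg (t ^ 2)]
  unfold betaPrim
  linarith

theorem mul_beta_nonneg (t : ℝ) : 0 ≤ t * beta t := by
  have := sqrt_one_add_sq_pos t
  rw [beta, ← mul_div_assoc, ← sq]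
  positivity

theorem eq_zero_of_mul_beta {t : ℝ} (h : t * beta t = 0) : t = 0 := by
  have h0 := (sqrt_one_add_sq_pos t).ne'
  rw [beta, ← mul_div_assoc, div_eq_zero_iff] at h
  rcases h with h | h
  · simpa using h
  · exact absurd h h0

theorem memLp_beta_comp {X : Type*} [MeasurableSpace X] {m : Measure X} {f : X → ℝ}
    (hf : MemLp f 2 m) : MemLp (fun x => beta (f x)) 2 m :=
  hf.of_le (contDiff_beta.continuous.comp_aestronglyMeasurable hf.1)
    (Eventually.of_forall fun _ => abs_beta_le _)

theorem memLp_betaPrim_comp {X : Type*} [MeasurableSpace X] {m : Measure X} {f : X → ℝ}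
    (hf : MemLp f 2 m) : MemLp (fun x => betaPrim (f x)) 2 m :=
  hf.of_le (contDiff_betaPrim.continuous.comp_aestronglyMeasurable hf.1)
    (Eventually.of_forall fun _ => abs_betaPrim_le _)

theorem MeasureTheory.MemLp.bdd_mul' {X : Type*} [MeasurableSpace X] {m : Measure X} {f g : X → ℝ}
    (hf : MemLp f 2 m) (hg : AEStronglyMeasurable g m) {C : ℝ} (hC : ∀ᵐ x ∂m, |g x| ≤ C) :
    MemLp (fun x => g x * f x) 2 m := by
  refine hf.of_le_mul (c := C) (hg.mul hf.1) (hC.mono fun x hx => ?_)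
  rw [norm_mul]
  exact mul_le_mul_of_nonneg_right hx (norm_nonneg _)

end Beta

section Renormalized

variable {d : ℕ}

theorem rot_comp {β : ℝ → ℝ} (hβ : ContDiff ℝ ∞ β) {v : E d × E d → ℝ} (hv : ContDiff ℝ ∞ v)
    (i l : Fin (d + 1)) (q : E d × E d) :
    rot i l (fun q => β (v q)) q = deriv β (v q) * rot i l v q := by
  have h1 := ((hβ.differentiable (by simp) (v q)).hasDerivAt).comp_hasFDerivAt q
    (hasFDerivAt_of_smooth hv q)
  simp only [rot]
  rw [show fderiv ℝ (fun q => β (v q)) q = _ from h1.fderiv]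
  simp

theorem transport_comp {β : ℝ → ℝ} (hβ : ContDiff ℝ ∞ β) {v : E d × E d → ℝ}
    (hv : ContDiff ℝ ∞ v) (q : E d × E d) :
    transport (fun q => β (v q)) q = deriv β (v q) * transport v q := by
  have h1 := ((hβ.differentiable (by simp) (v q)).hasDerivAt).comp_hasFDerivAt q
    (hasFDerivAt_of_smooth hv q)
  rw [transport_eq hv, show transport (fun q => β (v q)) q = _ from transport_eq (hβ.comp hv) q]
  rw [show fderiv ℝ (β ∘ v) q = _ from h1.fderiv]
  simp

theorem IsTestV.exists_bound {φ : E d × E d → ℝ} (h : IsTestV φ) : ∃ C, ∀ q, |φ q| ≤ C :=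
  h.smooth.continuous.bounded_above_of_compact_support h.compact

end Renormalized

section Renormalized

variable {d : ℕ}

/-- `(u, w)` solves `-∇_θ·(a w) + τ Tu + b u = 0` weakly against the test functions which vanish
near the part `τ θⁿ ≤ 0` of the boundary. -/
def IsHomSol (τ : ℝ) (a b : E d → ℝ) (u : L2Q d) (w : L2QVec d) : Prop :=
  ∀ φ : E d × E d → ℝ, IsTestV φ →
    (∀ q ∈ tsupport φ, q.1 (Fin.last d) = 0 → ‖q.2‖ = 1 → 0 < τ * q.2 (Fin.last d)) →
    ∫ p, (a p.1 * inner ℝ (w p) (angGrad φ (amb p)) - τ * (u p * transport φ (amb p))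
      + b p.1 * (u p * φ (amb p))) ∂(measQ d) = 0

/-- The components of an angular gradient along the rotation fields. -/
def rotComp (w : L2QVec d) (i l : Fin (d + 1)) (p : E d × S d) : ℝ :=
  inner ℝ (w p) (rotVec i l (p.2 : E d))

theorem memLp_rotComp (w : L2QVec d) (i l : Fin (d + 1)) : MemLp (rotComp w i l) 2 (measQ d) :=
  memLp_inner_rotVec w i l

/-- A coefficient: measurable, essentially bounded by `A` on the half-space. -/
structure IsCoeff (a : E d → ℝ) (A : ℝ) : Prop where
  meas : AEMeasurable a (volume.restrict (halfSpace d))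
  nonneg : ∀ᵐ x ∂(volume.restrict (halfSpace d)), 0 ≤ a x
  bound : ∀ᵐ x ∂(volume.restrict (halfSpace d)), a x ≤ A

theorem ae_measQ_of_ae {P : E d → Prop} (h : ∀ᵐ x ∂(volume.restrict (halfSpace d)), P x) :
    ∀ᵐ p ∂(measQ d), P p.1 :=
  Measure.quasiMeasurePreserving_fst.ae h

variable {a b : E d → ℝ} {A B : ℝ}

theorem IsCoeff.aestronglyMeasurable (ha : IsCoeff a A) :
    AEStronglyMeasurable (fun p : E d × S d => a p.1) (measQ d) :=
  (ha.meas.comp_quasiMeasurePreserving Measure.quasiMeasurePreserving_fst).aestronglyMeasurable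

theorem IsCoeff.ae_abs_le (ha : IsCoeff a A) : ∀ᵐ p : E d × S d ∂(measQ d), |a p.1| ≤ A := by
  filter_upwards [ae_measQ_of_ae ha.nonneg, ae_measQ_of_ae ha.bound] with p h1 h2
  rwa [abs_of_nonneg h1]

theorem IsCoeff.memLp (ha : IsCoeff a A) {f : E d × S d → ℝ} (hf : MemLp f 2 (measQ d)) :
    MemLp (fun p => a p.1 * f p) 2 (measQ d) :=
  FokkerPlanck.MeasureTheory.MemLp.bdd_mul' hf ha.aestronglyMeasurable ha.ae_abs_le

theorem inner_angGrad_eq_sum {u : L2Q d} {w : L2QVec d} (h : IsAngGrad u w)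
    {φ : E d × E d → ℝ} (hφ : ContDiff ℝ ∞ φ) :
    ∀ᵐ p ∂(measQ d), inner ℝ (w p) (angGrad φ (amb p))
      = (1 / 2) * ∑ i, ∑ l, rotComp w i l p * rot i l φ (amb p) := by
  filter_upwards [h.1] with p hp
  rw [sum_inner_rotVec_sphere p.2 hp]
  congr 1
  refine Finset.sum_congr rfl fun i _ => Finset.sum_congr rfl fun l _ => ?_
  rw [rotComp, ← inner_angGrad_rotVec hφ i l (amb p)]
  rfl

/-- The weak formulation in terms of the rotation fields. -/
theorem IsHomSol.sum_eq {τ : ℝ} {u : L2Q d} {w : L2QVec d} (h : IsAngGrad u w)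
    (ha : IsCoeff a A) (hb : IsCoeff b B) (heq : IsHomSol τ a b u w) {φ : E d × E d → ℝ}
    (hφ : IsTestV φ)
    (hs : ∀ q ∈ tsupport φ, q.1 (Fin.last d) = 0 → ‖q.2‖ = 1 → 0 < τ * q.2 (Fin.last d)) :
    (1 / 2) * ∑ i, ∑ l, ∫ p, (a p.1 * rotComp w i l p) * rot i l φ (amb p) ∂(measQ d)
      - τ * ∫ p, u p * transport φ (amb p) ∂(measQ d)
      + ∫ p, (b p.1 * u p) * φ (amb p) ∂(measQ d) = 0 := by
  rw [← heq φ hφ hs]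
  have i1 : ∀ i l, Integrable (fun p => (a p.1 * rotComp w i l p) * rot i l φ (amb p))
      (measQ d) := fun i l =>
    (ha.memLp (memLp_rotComp w i l)).integrable_mul ((hφ.rot i l).memLp (measQ d))
  have i2 : Integrable (fun p => u p * transport φ (amb p)) (measQ d) :=
    (Lp.memLp u).integrable_mul (hφ.transport.memLp (measQ d))
  have i3 : Integrable (fun p => (b p.1 * u p) * φ (amb p)) (measQ d) :=
    (hb.memLp (Lp.memLp u)).integrable_mul (hφ.memLp (measQ d))
  have i0 : Integrable (fun p => (1 / 2) * ∑ i, ∑ l,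
      (a p.1 * rotComp w i l p) * rot i l φ (amb p)) (measQ d) :=
    (integrable_finsetSum _ fun i _ => integrable_finsetSum _ fun l _ => i1 i l).const_mul _
  have e1 : ∫ p, (1 / 2) * ∑ i, ∑ l, (a p.1 * rotComp w i l p) * rot i l φ (amb p) ∂(measQ d)
      = (1 / 2) * ∑ i, ∑ l, ∫ p, (a p.1 * rotComp w i l p) * rot i l φ (amb p) ∂(measQ d) := by
    rw [integral_const_mul, integral_finsetSum _ fun i _ =>
      integrable_finsetSum _ fun l _ => i1 i l]
    congr 1
    exact Finset.sum_congr rfl fun i _ => integral_finsetSum _ fun l _ => i1 i l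
  have i4 : Integrable (fun p => (1 / 2) * ∑ i, ∑ l,
      (a p.1 * rotComp w i l p) * rot i l φ (amb p) - τ * (u p * transport φ (amb p)))
      (measQ d) := i0.sub (i2.const_mul τ)
  rw [← e1, ← integral_const_mul, ← integral_sub i0 (i2.const_mul τ), ← integral_add i4 i3]
  refine integral_congr_ae ?_
  filter_upwards [inner_angGrad_eq_sum h hφ.smooth] with p hp
  rw [hp]
  simp only [Finset.mul_sum]
  rw [mul_assoc (b p.1)]
  congr 2
  refine Finset.sum_congr rfl fun i _ => Finset.sum_congr rfl fun l _ => ?_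
  ring

theorem IsTestV.comp_zero {ψ : E d × E d → ℝ} (hψ : IsTestV ψ) {β : ℝ → ℝ}
    (hβ : ContDiff ℝ ∞ β) {v : E d × E d → ℝ} (hv : ContDiff ℝ ∞ v) :
    IsTestV (fun q => ψ q * β (v q)) :=
  hψ.mul_right (hβ.comp hv)

open scoped Pointwise in
theorem IsTestV.moll {j : E d × E d → ℝ} (hj : IsTestV j) {G : E d × E d → ℝ} (hG : IsTestV G) :
    IsTestV (moll j ((phase d).indicator fun p => G (amb p))) := by
  refine ⟨contDiff_moll hj (locallyIntegrable_of_memLp (memLp_zeroExt (hG.memLp _))), ?_⟩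
  refine HasCompactSupport.of_support_subset_isCompact (K := tsupport G + tsupport j)
    (hG.compact.isCompact.add hj.compact.isCompact) fun q hq => ?_
  obtain ⟨p, hp, hjp⟩ := exists_of_moll_ne_zero hq
  refine ⟨amb p, subset_tsupport _ ?_, q - amb p, subset_tsupport _ hjp, by simp⟩
  exact fun h0 => hp (by simp [h0])

theorem ae_bdryMeasure_mem {G : Set (E d × S d)} (hG : MeasurableSet G) :
    ∀ᵐ p ∂(bdryMeasure d G), p ∈ G :=
  (withDensity_absolutelyContinuous _ _).ae_le (ae_restrict_mem hG)

/-- The test function `P*(1_Q G)` is admissible and gives the mollified weak formulation. -/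
theorem MollSeq.tested_le {τ s : ℝ} (hτ : |τ| = 1) {j : ℕ → E d × E d → ℝ} (hj : MollSeq s j)
    {u : L2Q d} {w : L2QVec d} (h : IsAngGrad u w) (ha : IsCoeff a A) (hb : IsCoeff b B)
    (heq : IsHomSol τ a b u w) {G : E d × E d → ℝ} (hG : IsTestV G) (k : ℕ)
    (hs : ∀ q ∈ tsupport (moll (fun y => j k (-y)) ((phase d).indicator fun p => G (amb p))),
      q.1 (Fin.last d) = 0 → ‖q.2‖ = 1 → 0 < τ * q.2 (Fin.last d)) :
    (1 / 2) * ∑ i, ∑ l, ∫ p, FokkerPlanck.rot i l G (amb p)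
        * moll (j k) ((phase d).indicator fun p => a p.1 * rotComp w i l p) (amb p) ∂(measQ d)
      + τ * ∫ p, G (amb p) * transport (moll (j k) ((phase d).indicator u)) (amb p) ∂(measQ d)
      + ∫ p, G (amb p)
        * moll (j k) ((phase d).indicator fun p => b p.1 * u p) (amb p) ∂(measQ d)
      ≤ 1 / ((k : ℝ) + 1) * ((eLpNorm ((phase d).indicator u) 2 (fullMeasure d)).toReal
        * (eLpNorm ((phase d).indicator fun p => G (amb p)) 2 (fullMeasure d)).toReal) := by
  set g : E d × S d → ℝ := (phase d).indicator fun p => G (amb p) with hg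
  have hGm : MemLp (fun p => G (amb p)) 2 (measQ d) := hG.memLp _
  have hgm : MemLp g 2 (fullMeasure d) := memLp_zeroExt hGm
  have hum : MemLp ((phase d).indicator u) 2 (fullMeasure d) := memLp_zeroExt (Lp.memLp u)
  have hΦ : IsTestV (moll (fun y => j k (-y)) g) := (hj.reverse.test k).moll hG
  have key := IsHomSol.sum_eq h ha hb heq hΦ hs
  have adj : ∀ {f : E d × S d → ℝ} {F : E d × E d → ℝ}, MemLp f 2 (measQ d) → IsTestV F →
      ∫ p, f p * moll (fun y => j k (-y)) ((phase d).indicator fun p => F (amb p)) (amb p)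
        ∂(measQ d)
      = ∫ p, F (amb p) * moll (j k) ((phase d).indicator f) (amb p) ∂(measQ d) := by
    intro f F hf hF
    rw [← integral_zeroExt_mul, ← integral_zeroExt_mul,
      hj.integral_mul_moll k (memLp_zeroExt hf) (memLp_zeroExt (hF.memLp _))]
  have e1 : ∀ i l, ∫ p, (a p.1 * rotComp w i l p)
      * FokkerPlanck.rot i l (moll (fun y => j k (-y)) g) (amb p) ∂(measQ d)
      = ∫ p, FokkerPlanck.rot i l G (amb p)
        * moll (j k) ((phase d).indicator fun p => a p.1 * rotComp w i l p) (amb p)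
        ∂(measQ d) := by
    intro i l
    rw [← adj (ha.memLp (memLp_rotComp w i l)) (hG.rot i l)]
    refine integral_congr_ae (Eventually.of_forall fun p => ?_)
    simp only
    rw [hj.reverse.rot_moll k (locallyIntegrable_of_memLp hgm) (isWeakRot_of_test hG i l)]
  simp only [e1] at key
  rw [adj (hb.memLp (Lp.memLp u)) hG] at key
  have hw : ContDiff ℝ ∞ (moll (j k) ((phase d).indicator u)) :=
    contDiff_moll (hj.test k) (locallyIntegrable_of_memLp hum)
  have hGT : IsTestV fun q => G q * transport (moll (j k) ((phase d).indicator u)) q :=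
    hG.mul_right (contDiff_transport hw)
  have e2 : (fun q => g q * transport (moll (j k) ((phase d).indicator u)) (amb q))
      = (phase d).indicator
        fun q => G (amb q) * transport (moll (j k) ((phase d).indicator u)) (amb q) := by
    funext q
    by_cases hq : q ∈ phase d <;> simp [hg, hq]
  have c2 : Integrable (fun q => g q * transport (moll (j k) ((phase d).indicator u)) (amb q))
      (fullMeasure d) := by
    rw [e2]
    exact (hGT.integrable _).indicator (measurableSet_phase d)
  have hc := hj.commutator_le k hum hgm c2
  rw [integral_zeroExt_mul, hg, integral_zeroExt_mul] at hc
  rw [← hg] at hc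
  set X := ∫ p, u p * transport (moll (fun y => j k (-y)) g) (amb p) ∂(measQ d)
  set Z := ∫ p, G (amb p) * transport (moll (j k) ((phase d).indicator u)) (amb p) ∂(measQ d)
  have h3 : τ * (X + Z) ≤ |X + Z| := by
    calc τ * (X + Z) ≤ |τ * (X + Z)| := le_abs_self _
      _ = |X + Z| := by rw [abs_mul, hτ, one_mul]
  have h4 := h3.trans hc
  have h5 : τ * (X + Z) = τ * X + τ * Z := by ring
  linarith

end Renormalized

section Limit

variable {d : ℕ} {a b : E d → ℝ} {A B : ℝ}

/-- The weights `ψ` admissible in the renormalized inequality, for mollification from the side `s`: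
they vanish near the part `τ θⁿ ≤ 0` of phase space, or vanish on the part `τ θⁿ > 0` of the
boundary. -/
def IsSided (τ s : ℝ) (ψ : E d × E d → ℝ) : Prop :=
  (s = 1 ∧ ∃ c > 0, ∀ q, ψ q ≠ 0 → c ≤ τ * q.2 (Fin.last d)) ∨
  (s = -1 ∧ ∀ p : E d × S d, p.1 (Fin.last d) = 0 → 0 < τ * (p.2 : E d) (Fin.last d) →
    ψ (amb p) = 0)

theorem abs_last_le (x : E d) : |x (Fin.last d)| ≤ ‖x‖ := by
  simpa using PiLp.norm_apply_le x (Fin.last d)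

/-- For `k` large, `P*(1_Q ψ v)` is an admissible test function. -/
theorem MollSeq.eventually_admissible {τ s : ℝ} (hτ : |τ| = 1) {j : ℕ → E d × E d → ℝ}
    (hj : MollSeq s j) {ψ : E d × E d → ℝ} (hs : IsSided τ s ψ) :
    ∀ᶠ k in atTop, ∀ v : E d × E d → ℝ,
      ∀ q ∈ tsupport (moll (fun y => j k (-y))
        ((phase d).indicator fun p => ψ (amb p) * v (amb p))),
      q.1 (Fin.last d) = 0 → ‖q.2‖ = 1 → 0 < τ * q.2 (Fin.last d) := by
  have main : ∀ (k : ℕ) (v : E d × E d → ℝ) (q : E d × E d),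
      moll (fun y => j k (-y)) ((phase d).indicator fun p => ψ (amb p) * v (amb p)) q ≠ 0 →
      ∃ p : E d × S d, 0 < p.1 (Fin.last d) ∧ ψ (amb p) ≠ 0 ∧ j k (amb p - q) ≠ 0 := by
    intro k v q hq
    obtain ⟨p, hp, hjp⟩ := exists_of_moll_ne_zero hq
    have hmem : p ∈ phase d := Set.mem_of_indicator_ne_zero hp
    rw [Set.indicator_of_mem hmem] at hp
    exact ⟨p, hmem, left_ne_zero_of_mul hp, by simpa using hjp⟩
  rcases hs with ⟨rfl, c, hc, hψ⟩ | ⟨rfl, -⟩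
  · have hlim : Tendsto (fun k : ℕ => 2 / ((k : ℝ) + 1)) atTop (𝓝 0) := by
      simpa [div_eq_mul_inv] using (tendsto_one_div_add_atTop_nhds_zero_nat (𝕜 := ℝ)).const_mul 2
    filter_upwards [hlim.eventually (gt_mem_nhds (half_pos hc))] with k hk v q hq _ _
    have hcl : IsClosed {q : E d × E d | c / 2 ≤ τ * q.2 (Fin.last d)} :=
      isClosed_le continuous_const (continuous_const.mul (continuous_last.comp continuous_snd))
    refine (half_pos hc).trans_le (closure_minimal (fun q hq => ?_) hcl hq)
    obtain ⟨p, -, hp, hjp⟩ := main k v q hq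
    have h1 := hψ _ hp
    have h2 := hj.norm_le k _ hjp
    have h3 : τ * ((p.2 : E d) - q.2) (Fin.last d) ≤ 2 / ((k : ℝ) + 1) := by
      calc τ * ((p.2 : E d) - q.2) (Fin.last d) ≤ |τ * ((p.2 : E d) - q.2) (Fin.last d)| :=
            le_abs_self _
        _ = |((p.2 : E d) - q.2) (Fin.last d)| := by rw [abs_mul, hτ, one_mul]
        _ ≤ ‖(p.2 : E d) - q.2‖ := abs_last_le _
        _ ≤ ‖amb p - q‖ := norm_snd_le (amb p - q)
        _ ≤ _ := h2
    have h4 : τ * ((p.2 : E d) - q.2) (Fin.last d)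
        = τ * (p.2 : E d) (Fin.last d) - τ * q.2 (Fin.last d) := by
      rw [PiLp.sub_apply]; ring
    have h5 : (amb p).2 = (p.2 : E d) := rfl
    rw [h5] at h1
    simp only [Set.mem_ofPred_eq]
    linarith
  · refine Eventually.of_forall fun k v q hq h0 _ => ?_
    exfalso
    have hcl : IsClosed {q : E d × E d | 1 / (2 * ((k : ℝ) + 1)) ≤ q.1 (Fin.last d)} :=
      isClosed_le continuous_const (continuous_last.comp continuous_fst)
    have h1 : 1 / (2 * ((k : ℝ) + 1)) ≤ q.1 (Fin.last d) :=
      closure_minimal (fun q hq => by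
        obtain ⟨p, hp0, hp, hjp⟩ := main k v q hq
        have h1 := hj.side k _ hjp
        have h2 : (amb p - q).1 (Fin.last d) = p.1 (Fin.last d) - q.1 (Fin.last d) := by
          rw [Prod.fst_sub, PiLp.sub_apply]; rfl
        rw [h2] at h1
        simp only [Set.mem_ofPred_eq]
        linarith) hcl hq
    have : (0 : ℝ) < 1 / (2 * ((k : ℝ) + 1)) := by positivity
    linarith

/-- The boundary term of the renormalized inequality has a sign. -/
theorem MollSeq.boundary_nonneg {τ s : ℝ} (hτ : |τ| = 1) {j : ℕ → E d × E d → ℝ}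
    (hj : MollSeq s j) {ψ : E d × E d → ℝ} (hψ : IsTestV ψ) (h0 : ∀ q, 0 ≤ ψ q)
    (hs : IsSided τ s ψ) (u : L2Q d) (k : ℕ) :
    0 ≤ τ * ∫ p, transport (fun q => ψ q * betaPrim (moll (j k) ((phase d).indicator u) q))
      (amb p) ∂(measQ d) := by
  have hum : MemLp ((phase d).indicator u) 2 (fullMeasure d) := memLp_zeroExt (Lp.memLp u)
  have hw : ContDiff ℝ ∞ (moll (j k) ((phase d).indicator u)) :=
    contDiff_moll (hj.test k) (locallyIntegrable_of_memLp hum)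
  have hF := hψ.comp_zero contDiff_betaPrim hw
  set F : E d × E d → ℝ := fun q => ψ q * betaPrim (moll (j k) ((phase d).indicator u) q)
  have hF0 : ∀ q, 0 ≤ F q := fun q => mul_nonneg (h0 q) (betaPrim_nonneg _)
  have hvan : ∀ p : E d × S d, p.1 (Fin.last d) = 0 → 0 < τ * (p.2 : E d) (Fin.last d) →
      F (amb p) = 0 := by
    intro p hp1 hp2
    rcases hs with ⟨rfl, -⟩ | ⟨-, hs⟩
    · have : moll (j k) ((phase d).indicator u) (amb p) = 0 := by
        by_contra hne
        obtain ⟨p', hp', hjp⟩ := exists_of_moll_ne_zero hne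
        have hmem0 : p' ∈ phase d := Set.mem_of_indicator_ne_zero hp'
        have hmem : 0 < p'.1 (Fin.last d) := hmem0
        have h1 := hj.side k _ hjp
        have h2 : (amb p - amb p').1 (Fin.last d) = p.1 (Fin.last d) - p'.1 (Fin.last d) := by
          rw [Prod.fst_sub, PiLp.sub_apply]; rfl
        rw [h2, hp1] at h1
        have : (0 : ℝ) < 1 / (2 * ((k : ℝ) + 1)) := by positivity
        linarith
      simp [F, this, betaPrim_zero]
    · simp [F, hs p hp1 hp2]
  rw [integral_transport hF]
  have hp : 0 ≤ ∫ p, F (amb p) ∂(bdryMeasure d (GammaPlus d)) :=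
    integral_nonneg fun p => hF0 _
  have hm : 0 ≤ ∫ p, F (amb p) ∂(bdryMeasure d (GammaMinus d)) :=
    integral_nonneg fun p => hF0 _
  rcases eq_or_eq_neg_of_abs_eq hτ with rfl | rfl
  · have : ∫ p, F (amb p) ∂(bdryMeasure d (GammaMinus d)) = 0 := by
      refine integral_eq_zero_of_ae ?_
      filter_upwards [ae_bdryMeasure_mem (measurableSet_GammaMinus d)] with p hp
      have h2 := hp.2
      rw [inner_normal] at h2
      exact hvan p hp.1 (by linarith)
    rw [this]; linarith
  · have : ∫ p, F (amb p) ∂(bdryMeasure d (GammaPlus d)) = 0 := by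
      refine integral_eq_zero_of_ae ?_
      filter_upwards [ae_bdryMeasure_mem (measurableSet_GammaPlus d)] with p hp
      have h2 := hp.2
      rw [inner_normal] at h2
      exact hvan p hp.1 (by linarith)
    rw [this]; linarith

/-- The mollified renormalized inequality. -/
theorem MollSeq.renormalized_le {τ s : ℝ} (hτ : |τ| = 1) {j : ℕ → E d × E d → ℝ}
    (hj : MollSeq s j) {u : L2Q d} {w : L2QVec d} (h : IsAngGrad u w) (ha : IsCoeff a A)
    (hb : IsCoeff b B) (heq : IsHomSol τ a b u w) {ψ : E d × E d → ℝ} (hψ : IsTestV ψ)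
    (h0 : ∀ q, 0 ≤ ψ q) (hs : IsSided τ s ψ) {C : ℝ} (hC : ∀ q, |ψ q| ≤ C) :
    ∀ᶠ k in atTop,
      (1 / 2) * ∑ i, ∑ l,
          (∫ p, (FokkerPlanck.rot i l ψ (amb p)
              * beta (moll (j k) ((phase d).indicator u) (amb p)))
            * moll (j k) ((phase d).indicator fun p => a p.1 * rotComp w i l p) (amb p) ∂(measQ d)
          - ∫ p, (C * |moll (j k) ((phase d).indicator (rotComp w i l)) (amb p)|)
            * |moll (j k) ((phase d).indicator fun p => a p.1 * rotComp w i l p) (amb p)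
              + -(a p.1 * moll (j k) ((phase d).indicator (rotComp w i l)) (amb p))| ∂(measQ d))
        + ∫ p, (ψ (amb p) * beta (moll (j k) ((phase d).indicator u) (amb p)))
          * moll (j k) ((phase d).indicator fun p => b p.1 * u p) (amb p) ∂(measQ d)
      ≤ τ * ∫ p, betaPrim (moll (j k) ((phase d).indicator u) (amb p))
          * transport ψ (amb p) ∂(measQ d)
        + 1 / ((k : ℝ) + 1) * ((eLpNorm ((phase d).indicator u) 2 (fullMeasure d)).toReal
        * (eLpNorm ((phase d).indicator fun p => ψ (amb p)) 2 (fullMeasure d)).toReal) := by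
  filter_upwards [hj.eventually_admissible hτ hs] with k hk
  have hum : MemLp ((phase d).indicator u) 2 (fullMeasure d) := memLp_zeroExt (Lp.memLp u)
  have hv : ContDiff ℝ ∞ (moll (j k) ((phase d).indicator u)) :=
    contDiff_moll (hj.test k) (locallyIntegrable_of_memLp hum)
  have hbd := hj.boundary_nonneg hτ hψ h0 hs u k
  have hG := hψ.comp_zero contDiff_beta hv
  have hmain := hj.tested_le hτ h ha hb heq hG k
    (hk fun q => beta (moll (j k) ((phase d).indicator u) q))
  set v := moll (j k) ((phase d).indicator u)
  have hβ : ContDiff ℝ ∞ fun q => beta (v q) := contDiff_beta.comp hv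
  have hB : ContDiff ℝ ∞ fun q => betaPrim (v q) := contDiff_betaPrim.comp hv
  -- the norm of the test function
  have hnorm : (eLpNorm ((phase d).indicator fun p => ψ (amb p) * beta (v (amb p))) 2
      (fullMeasure d)).toReal
      ≤ (eLpNorm ((phase d).indicator fun p => ψ (amb p)) 2 (fullMeasure d)).toReal := by
    refine ENNReal.toReal_mono (memLp_zeroExt (hψ.memLp _)).2.ne (eLpNorm_mono fun p => ?_)
    by_cases hp : p ∈ phase d
    · simp only [Set.indicator_of_mem hp, norm_mul]
      exact mul_le_of_le_one_right (norm_nonneg _) (abs_beta_le_one _)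
    · simp [hp]
  have hnorm' := mul_le_mul_of_nonneg_left hnorm (ENNReal.toReal_nonneg
    (a := eLpNorm ((phase d).indicator u) 2 (fullMeasure d)))
  have hk0 : (0 : ℝ) ≤ 1 / ((k : ℝ) + 1) := by positivity
  have hnorm2 := mul_le_mul_of_nonneg_left hnorm' hk0
  -- the transport term
  have htr : τ * ∫ p, transport (fun q => ψ q * betaPrim (v q)) (amb p) ∂(measQ d)
      = τ * ∫ p, (ψ (amb p) * beta (v (amb p))) * transport v (amb p) ∂(measQ d)
        + τ * ∫ p, betaPrim (v (amb p)) * transport ψ (amb p) ∂(measQ d) := by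
    rw [← mul_add, ← integral_add]
    · congr 1
      refine integral_congr_ae (Eventually.of_forall fun p => ?_)
      simp only
      rw [transport_mul hψ.smooth hB, transport_comp contDiff_betaPrim hv,
        (hasDerivAt_betaPrim _).deriv]
      ring
    · exact (hG.mul_right (contDiff_transport hv)).integrable _
    · exact (hψ.transport.mul_left hB).integrable _
  -- the angular terms
  have hang : ∀ i l, (∫ p, (FokkerPlanck.rot i l ψ (amb p) * beta (v (amb p)))
            * moll (j k) ((phase d).indicator fun p => a p.1 * rotComp w i l p) (amb p) ∂(measQ d)
          - ∫ p, (C * |moll (j k) ((phase d).indicator (rotComp w i l)) (amb p)|)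
            * |moll (j k) ((phase d).indicator fun p => a p.1 * rotComp w i l p) (amb p)
              + -(a p.1 * moll (j k) ((phase d).indicator (rotComp w i l)) (amb p))| ∂(measQ d))
      ≤ ∫ p, FokkerPlanck.rot i l (fun q => ψ q * beta (v q)) (amb p)
        * moll (j k) ((phase d).indicator fun p => a p.1 * rotComp w i l p) (amb p)
        ∂(measQ d) := by
    intro i l
    have hx := hj.memLp_measQ k (memLp_rotComp w i l)
    have hy := hj.memLp_measQ k (ha.memLp (memLp_rotComp w i l))
    have hR : IsTestV fun q => FokkerPlanck.rot i l ψ q * beta (v q) :=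
      (hψ.rot i l).comp_zero contDiff_beta hv
    rw [← integral_sub]
    · refine integral_mono_ae ?_ ?_ ?_
      · refine Integrable.sub ((hR.memLp _).integrable_mul hy) ?_
        exact (hx.abs.const_mul C).integrable_mul (hy.add (ha.memLp hx).neg).abs
      · exact ((hG.rot i l).memLp _).integrable_mul hy
      · filter_upwards [ae_measQ_of_ae ha.nonneg] with p hp
        have hwk : FokkerPlanck.rot i l v (amb p)
            = moll (j k) ((phase d).indicator (rotComp w i l)) (amb p) :=
          hj.rot_moll k (locallyIntegrable_of_memLp hum) (h.isWeakRot i l) _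
        rw [rot_mul hψ.smooth hβ, rot_comp contDiff_beta hv, hwk]
        set x := moll (j k) ((phase d).indicator (rotComp w i l)) (amb p)
        set y := moll (j k) ((phase d).indicator fun p => a p.1 * rotComp w i l p) (amb p)
        set c := ψ (amb p) * deriv beta (v (amb p)) with hc
        have hc0 : 0 ≤ c := mul_nonneg (h0 _) (deriv_beta_nonneg _)
        have hc1 : c ≤ C :=
          (mul_le_of_le_one_right (h0 _) (deriv_beta_le_one _)).trans
            ((le_abs_self _).trans (hC _))
        have e1 : c * (x * y) ≥ - (c * (|x| * |y + -(a p.1 * x)|)) := by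
          have h1 : x * (y + -(a p.1 * x)) ≥ - (|x| * |y + -(a p.1 * x)|) := by
            rw [← abs_mul]; exact neg_abs_le _
          have h2 : x * y ≥ x * (y + -(a p.1 * x)) := by nlinarith [mul_nonneg hp (sq_nonneg x)]
          calc c * (x * y) ≥ c * (- (|x| * |y + -(a p.1 * x)|)) :=
                mul_le_mul_of_nonneg_left (h1.trans h2) hc0
            _ = _ := by ring
        have e2 : c * (|x| * |y + -(a p.1 * x)|) ≤ C * (|x| * |y + -(a p.1 * x)|) :=
          mul_le_mul_of_nonneg_right hc1 (by positivity)
        have e3 : (ψ (amb p) * (deriv beta (v (amb p)) * x)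
            + beta (v (amb p)) * FokkerPlanck.rot i l ψ (amb p)) * y
            = c * (x * y) + FokkerPlanck.rot i l ψ (amb p) * beta (v (amb p)) * y := by
          rw [hc]; ring
        rw [e3]
        linarith [mul_assoc C |x| |y + -(a p.1 * x)|]
    · exact (hR.memLp _).integrable_mul hy
    · exact (hx.abs.const_mul C).integrable_mul (hy.add (ha.memLp hx).neg).abs
  have hsum := Finset.sum_le_sum fun i (_ : i ∈ Finset.univ) =>
    Finset.sum_le_sum fun l (_ : l ∈ Finset.univ) => hang i l
  linarith

/-- The renormalized inequality. -/
theorem IsHomSol.renormalized_le {τ s : ℝ} (hτ : |τ| = 1) (hs1 : |s| = 1)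
    {u : L2Q d} {w : L2QVec d} (h : IsAngGrad u w) (ha : IsCoeff a A)
    (hb : IsCoeff b B) (heq : IsHomSol τ a b u w) {ψ : E d × E d → ℝ} (hψ : IsTestV ψ)
    (h0 : ∀ q, 0 ≤ ψ q) (hs : IsSided τ s ψ) :
    (1 / 2) * ∑ i, ∑ l,
        ∫ p, (rot i l ψ (amb p) * beta (u p)) * (a p.1 * rotComp w i l p) ∂(measQ d)
      + ∫ p, (ψ (amb p) * beta (u p)) * (b p.1 * u p) ∂(measQ d)
    ≤ τ * ∫ p, betaPrim (u p) * transport ψ (amb p) ∂(measQ d) := by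
  obtain ⟨j, hj⟩ := exists_mollSeq d hs1
  obtain ⟨C, hC⟩ := hψ.exists_bound
  have hle := hj.renormalized_le hτ h ha hb heq hψ h0 hs hC
  have hu : MemLp u 2 (measQ d) := Lp.memLp u
  have hPu := hj.tendstoL2_measQ hu
  have mPu := fun k => hj.memLp_measQ k hu
  -- weights times the nonlinearity
  have hwt : ∀ {φ : E d × E d → ℝ}, IsTestV φ → MemLp (fun p => φ (amb p) * beta (u p)) 2 (measQ d) ∧
      (∀ k, MemLp (fun p => φ (amb p) * beta (moll (j k) ((phase d).indicator u) (amb p))) 2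
        (measQ d)) ∧ TendstoL2 (measQ d)
        (fun k p => φ (amb p) * beta (moll (j k) ((phase d).indicator u) (amb p)))
        (fun p => φ (amb p) * beta (u p)) := by
    intro φ hφ
    obtain ⟨D, hD⟩ := hφ.exists_bound
    have hm : AEStronglyMeasurable (fun p => φ (amb p)) (measQ d) := (hφ.memLp _).1
    refine ⟨FokkerPlanck.MeasureTheory.MemLp.bdd_mul' (memLp_beta_comp hu) hm
      (Eventually.of_forall fun p => hD _), fun k =>
      FokkerPlanck.MeasureTheory.MemLp.bdd_mul' (memLp_beta_comp (mPu k)) hm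
      (Eventually.of_forall fun p => hD _), hPu.of_le D fun k => Eventually.of_forall fun p => ?_⟩
    rw [← mul_sub, norm_mul]
    exact mul_le_mul (hD _) (beta_lipschitz _ _) (norm_nonneg _) ((abs_nonneg _).trans (hD 0))
  have t1 : ∀ i l, Tendsto (fun k => ∫ p, (rot i l ψ (amb p)
              * beta (moll (j k) ((phase d).indicator u) (amb p)))
            * moll (j k) ((phase d).indicator fun p => a p.1 * rotComp w i l p) (amb p) ∂(measQ d))
      atTop (𝓝 (∫ p, (rot i l ψ (amb p) * beta (u p)) * (a p.1 * rotComp w i l p) ∂(measQ d))) := by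
    intro i l
    obtain ⟨m1, m2, m3⟩ := hwt (hψ.rot i l)
    have ha' := ha.memLp (memLp_rotComp w i l)
    exact TendstoL2.integral_mul m2 (fun k => hj.memLp_measQ k ha') m1 ha' m3
      (hj.tendstoL2_measQ ha')
  have t2 : ∀ i l, Tendsto (fun k =>
      ∫ p, (C * |moll (j k) ((phase d).indicator (rotComp w i l)) (amb p)|)
            * |moll (j k) ((phase d).indicator fun p => a p.1 * rotComp w i l p) (amb p)
              + -(a p.1 * moll (j k) ((phase d).indicator (rotComp w i l)) (amb p))| ∂(measQ d))
      atTop (𝓝 0) := by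
    intro i l
    have hW := memLp_rotComp w i l
    have haW := ha.memLp hW
    have mW := fun k => hj.memLp_measQ k hW
    have maW := fun k => hj.memLp_measQ k haW
    have l1 : TendstoL2 (measQ d)
        (fun k p => C * |moll (j k) ((phase d).indicator (rotComp w i l)) (amb p)|)
        (fun p => C * |rotComp w i l p|) := by
      refine (hj.tendstoL2_measQ hW).of_le |C| fun k => Eventually.of_forall fun p => ?_
      rw [← mul_sub, norm_mul, Real.norm_eq_abs]
      exact mul_le_mul_of_nonneg_left (abs_abs_sub_abs_le_abs_sub _ _) (abs_nonneg _)
    have l2 : TendstoL2 (measQ d)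
        (fun k p => -(a p.1 * moll (j k) ((phase d).indicator (rotComp w i l)) (amb p)))
        (fun p => -(a p.1 * rotComp w i l p)) := by
      refine (hj.tendstoL2_measQ hW).of_le A fun k => ?_
      filter_upwards [ha.ae_abs_le] with p hp
      rw [← neg_sub_neg, neg_neg, neg_neg, ← mul_sub, norm_mul, norm_sub_rev]
      exact mul_le_mul_of_nonneg_right hp (norm_nonneg _)
    have l3 := TendstoL2.add maW (fun k => (ha.memLp (mW k)).neg) haW haW.neg
      (hj.tendstoL2_measQ haW) l2
    have l4 : TendstoL2 (measQ d)
        (fun k p => |moll (j k) ((phase d).indicator fun p => a p.1 * rotComp w i l p) (amb p)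
              + -(a p.1 * moll (j k) ((phase d).indicator (rotComp w i l)) (amb p))|)
        (fun p => |a p.1 * rotComp w i l p + -(a p.1 * rotComp w i l p)|) := by
      refine l3.of_le 1 fun k => Eventually.of_forall fun p => ?_
      rw [one_mul]
      exact abs_abs_sub_abs_le_abs_sub _ _
    have := TendstoL2.integral_mul (fun k => (mW k).abs.const_mul C)
      (fun k => ((maW k).add (ha.memLp (mW k)).neg).abs) (hW.abs.const_mul C)
      (haW.add haW.neg).abs l1 l4
    simpa using this
  have t3 : Tendsto (fun k => ∫ p, (ψ (amb p) * beta (moll (j k) ((phase d).indicator u) (amb p)))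
          * moll (j k) ((phase d).indicator fun p => b p.1 * u p) (amb p) ∂(measQ d)) atTop
      (𝓝 (∫ p, (ψ (amb p) * beta (u p)) * (b p.1 * u p) ∂(measQ d))) := by
    obtain ⟨m1, m2, m3⟩ := hwt hψ
    have hb' := hb.memLp hu
    exact TendstoL2.integral_mul m2 (fun k => hj.memLp_measQ k hb') m1 hb' m3
      (hj.tendstoL2_measQ hb')
  have t4 : Tendsto (fun k => ∫ p, betaPrim (moll (j k) ((phase d).indicator u) (amb p))
          * transport ψ (amb p) ∂(measQ d)) atTop
      (𝓝 (∫ p, betaPrim (u p) * transport ψ (amb p) ∂(measQ d))) := by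
    have l1 : TendstoL2 (measQ d)
        (fun k p => betaPrim (moll (j k) ((phase d).indicator u) (amb p)))
        (fun p => betaPrim (u p)) :=
      hPu.of_le 1 fun k => Eventually.of_forall fun p => by
        rw [one_mul]; exact betaPrim_lipschitz _ _
    exact TendstoL2.integral_mul (fun k => memLp_betaPrim_comp (mPu k))
      (fun _ => hψ.transport.memLp _) (memLp_betaPrim_comp hu) (hψ.transport.memLp _) l1
      (TendstoL2.const _)
  have t5 := (tendsto_one_div_add_atTop_nhds_zero_nat (𝕜 := ℝ)).mul_const
    ((eLpNorm ((phase d).indicator u) 2 (fullMeasure d)).toReal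
        * (eLpNorm ((phase d).indicator fun p => ψ (amb p)) 2 (fullMeasure d)).toReal)
  have tL := ((tendsto_finsetSum Finset.univ fun i _ => tendsto_finsetSum Finset.univ fun l _ =>
    (t1 i l).sub (t2 i l)).const_mul (1 / 2)).add t3
  have tR := (t4.const_mul τ).add t5
  have := le_of_tendsto_of_tendsto tL tR hle
  simpa using this

end Limit

section Weights

variable {d : ℕ}

theorem rot_add {φ χ : E d × E d → ℝ} (h : ContDiff ℝ ∞ φ) (hχ : ContDiff ℝ ∞ χ)
    (i j : Fin (d + 1)) (q : E d × E d) :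
    rot i j (fun q => φ q + χ q) q = rot i j φ q + rot i j χ q := by
  simp only [rot]
  rw [show fderiv ℝ (fun q => φ q + χ q) q = _ from
    ((hasFDerivAt_of_smooth h q).add (hasFDerivAt_of_smooth hχ q)).fderiv]
  simp

theorem transport_add {φ χ : E d × E d → ℝ} (h : ContDiff ℝ ∞ φ) (hχ : ContDiff ℝ ∞ χ)
    (q : E d × E d) :
    transport (fun q => φ q + χ q) q = transport φ q + transport χ q := by
  rw [transport_eq h, transport_eq hχ, transport_eq (h.add hχ)]
  rw [show fderiv ℝ (fun q => φ q + χ q) q = _ from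
    ((hasFDerivAt_of_smooth h q).add (hasFDerivAt_of_smooth hχ q)).fderiv]
  simp

theorem rot_one_sub {φ : E d × E d → ℝ} (h : ContDiff ℝ ∞ φ)
    (i j : Fin (d + 1)) (q : E d × E d) :
    rot i j (fun q => 1 - φ q) q = - rot i j φ q := by
  simp only [rot]
  rw [show fderiv ℝ (fun q => 1 - φ q) q = _ from
    ((hasFDerivAt_of_smooth h q).const_sub 1).fderiv]
  simp

theorem transport_one_sub {φ : E d × E d → ℝ} (h : ContDiff ℝ ∞ φ) (q : E d × E d) :
    transport (fun q => 1 - φ q) q = - transport φ q := by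
  rw [transport_eq h, transport_eq (contDiff_const.sub h)]
  rw [show fderiv ℝ (fun q => 1 - φ q) q = _ from
    ((hasFDerivAt_of_smooth h q).const_sub 1).fderiv]
  simp

theorem contDiff_scalar_comp {β : ℝ → ℝ} (hβ : ContDiff ℝ ∞ β) {v : E d × E d → ℝ}
    (hv : ContDiff ℝ ∞ v) : ContDiff ℝ ∞ fun q => β (v q) :=
  hβ.comp hv

theorem contDiff_last_fst (c : ℝ) : ContDiff ℝ ∞ fun q : E d × E d => c * q.1 (Fin.last d) :=
  contDiff_const.mul ((EuclideanSpace.proj (𝕜 := ℝ) (Fin.last d)).contDiff.comp contDiff_fst)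

theorem contDiff_last_snd (c : ℝ) : ContDiff ℝ ∞ fun q : E d × E d => c * q.2 (Fin.last d) :=
  contDiff_const.mul ((EuclideanSpace.proj (𝕜 := ℝ) (Fin.last d)).contDiff.comp contDiff_snd)

theorem contDiff_normSq_fst (c : ℝ) : ContDiff ℝ ∞ fun q : E d × E d => c * ‖q.1‖ ^ 2 :=
  contDiff_const.mul (contDiff_fst.norm_sq ℝ)

theorem contDiff_normSq_snd : ContDiff ℝ ∞ fun q : E d × E d => ‖q.2‖ ^ 2 :=
  contDiff_snd.norm_sq ℝ

theorem fderiv_last_fst (c : ℝ) (q v : E d × E d) :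
    fderiv ℝ (fun q : E d × E d => c * q.1 (Fin.last d)) q v = c * v.1 (Fin.last d) := by
  have h : HasFDerivAt (fun q : E d × E d => c * q.1 (Fin.last d))
      (c • ((EuclideanSpace.proj (𝕜 := ℝ) (Fin.last d)).comp
        (ContinuousLinearMap.fst ℝ (E d) (E d)))) q :=
    (ContinuousLinearMap.hasFDerivAt ((EuclideanSpace.proj (𝕜 := ℝ) (Fin.last d)).comp
        (ContinuousLinearMap.fst ℝ (E d) (E d)))).const_mul c
  rw [h.fderiv]; simp

theorem fderiv_last_snd (c : ℝ) (q v : E d × E d) :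
    fderiv ℝ (fun q : E d × E d => c * q.2 (Fin.last d)) q v = c * v.2 (Fin.last d) := by
  have h : HasFDerivAt (fun q : E d × E d => c * q.2 (Fin.last d))
      (c • ((EuclideanSpace.proj (𝕜 := ℝ) (Fin.last d)).comp
        (ContinuousLinearMap.snd ℝ (E d) (E d)))) q :=
    (ContinuousLinearMap.hasFDerivAt ((EuclideanSpace.proj (𝕜 := ℝ) (Fin.last d)).comp
        (ContinuousLinearMap.snd ℝ (E d) (E d)))).const_mul c
  rw [h.fderiv]; simp

theorem fderiv_normSq_fst (c : ℝ) (q v : E d × E d) :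
    fderiv ℝ (fun q : E d × E d => c * ‖q.1‖ ^ 2) q v = c * (2 * inner ℝ q.1 v.1) := by
  have h := ((hasFDerivAt_fst (𝕜 := ℝ) (p := q)).norm_sq).const_mul c
  rw [h.fderiv]; simp

theorem fderiv_normSq_snd (q v : E d × E d) :
    fderiv ℝ (fun q : E d × E d => ‖q.2‖ ^ 2) q v = 2 * inner ℝ q.2 v.2 := by
  have h := ((hasFDerivAt_snd (𝕜 := ℝ) (p := q)).norm_sq)
  rw [h.fderiv]; simp

theorem exists_deriv_smoothTransition_le :
    ∃ K, 0 ≤ K ∧ ∀ t, |deriv Real.smoothTransition t| ≤ K := by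
  have hc : Continuous (deriv Real.smoothTransition) :=
    (Real.smoothTransition.contDiff (n := 1)).continuous_deriv le_rfl
  obtain ⟨K, hK⟩ := isCompact_Icc.exists_bound_of_continuousOn (s := Set.Icc (0 : ℝ) 1)
    hc.continuousOn
  refine ⟨K, (norm_nonneg _).trans (hK 0 (by simp)), fun t => ?_⟩
  by_cases ht : t ∈ Set.Icc (0 : ℝ) 1
  · exact hK t ht
  · have h0 : deriv Real.smoothTransition t = 0 := by
      rw [Set.mem_Icc, not_and_or, not_le, not_le] at ht
      rcases ht with ht | ht
      · have : Real.smoothTransition =ᶠ[𝓝 t] fun _ => 0 := by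
          filter_upwards [gt_mem_nhds ht] with s hs
          exact Real.smoothTransition.zero_of_nonpos hs.le
        rw [this.deriv_eq]; simp
      · have : Real.smoothTransition =ᶠ[𝓝 t] fun _ => 1 := by
          filter_upwards [lt_mem_nhds ht] with s hs
          exact Real.smoothTransition.one_of_one_le hs.le
        rw [this.deriv_eq]; simp
    rw [h0, abs_zero]
    exact (norm_nonneg _).trans (hK 0 (by simp))

/-- A smooth cutoff of `[0, 2]` in `[0, 3]`. -/
def lowCut (t : ℝ) : ℝ := Real.smoothTransition (3 - t)

theorem contDiff_lowCut : ContDiff ℝ ∞ lowCut :=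
  Real.smoothTransition.contDiff.comp (contDiff_const.sub contDiff_id)

theorem lowCut_nonneg (t : ℝ) : 0 ≤ lowCut t := Real.smoothTransition.nonneg _

theorem lowCut_le_one (t : ℝ) : lowCut t ≤ 1 := Real.smoothTransition.le_one _

theorem lowCut_one {t : ℝ} (h : t ≤ 2) : lowCut t = 1 :=
  Real.smoothTransition.one_of_one_le (by linarith)

theorem lowCut_zero {t : ℝ} (h : 3 ≤ t) : lowCut t = 0 :=
  Real.smoothTransition.zero_of_nonpos (by linarith)

theorem deriv_lowCut (t : ℝ) : deriv lowCut t = - deriv Real.smoothTransition (3 - t) :=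
  deriv_comp_const_sub ..

theorem deriv_lowCut_zero {t : ℝ} (h : 3 < t) : deriv lowCut t = 0 := by
  have : lowCut =ᶠ[𝓝 t] fun _ => 0 := by
    filter_upwards [lt_mem_nhds h] with s hs
    exact lowCut_zero hs.le
  rw [this.deriv_eq]; simp

/-- The cutoff at scale `R` in space (and on a neighbourhood of the sphere in direction). -/
def bigCut (R : ℝ) (q : E d × E d) : ℝ := lowCut ((R ^ 2)⁻¹ * ‖q.1‖ ^ 2) * lowCut (‖q.2‖ ^ 2)

theorem isTestV_bigCut {R : ℝ} (hR : 0 < R) : IsTestV (bigCut (d := d) R) := by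
  refine ⟨(contDiff_lowCut.comp (contDiff_normSq_fst _)).mul
    (contDiff_lowCut.comp contDiff_normSq_snd), ?_⟩
  refine HasCompactSupport.of_support_subset_isCompact
    (K := Metric.closedBall 0 (2 * R) ×ˢ Metric.closedBall 0 2)
    ((isCompact_closedBall _ _).prod (isCompact_closedBall _ _)) fun q hq => ?_
  have h1 : lowCut ((R ^ 2)⁻¹ * ‖q.1‖ ^ 2) ≠ 0 := left_ne_zero_of_mul hq
  have h2 : lowCut (‖q.2‖ ^ 2) ≠ 0 := right_ne_zero_of_mul hq
  have h3 : (R ^ 2)⁻¹ * ‖q.1‖ ^ 2 < 3 := not_le.1 fun h => h1 (lowCut_zero h)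
  have h4 : ‖q.2‖ ^ 2 < 3 := not_le.1 fun h => h2 (lowCut_zero h)
  rw [inv_mul_lt_iff₀ (by positivity)] at h3
  simp only [Set.mem_prod, mem_closedBall_zero_iff]
  constructor
  · exact abs_le_of_sq_le_sq' (by nlinarith) (by positivity) |>.2
  · exact abs_le_of_sq_le_sq' (by nlinarith) (by positivity) |>.2

theorem bigCut_nonneg (R : ℝ) (q : E d × E d) : 0 ≤ bigCut R q :=
  mul_nonneg (lowCut_nonneg _) (lowCut_nonneg _)

theorem bigCut_le_one (R : ℝ) (q : E d × E d) : bigCut R q ≤ 1 :=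
  mul_le_one₀ (lowCut_le_one _) (lowCut_nonneg _) (lowCut_le_one _)

theorem norm_le_of_bigCut {R : ℝ} (hR : 0 < R) {q : E d × E d} (h : bigCut R q ≠ 0) :
    ‖q.1‖ ≤ 2 * R := by
  have h1 : lowCut ((R ^ 2)⁻¹ * ‖q.1‖ ^ 2) ≠ 0 := left_ne_zero_of_mul h
  have h3 : (R ^ 2)⁻¹ * ‖q.1‖ ^ 2 < 3 := not_le.1 fun h => h1 (lowCut_zero h)
  rw [inv_mul_lt_iff₀ (by positivity)] at h3
  exact abs_le_of_sq_le_sq' (by nlinarith) (by positivity) |>.2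

theorem bigCut_eq_one {R : ℝ} {q : E d × E d} (h : ‖q.1‖ ≤ R) (hq : ‖q.2‖ ≤ 1) :
    bigCut R q = 1 := by
  have h1 : (R ^ 2)⁻¹ * ‖q.1‖ ^ 2 ≤ 2 := by
    have h2 : ‖q.1‖ ^ 2 ≤ R ^ 2 := pow_le_pow_left₀ (norm_nonneg _) h 2
    have h3 : (R ^ 2)⁻¹ * ‖q.1‖ ^ 2 ≤ 1 := by
      rw [← div_eq_inv_mul]
      exact div_le_one_of_le₀ h2 (sq_nonneg _)
    linarith
  have h4 : ‖q.2‖ ^ 2 ≤ 2 := by nlinarith [norm_nonneg q.2]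
  rw [bigCut, lowCut_one h1, lowCut_one h4, mul_one]

theorem rot_bigCut (R : ℝ) (i l : Fin (d + 1)) (q : E d × E d) : rot i l (bigCut R) q = 0 := by
  have e : bigCut (d := d) R = fun q => lowCut ((R ^ 2)⁻¹ * ‖q.1‖ ^ 2) * lowCut (‖q.2‖ ^ 2) := rfl
  rw [e, rot_mul (contDiff_scalar_comp contDiff_lowCut (contDiff_normSq_fst _))
    (contDiff_scalar_comp contDiff_lowCut contDiff_normSq_snd), rot_comp contDiff_lowCut (contDiff_normSq_fst _),
    rot_comp contDiff_lowCut contDiff_normSq_snd]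
  simp only [rot]
  rw [fderiv_normSq_fst, fderiv_normSq_snd, inner_rotVec_self]
  simp

theorem exists_transport_bigCut_le (d : ℕ) :
    ∃ K, 0 ≤ K ∧ ∀ R : ℝ, 0 < R → ∀ p : E d × S d, |transport (bigCut R) (amb p)| ≤ K / R := by
  obtain ⟨K, hK0, hK⟩ := exists_deriv_smoothTransition_le
  refine ⟨4 * K, by positivity, fun R hR p => ?_⟩
  have e : bigCut (d := d) R = fun q => lowCut ((R ^ 2)⁻¹ * ‖q.1‖ ^ 2) * lowCut (‖q.2‖ ^ 2) := rfl
  have hp : ‖(p.2 : E d)‖ = 1 := by simp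
  rw [e, transport_mul (contDiff_scalar_comp contDiff_lowCut (contDiff_normSq_fst _))
    (contDiff_scalar_comp contDiff_lowCut contDiff_normSq_snd), transport_comp contDiff_lowCut
    (contDiff_normSq_fst _), transport_comp contDiff_lowCut contDiff_normSq_snd,
    transport_eq (contDiff_normSq_fst _), transport_eq contDiff_normSq_snd,
    fderiv_normSq_fst, fderiv_normSq_snd]
  simp only [amb, hp, inner_zero_right, mul_zero, zero_add]
  rw [lowCut_one (by norm_num), one_mul]
  by_cases h3 : 3 < (R ^ 2)⁻¹ * ‖p.1‖ ^ 2
  · rw [deriv_lowCut_zero h3, zero_mul, abs_zero]; positivity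
  · rw [not_lt, inv_mul_le_iff₀ (by positivity)] at h3
    have hx : ‖p.1‖ ≤ 2 * R := abs_le_of_sq_le_sq' (by nlinarith) (by positivity) |>.2
    have hi : |inner ℝ p.1 (p.2 : E d)| ≤ 2 * R := by
      refine (abs_real_inner_le_norm _ _).trans ?_
      rw [hp, mul_one]; exact hx
    have hd : |deriv lowCut ((R ^ 2)⁻¹ * ‖p.1‖ ^ 2)| ≤ K := by
      rw [deriv_lowCut, abs_neg]; exact hK _
    rw [abs_mul, abs_mul, abs_mul, abs_of_pos (show (0 : ℝ) < (R ^ 2)⁻¹ by positivity),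
      abs_of_pos (show (0 : ℝ) < 2 by norm_num)]
    calc _ ≤ K * ((R ^ 2)⁻¹ * (2 * (2 * R))) := by gcongr
      _ = 4 * K / R := by field_simp; ring

/-- The profile in `τ θⁿ / r` of the cutoff near the grazing set. -/
def grazeProfile (t : ℝ) : ℝ :=
  (1 - Real.smoothTransition (t - 1)) * Real.smoothTransition (t + 1)

theorem contDiff_grazeProfile : ContDiff ℝ ∞ grazeProfile :=
  (contDiff_const.sub (Real.smoothTransition.contDiff.comp (contDiff_id.sub contDiff_const))).mul
    (Real.smoothTransition.contDiff.comp (contDiff_id.add contDiff_const))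

theorem grazeProfile_nonneg (t : ℝ) : 0 ≤ grazeProfile t :=
  mul_nonneg (sub_nonneg.2 (Real.smoothTransition.le_one _)) (Real.smoothTransition.nonneg _)

theorem grazeProfile_le_one (t : ℝ) : grazeProfile t ≤ 1 :=
  mul_le_one₀ (sub_le_self _ (Real.smoothTransition.nonneg _)) (Real.smoothTransition.nonneg _)
    (Real.smoothTransition.le_one _)

theorem abs_le_of_grazeProfile {t : ℝ} (h : grazeProfile t ≠ 0) : |t| ≤ 2 := by
  rw [abs_le]
  constructor
  · by_contra hc
    exact right_ne_zero_of_mul h (Real.smoothTransition.zero_of_nonpos (by linarith))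
  · by_contra hc
    exact left_ne_zero_of_mul h (by
      rw [Real.smoothTransition.one_of_one_le (by linarith), sub_self])

theorem exists_deriv_grazeProfile_le : ∃ K, 0 ≤ K ∧ ∀ t, |deriv grazeProfile t| ≤ K := by
  have hcs : HasCompactSupport grazeProfile :=
    HasCompactSupport.of_support_subset_isCompact (isCompact_closedBall (0 : ℝ) 2) fun t ht => by
      rw [mem_closedBall_zero_iff]; exact abs_le_of_grazeProfile ht
  obtain ⟨K, hK⟩ := (contDiff_grazeProfile.continuous_deriv (by simp)).bounded_above_of_compact_support
    hcs.deriv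
  exact ⟨K, (norm_nonneg _).trans (hK 0), hK⟩

/-- The cutoff `χ(xⁿ/r²)` near the boundary. -/
def bdryCut (r : ℝ) (q : E d × E d) : ℝ :=
  1 - Real.smoothTransition ((r ^ 2)⁻¹ * q.1 (Fin.last d))

theorem contDiff_bdryCut (r : ℝ) : ContDiff ℝ ∞ (bdryCut (d := d) r) :=
  contDiff_const.sub (contDiff_scalar_comp Real.smoothTransition.contDiff (contDiff_last_fst _))

theorem bdryCut_nonneg (r : ℝ) (q : E d × E d) : 0 ≤ bdryCut r q :=
  sub_nonneg.2 (Real.smoothTransition.le_one _)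

theorem bdryCut_le_one (r : ℝ) (q : E d × E d) : bdryCut r q ≤ 1 :=
  sub_le_self _ (Real.smoothTransition.nonneg _)

theorem bdryCut_zero {r : ℝ} (hr : 0 < r) {q : E d × E d} (h : r ^ 2 ≤ q.1 (Fin.last d)) :
    bdryCut r q = 0 := by
  have : 1 ≤ (r ^ 2)⁻¹ * q.1 (Fin.last d) := by
    rw [le_inv_mul_iff₀ (by positivity), mul_one]; exact h
  rw [bdryCut, Real.smoothTransition.one_of_one_le this, sub_self]

theorem rot_bdryCut (r : ℝ) (i l : Fin (d + 1)) (q : E d × E d) :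
    rot i l (bdryCut r) q = 0 := by
  have e : bdryCut (d := d) r =
    fun q => 1 - Real.smoothTransition ((r ^ 2)⁻¹ * q.1 (Fin.last d)) := rfl
  rw [e, rot_one_sub (contDiff_scalar_comp Real.smoothTransition.contDiff (contDiff_last_fst _)),
    rot_comp Real.smoothTransition.contDiff (contDiff_last_fst _)]
  simp only [rot]
  rw [fderiv_last_fst]
  simp

theorem transport_bdryCut (r : ℝ) (q : E d × E d) :
    transport (bdryCut r) q = - (deriv Real.smoothTransition ((r ^ 2)⁻¹ * q.1 (Fin.last d))
      * ((r ^ 2)⁻¹ * q.2 (Fin.last d))) := by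
  have e : bdryCut (d := d) r =
    fun q => 1 - Real.smoothTransition ((r ^ 2)⁻¹ * q.1 (Fin.last d)) := rfl
  rw [e, transport_one_sub (contDiff_scalar_comp Real.smoothTransition.contDiff (contDiff_last_fst _)),
    transport_comp Real.smoothTransition.contDiff (contDiff_last_fst _),
    transport_eq (contDiff_last_fst _), fderiv_last_fst]

/-- The cutoff near the grazing set. -/
def grazeCut (τ r : ℝ) (q : E d × E d) : ℝ :=
  grazeProfile ((τ / r) * q.2 (Fin.last d)) * bdryCut r q

theorem contDiff_grazeCut (τ r : ℝ) : ContDiff ℝ ∞ (grazeCut (d := d) τ r) :=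
  (contDiff_scalar_comp contDiff_grazeProfile (contDiff_last_snd _)).mul (contDiff_bdryCut r)

theorem grazeCut_nonneg (τ r : ℝ) (q : E d × E d) : 0 ≤ grazeCut τ r q :=
  mul_nonneg (grazeProfile_nonneg _) (bdryCut_nonneg _ _)

theorem grazeCut_le_one (τ r : ℝ) (q : E d × E d) : grazeCut τ r q ≤ 1 :=
  mul_le_one₀ (grazeProfile_le_one _) (bdryCut_nonneg _ _) (bdryCut_le_one _ _)

theorem grazeCut_zero (τ : ℝ) {r : ℝ} (hr : 0 < r) {q : E d × E d}
    (h : r ^ 2 ≤ q.1 (Fin.last d)) : grazeCut τ r q = 0 := by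
  rw [grazeCut, bdryCut_zero hr h, mul_zero]

theorem exists_rot_grazeCut_le (d : ℕ) : ∃ K, 0 ≤ K ∧ ∀ τ r : ℝ, |τ| = 1 → 0 < r →
    ∀ (i l : Fin (d + 1)) (p : E d × S d), |rot i l (grazeCut τ r) (amb p)| ≤ K / r := by
  obtain ⟨K, hK0, hK⟩ := exists_deriv_grazeProfile_le
  refine ⟨2 * K, by positivity, fun τ r hτ hr i l p => ?_⟩
  have e : grazeCut (d := d) τ r = fun q =>
    grazeProfile ((τ / r) * q.2 (Fin.last d)) * bdryCut r q := rfl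
  rw [e, rot_mul (contDiff_scalar_comp contDiff_grazeProfile (contDiff_last_snd _)) (contDiff_bdryCut r),
    rot_comp contDiff_grazeProfile (contDiff_last_snd _), rot_bdryCut]
  simp only [rot]
  rw [fderiv_last_snd, mul_zero, zero_add, abs_mul, abs_mul, abs_mul, abs_div, hτ,
    abs_of_pos hr, abs_of_nonneg (bdryCut_nonneg _ _)]
  have h1 : |rotVec i l (p.2 : E d) (Fin.last d)| ≤ 2 := by
    refine (abs_last_le _).trans ((norm_rotVec_le i l _).trans ?_)
    simp
  calc bdryCut r (amb p) * (|deriv grazeProfile (τ / r * (amb p).2 (Fin.last d))|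
        * (1 / r * |rotVec i l (p.2 : E d) (Fin.last d)|))
      ≤ 1 * (K * (1 / r * 2)) := by
        gcongr
        · exact bdryCut_le_one _ _
        · exact hK _
    _ = 2 * K / r := by ring

theorem exists_transport_grazeCut_le (d : ℕ) : ∃ K, 0 ≤ K ∧ ∀ τ r : ℝ, |τ| = 1 → 0 < r →
    ∀ (p : E d × S d), |transport (grazeCut τ r) (amb p)| ≤ K / r := by
  obtain ⟨K, hK0, hK⟩ := exists_deriv_smoothTransition_le
  refine ⟨2 * K, by positivity, fun τ r hτ hr p => ?_⟩
  have e : grazeCut (d := d) τ r = fun q =>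
    grazeProfile ((τ / r) * q.2 (Fin.last d)) * bdryCut r q := rfl
  rw [e, transport_mul (contDiff_scalar_comp contDiff_grazeProfile (contDiff_last_snd _)) (contDiff_bdryCut r),
    transport_comp contDiff_grazeProfile (contDiff_last_snd _), transport_bdryCut,
    transport_eq (contDiff_last_snd _), fderiv_last_snd]
  simp only [PiLp.zero_apply, mul_zero, add_zero, amb]
  by_cases h0 : grazeProfile (τ / r * (p.2 : E d) (Fin.last d)) = 0
  · rw [h0, zero_mul, abs_zero]; positivity
  · have h1 := abs_le_of_grazeProfile h0
    rw [abs_mul, abs_div, hτ, abs_of_pos hr, one_div_mul_eq_div, div_le_iff₀ hr] at h1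
    rw [abs_mul, abs_neg, abs_mul, abs_mul, abs_of_nonneg (grazeProfile_nonneg _),
      abs_of_pos (show (0 : ℝ) < (r ^ 2)⁻¹ by positivity)]
    calc _ ≤ 1 * (K * ((r ^ 2)⁻¹ * (2 * r))) := by
          gcongr
          · exact grazeProfile_le_one _
          · exact hK _
      _ = 2 * K / r := by field_simp

end Weights

section Strip

theorem integrable_mul_of_memLp {X : Type*} [MeasurableSpace X] {m : Measure X} {f g : X → ℝ}
    (hf : MemLp f 2 m) (hg : MemLp g 2 m) : Integrable (fun x => f x * g x) m :=
  hf.integrable_mul hg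

/-- The points of phase space close to the boundary, in a large ball. -/
def strip (d : ℕ) (r R : ℝ) : Set (E d × S d) := {p | p.1 (Fin.last d) ≤ r ^ 2 ∧ ‖p.1‖ ≤ 2 * R}

theorem measurableSet_strip (d : ℕ) (r R : ℝ) : MeasurableSet (strip d r R) :=
  ((isClosed_le (continuous_last.comp continuous_fst) continuous_const).inter
    (isClosed_le continuous_fst.norm continuous_const)).measurableSet

theorem norm_snd_le_slab {d : ℕ} (p : ℝ × EuclideanSpace ℝ (Fin d)) : ‖p.2‖ ≤ ‖slab d p‖ := by
  refine le_of_sq_le_sq ?_ (norm_nonneg _)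
  rw [EuclideanSpace.norm_sq_eq, EuclideanSpace.norm_sq_eq, Fin.sum_univ_castSucc]
  simp only [slab_castSucc, slab_last]
  have := sq_nonneg ‖p.1‖
  linarith

theorem measure_strip_le (d : ℕ) (R : ℝ) : ∃ C : ℝ, 0 ≤ C ∧ ∀ r : ℝ, 
    measQ d (strip d r R) ≤ ENNReal.ofReal (C * r ^ 2) := by
  refine ⟨(volume (Metric.closedBall (0 : EuclideanSpace ℝ (Fin d)) (2 * R))).toReal
    * (sphereMeasure d Set.univ).toReal, by positivity, fun r => ?_⟩
  have e : strip d r R = {x : E d | x (Fin.last d) ≤ r ^ 2 ∧ ‖x‖ ≤ 2 * R} ×ˢ Set.univ := by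
    ext p; simp [strip]
  have hA : MeasurableSet {x : E d | x (Fin.last d) ≤ r ^ 2 ∧ ‖x‖ ≤ 2 * R} :=
    ((isClosed_le continuous_last continuous_const).inter
      (isClosed_le continuous_norm continuous_const)).measurableSet
  rw [e, measQ, Measure.prod_prod, Measure.restrict_apply hA,
    ← (measurePreserving_slab d).measure_preimage
      (hA.inter (measurableSet_halfSpace d)).nullMeasurableSet]
  have hsub : slab d ⁻¹' ({x : E d | x (Fin.last d) ≤ r ^ 2 ∧ ‖x‖ ≤ 2 * R} ∩ halfSpace d)
      ⊆ Set.Ioc 0 (r ^ 2) ×ˢ Metric.closedBall 0 (2 * R) := by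
    rintro p ⟨⟨h1, h2⟩, h3⟩
    have h3' : 0 < slab d p (Fin.last d) := h3
    rw [slab_last] at h1 h3'
    exact ⟨⟨h3', h1⟩, by rw [mem_closedBall_zero_iff]; exact (norm_snd_le_slab p).trans h2⟩
  calc _ ≤ ((volume : Measure ℝ).prod (volume : Measure (EuclideanSpace ℝ (Fin d))))
          (Set.Ioc 0 (r ^ 2) ×ˢ Metric.closedBall 0 (2 * R))
        * sphereMeasure d Set.univ := mul_le_mul_left (measure_mono hsub) _
    _ = ENNReal.ofReal _ := by
        rw [Measure.prod_prod, Real.volume_Ioc, sub_zero,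
          ENNReal.ofReal_mul (by positivity), ENNReal.ofReal_mul (by positivity),
          ENNReal.ofReal_toReal (measure_closedBall_lt_top).ne,
          ENNReal.ofReal_toReal (measure_lt_top _ _).ne]
        ring

theorem setIntegral_abs_le {X : Type*} [MeasurableSpace X] {m : Measure X} {s : Set X} {F : X → ℝ}
    (hF : MemLp F 2 m) (hs : m s ≠ ⊤) :
    ∫ x in s, |F x| ∂m ≤ Real.sqrt (∫ x in s, F x ^ 2 ∂m) * Real.sqrt (m.real s) := by
  have : IsFiniteMeasure (m.restrict s) := ⟨by simpa using hs.lt_top⟩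
  have h := integral_mul_le_Lp_mul_Lq_of_nonneg (μ := m.restrict s) Real.HolderConjugate.two_two
    (f := fun x => |F x|) (g := fun _ => 1) (Eventually.of_forall fun x => abs_nonneg _)
    (Eventually.of_forall fun x => zero_le_one) (by rw [ENNReal.ofReal_ofNat]; exact hF.abs.restrict s)
    (memLp_const 1)
  simpa [Real.sqrt_eq_rpow, measureReal_restrict_apply] using h

theorem tendsto_strip {d : ℕ} (R : ℝ) {F : E d × S d → ℝ} (hF : MemLp F 2 (measQ d)) :
    Tendsto (fun k : ℕ => ((k : ℝ) + 1) * ∫ p in strip d (1 / ((k : ℝ) + 1)) R, |F p| ∂(measQ d))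
      atTop (𝓝 0) := by
  obtain ⟨C, hC0, hC⟩ := measure_strip_le d R
  have hF2 : Integrable (fun p => F p ^ 2) (measQ d) := hF.integrable_sq
  have h1 : Tendsto (fun k : ℕ => ∫ p in strip d (1 / ((k : ℝ) + 1)) R, F p ^ 2 ∂(measQ d)) atTop
      (𝓝 0) := by
    have hanti : Antitone fun k : ℕ => strip d (1 / ((k : ℝ) + 1)) R := by
      intro k l hkl p hp
      refine ⟨hp.1.trans ?_, hp.2⟩
      gcongr
    have := hanti.tendsto_setIntegral (μ := measQ d) (f := fun p => F p ^ 2)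
      (fun k => measurableSet_strip d _ R) hF2.integrableOn
    convert this using 2
    symm
    refine setIntegral_measure_zero _ (measure_mono_null (t := {p | ¬ p.1 ∈ halfSpace d}) ?_
      (ae_measQ_mem d))
    intro p hp
    have hp' : ∀ k : ℕ, p.1 (Fin.last d) ≤ (1 / ((k : ℝ) + 1)) ^ 2 := fun k =>
      (Set.mem_iInter.1 hp k).1
    have hlim : Tendsto (fun k : ℕ => (1 / ((k : ℝ) + 1)) ^ 2) atTop (𝓝 0) := by
      simpa using (tendsto_one_div_add_atTop_nhds_zero_nat (𝕜 := ℝ)).pow 2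
    exact not_lt.2 (ge_of_tendsto' hlim hp')
  have h2 : Tendsto (fun k : ℕ => Real.sqrt (∫ p in strip d (1 / ((k : ℝ) + 1)) R, F p ^ 2
      ∂(measQ d)) * Real.sqrt C) atTop (𝓝 0) := by
    have := ((Real.continuous_sqrt.tendsto 0).comp h1).mul_const (Real.sqrt C)
    simpa using this
  refine squeeze_zero (fun k => by positivity) (fun k => ?_) h2
  have hk : (0 : ℝ) < (k : ℝ) + 1 := by positivity
  have hfin : measQ d (strip d (1 / ((k : ℝ) + 1)) R) ≠ ⊤ :=
    ((hC _).trans_lt ENNReal.ofReal_lt_top).ne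
  have h3 : Real.sqrt ((measQ d).real (strip d (1 / ((k : ℝ) + 1)) R))
      ≤ Real.sqrt C * (1 / ((k : ℝ) + 1)) := by
    rw [← Real.sqrt_sq (show (0 : ℝ) ≤ 1 / ((k : ℝ) + 1) by positivity), ← Real.sqrt_mul hC0]
    rw [Real.sqrt_sq (show (0 : ℝ) ≤ 1 / ((k : ℝ) + 1) by positivity)]
    exact Real.sqrt_le_sqrt (ENNReal.toReal_le_of_le_ofReal (by positivity) (hC _))
  calc _ ≤ ((k : ℝ) + 1) * (Real.sqrt (∫ p in strip d (1 / ((k : ℝ) + 1)) R, F p ^ 2 ∂(measQ d))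
        * (Real.sqrt C * (1 / ((k : ℝ) + 1)))) := by
        gcongr
        exact (setIntegral_abs_le hF hfin).trans (by gcongr)
    _ = _ := by field_simp

end Strip

section Uniqueness

variable {d : ℕ} {a b : E d → ℝ} {A B : ℝ}

theorem IsHomSol.renormalized_add {τ : ℝ} (hτ : |τ| = 1) 
    {u : L2Q d} {w : L2QVec d} (h : IsAngGrad u w) (ha : IsCoeff a A)
    (hb : IsCoeff b B) (heq : IsHomSol τ a b u w) {ψ χ : E d × E d → ℝ} (hψ : IsTestV ψ)
    (hψ0 : ∀ q, 0 ≤ ψ q) (hψs : IsSided τ 1 ψ) (hχ : IsTestV χ)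
    (hχ0 : ∀ q, 0 ≤ χ q) (hχs : IsSided τ (-1) χ) :
    (1 / 2) * ∑ i, ∑ l,
        ∫ p, (rot i l (fun q => ψ q + χ q) (amb p) * beta (u p)) * (a p.1 * rotComp w i l p)
          ∂(measQ d)
      + ∫ p, ((ψ (amb p) + χ (amb p)) * beta (u p)) * (b p.1 * u p) ∂(measQ d)
    ≤ τ * ∫ p, betaPrim (u p) * transport (fun q => ψ q + χ q) (amb p) ∂(measQ d) := by
  have h1 := heq.renormalized_le hτ (s := 1) (by simp) h ha hb hψ hψ0 hψs
  have h2 := heq.renormalized_le hτ (s := -1) (by simp) h ha hb hχ hχ0 hχs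
  have hu : MemLp u 2 (measQ d) := Lp.memLp u
  have hwt : ∀ {φ : E d × E d → ℝ}, IsTestV φ →
      MemLp (fun p => φ (amb p) * beta (u p)) 2 (measQ d) := by
    intro φ hφ
    obtain ⟨D, hD⟩ := hφ.exists_bound
    exact FokkerPlanck.MeasureTheory.MemLp.bdd_mul' (memLp_beta_comp hu) (hφ.memLp _).1
      (Eventually.of_forall fun p => hD _)
  have e1 : ∀ i l, ∫ p, (rot i l (fun q => ψ q + χ q) (amb p) * beta (u p))
        * (a p.1 * rotComp w i l p) ∂(measQ d)
      = ∫ p, (rot i l ψ (amb p) * beta (u p)) * (a p.1 * rotComp w i l p) ∂(measQ d)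
        + ∫ p, (rot i l χ (amb p) * beta (u p)) * (a p.1 * rotComp w i l p) ∂(measQ d) := by
    intro i l
    have haW := ha.memLp (memLp_rotComp w i l)
    rw [← integral_add (integrable_mul_of_memLp (hwt (hψ.rot i l)) haW)
      (integrable_mul_of_memLp (hwt (hχ.rot i l)) haW)]
    refine integral_congr_ae (Eventually.of_forall fun p => ?_)
    simp only
    rw [rot_add hψ.smooth hχ.smooth]
    ring
  have e2 : ∫ p, ((ψ (amb p) + χ (amb p)) * beta (u p)) * (b p.1 * u p) ∂(measQ d)
      = ∫ p, (ψ (amb p) * beta (u p)) * (b p.1 * u p) ∂(measQ d)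
        + ∫ p, (χ (amb p) * beta (u p)) * (b p.1 * u p) ∂(measQ d) := by
    rw [← integral_add (integrable_mul_of_memLp (hwt hψ) (hb.memLp hu))
      (integrable_mul_of_memLp (hwt hχ) (hb.memLp hu))]
    refine integral_congr_ae (Eventually.of_forall fun p => ?_)
    simp only
    ring
  have e3 : ∫ p, betaPrim (u p) * transport (fun q => ψ q + χ q) (amb p) ∂(measQ d)
      = ∫ p, betaPrim (u p) * transport ψ (amb p) ∂(measQ d)
        + ∫ p, betaPrim (u p) * transport χ (amb p) ∂(measQ d) := by
    rw [← integral_add (integrable_mul_of_memLp (memLp_betaPrim_comp hu) (hψ.transport.memLp _))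
      (integrable_mul_of_memLp (memLp_betaPrim_comp hu) (hχ.transport.memLp _))]
    refine integral_congr_ae (Eventually.of_forall fun p => ?_)
    simp only
    rw [transport_add hψ.smooth hχ.smooth]
    ring
  simp only [e1, Finset.sum_add_distrib]
  rw [e2, e3]
  linarith

/-- The weight obtained by cutting off infinity and a neighbourhood of the grazing set. -/
def cutWeight (τ r R : ℝ) (q : E d × E d) : ℝ := bigCut R q * (1 - grazeCut τ r q)

theorem IsHomSol.renormalized_cutWeight {τ : ℝ} (hτ : |τ| = 1) 
    {u : L2Q d} {w : L2QVec d} (h : IsAngGrad u w) (ha : IsCoeff a A)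
    (hb : IsCoeff b B) (heq : IsHomSol τ a b u w) {r R : ℝ} (hr : 0 < r) (hR : 0 < R) :
    (1 / 2) * ∑ i, ∑ l,
        ∫ p, (rot i l (cutWeight τ r R) (amb p) * beta (u p)) * (a p.1 * rotComp w i l p)
          ∂(measQ d)
      + ∫ p, (cutWeight τ r R (amb p) * beta (u p)) * (b p.1 * u p) ∂(measQ d)
    ≤ τ * ∫ p, betaPrim (u p) * transport (cutWeight τ r R) (amb p) ∂(measQ d) := by
  have hα : ContDiff ℝ ∞ fun q : E d × E d =>
      Real.smoothTransition ((τ / r) * q.2 (Fin.last d) - 1) :=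
    Real.smoothTransition.contDiff.comp ((contDiff_last_snd _).sub contDiff_const)
  have hδ : ContDiff ℝ ∞ fun q : E d × E d =>
      Real.smoothTransition ((τ / r) * q.2 (Fin.last d) + 1) :=
    Real.smoothTransition.contDiff.comp ((contDiff_last_snd _).add contDiff_const)
  set ψ : E d × E d → ℝ := fun q =>
    bigCut R q * Real.smoothTransition ((τ / r) * q.2 (Fin.last d) - 1) with hψ
  set χ : E d × E d → ℝ := fun q =>
    bigCut R q * ((1 - Real.smoothTransition ((τ / r) * q.2 (Fin.last d) - 1))
      * (1 - Real.smoothTransition ((τ / r) * q.2 (Fin.last d) + 1) * bdryCut r q)) with hχ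
  have e : (fun q => ψ q + χ q) = cutWeight τ r R := by
    funext q
    simp only [hψ, hχ, cutWeight, grazeCut, grazeProfile]
    ring
  have hψ1 : IsTestV ψ := (isTestV_bigCut hR).mul_right hα
  have hχ1 : IsTestV χ := (isTestV_bigCut hR).mul_right
    ((contDiff_const.sub hα).mul (contDiff_const.sub (hδ.mul (contDiff_bdryCut r))))
  have hψ0 : ∀ q, 0 ≤ ψ q := fun q =>
    mul_nonneg (bigCut_nonneg R q) (Real.smoothTransition.nonneg _)
  have hχ0 : ∀ q, 0 ≤ χ q := fun q =>
    mul_nonneg (bigCut_nonneg R q) (mul_nonneg (sub_nonneg.2 (Real.smoothTransition.le_one _))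
      (sub_nonneg.2 (mul_le_one₀ (Real.smoothTransition.le_one _) (bdryCut_nonneg _ _)
        (bdryCut_le_one _ _))))
  have hψs : IsSided τ 1 ψ := by
    refine Or.inl ⟨rfl, r, hr, fun q hq => ?_⟩
    by_contra hc
    refine right_ne_zero_of_mul hq (Real.smoothTransition.zero_of_nonpos ?_)
    have : τ / r * q.2 (Fin.last d) = (τ * q.2 (Fin.last d)) / r := by ring
    rw [this, sub_nonpos, div_le_one hr]
    exact (not_le.1 hc).le
  have hχs : IsSided τ (-1) χ := by
    refine Or.inr ⟨rfl, fun p h0 hp => ?_⟩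
    have h1 : τ / r * (p.2 : E d) (Fin.last d) = (τ * (p.2 : E d) (Fin.last d)) / r := by ring
    have h2 : Real.smoothTransition (τ / r * (p.2 : E d) (Fin.last d) + 1) = 1 :=
      Real.smoothTransition.one_of_one_le (by
        rw [h1]
        have : 0 < (τ * (p.2 : E d) (Fin.last d)) / r := div_pos hp hr
        linarith)
    simp [hχ, amb, h2, bdryCut, h0, Real.smoothTransition.zero_of_nonpos le_rfl]
  have := heq.renormalized_add hτ h ha hb hψ1 hψ0 hψs hχ1 hχ0 hχs
  rw [e] at this
  have e' : ∀ p : E d × S d, ψ (amb p) + χ (amb p) = cutWeight τ r R (amb p) := fun p =>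
    congrFun e (amb p)
  simpa only [e'] using this

theorem fderiv_grazeCut_zero (τ : ℝ) {r : ℝ} (hr : 0 < r) {q : E d × E d}
    (h : r ^ 2 < q.1 (Fin.last d)) : fderiv ℝ (grazeCut τ r) q = 0 := by
  have : grazeCut τ r =ᶠ[𝓝 q] fun _ => 0 := by
    filter_upwards [(continuous_last.comp continuous_fst).continuousAt.eventually
      (lt_mem_nhds h)] with q' hq'
    exact grazeCut_zero τ hr (le_of_lt hq')
  rw [this.fderiv_eq]; simp

theorem isTestV_cutWeight (τ r : ℝ) {R : ℝ} (hR : 0 < R) :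
    IsTestV (cutWeight (d := d) τ r R) :=
  (isTestV_bigCut hR).mul_right (contDiff_const.sub (contDiff_grazeCut τ r))

theorem exists_rot_cutWeight_le (d : ℕ) : ∃ K, 0 ≤ K ∧ ∀ τ r R : ℝ, |τ| = 1 → 0 < r → 0 < R →
    ∀ (i l : Fin (d + 1)) (p : E d × S d),
      |rot i l (cutWeight τ r R) (amb p)| ≤ (strip d r R).indicator (fun _ => K / r) p := by
  obtain ⟨K, hK0, hK⟩ := exists_rot_grazeCut_le d
  refine ⟨K, hK0, fun τ r R hτ hr hR i l p => ?_⟩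
  have e : cutWeight (d := d) τ r R = fun q => bigCut R q * (1 - grazeCut τ r q) := rfl
  rw [e, rot_mul (isTestV_bigCut hR).smooth (contDiff_const.sub (contDiff_grazeCut τ r)),
    rot_one_sub (contDiff_grazeCut τ r), rot_bigCut, mul_zero, add_zero, abs_mul, abs_neg,
    abs_of_nonneg (bigCut_nonneg _ _)]
  by_cases hp : p ∈ strip d r R
  · rw [Set.indicator_of_mem hp]
    exact (mul_le_of_le_one_left (abs_nonneg _) (bigCut_le_one _ _)).trans (hK τ r hτ hr i l p)
  · rw [Set.indicator_of_notMem hp]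
    by_cases h0 : bigCut R (amb p) = 0
    · rw [h0, zero_mul]
    · have hx : ‖p.1‖ ≤ 2 * R := norm_le_of_bigCut (q := amb p) hR h0
      have h1 : r ^ 2 < p.1 (Fin.last d) := by
        by_contra hc
        exact hp ⟨not_lt.1 hc, hx⟩
      rw [rot, fderiv_grazeCut_zero (q := amb p) τ hr h1]
      simp

theorem exists_transport_cutWeight_le (d : ℕ) : ∃ K, 0 ≤ K ∧ ∀ τ r R : ℝ, |τ| = 1 → 0 < r →
    0 < R → ∀ (p : E d × S d), |transport (cutWeight τ r R) (amb p)|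
      ≤ K / R + (strip d r R).indicator (fun _ => K / r) p := by
  obtain ⟨K, hK0, hK⟩ := exists_transport_grazeCut_le d
  obtain ⟨L, hL0, hL⟩ := exists_transport_bigCut_le d
  refine ⟨K + L, by positivity, fun τ r R hτ hr hR p => ?_⟩
  have e : cutWeight (d := d) τ r R = fun q => bigCut R q * (1 - grazeCut τ r q) := rfl
  rw [e, transport_mul (isTestV_bigCut hR).smooth (contDiff_const.sub (contDiff_grazeCut τ r)),
    transport_one_sub (contDiff_grazeCut τ r)]
  have h2 : |(1 - grazeCut τ r (amb p)) * transport (bigCut R) (amb p)| ≤ (K + L) / R := by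
    rw [abs_mul, abs_of_nonneg (sub_nonneg.2 (grazeCut_le_one _ _ _))]
    refine (mul_le_of_le_one_left (abs_nonneg _) (sub_le_self _ (grazeCut_nonneg _ _ _))).trans
      ((hL R hR p).trans ?_)
    gcongr; linarith
  have h1 : |bigCut R (amb p) * -transport (grazeCut τ r) (amb p)|
      ≤ (strip d r R).indicator (fun _ => (K + L) / r) p := by
    rw [abs_mul, abs_neg, abs_of_nonneg (bigCut_nonneg _ _)]
    by_cases hp : p ∈ strip d r R
    · rw [Set.indicator_of_mem hp]
      refine (mul_le_of_le_one_left (abs_nonneg _) (bigCut_le_one _ _)).trans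
        ((hK τ r hτ hr p).trans ?_)
      gcongr; linarith
    · rw [Set.indicator_of_notMem hp]
      by_cases h0 : bigCut R (amb p) = 0
      · rw [h0, zero_mul]
      · have hx : ‖p.1‖ ≤ 2 * R := norm_le_of_bigCut (q := amb p) hR h0
        have h1 : r ^ 2 < p.1 (Fin.last d) := by
          by_contra hc
          exact hp ⟨not_lt.1 hc, hx⟩
        rw [transport_eq (contDiff_grazeCut τ r), fderiv_grazeCut_zero (q := amb p) τ hr h1]
        simp
  exact (abs_add_le _ _).trans (by linarith)

end Uniqueness

section Uniqueness

variable {d : ℕ} {a b : E d → ℝ} {A B : ℝ}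

theorem abs_cutWeight_le (τ r R : ℝ) (q : E d × E d) : |cutWeight τ r R q| ≤ 1 := by
  have h0 : 0 ≤ 1 - grazeCut τ r q := sub_nonneg.2 (grazeCut_le_one _ _ _)
  rw [cutWeight, abs_of_nonneg (mul_nonneg (bigCut_nonneg _ _) h0)]
  exact mul_le_one₀ (bigCut_le_one _ _) h0 (sub_le_self _ (grazeCut_nonneg _ _ _))

theorem exists_cutWeight_estimate {τ : ℝ} (hτ : |τ| = 1) {u : L2Q d} {w : L2QVec d}
    (h : IsAngGrad u w) (ha : IsCoeff a A) (hb : IsCoeff b B) (heq : IsHomSol τ a b u w) :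
    ∃ K, 0 ≤ K ∧ ∀ r R : ℝ, 0 < r → 0 < R →
      ∫ p, (cutWeight τ r R (amb p) * beta (u p)) * (b p.1 * u p) ∂(measQ d)
      ≤ K / R * ∫ p, u p ^ 2 ∂(measQ d)
        + K * (r⁻¹ * ∫ p in strip d r R, |u p| ∂(measQ d))
        + (1 / 2) * ∑ i, ∑ l, K * (r⁻¹ * ∫ p in strip d r R, |a p.1 * rotComp w i l p| ∂(measQ d)) := by
  obtain ⟨K, hK0, hK⟩ := exists_rot_cutWeight_le d
  obtain ⟨L, hL0, hL⟩ := exists_transport_cutWeight_le d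
  refine ⟨K + L, by positivity, fun r R hr hR => ?_⟩
  have main := heq.renormalized_cutWeight hτ h ha hb hr hR
  have hu : MemLp u 2 (measQ d) := Lp.memLp u
  have hfin : measQ d (strip d r R) ≠ ⊤ := by
    obtain ⟨C, -, hC⟩ := measure_strip_le d R
    exact ((hC r).trans_lt ENNReal.ofReal_lt_top).ne
  have hint : ∀ {F : E d × S d → ℝ}, MemLp F 2 (measQ d) →
      Integrable (fun p => (strip d r R).indicator (fun p => |F p|) p) (measQ d) := by
    intro F hF
    rw [integrable_indicator_iff (measurableSet_strip d r R)]
    have : IsFiniteMeasure ((measQ d).restrict (strip d r R)) := ⟨by simpa using hfin.lt_top⟩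
    exact (hF.abs.restrict _).integrable (by norm_num)
  have hang : ∀ i l, - ((K + L) * (r⁻¹ * ∫ p in strip d r R, |a p.1 * rotComp w i l p| ∂(measQ d)))
      ≤ ∫ p, (rot i l (cutWeight τ r R) (amb p) * beta (u p)) * (a p.1 * rotComp w i l p)
          ∂(measQ d) := by
    intro i l
    have haW := ha.memLp (memLp_rotComp w i l)
    rw [neg_le]
    refine (neg_le_abs _).trans ((abs_integral_le_integral_abs).trans ?_)
    rw [← integral_indicator (measurableSet_strip d r R), ← mul_assoc, ← integral_const_mul]
    refine integral_mono_of_nonneg (Eventually.of_forall fun p => abs_nonneg _)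
      ((hint haW).const_mul _) (Eventually.of_forall fun p => ?_)
    simp only
    rw [abs_mul, abs_mul]
    have h1 := hK τ r R hτ hr hR i l p
    have h2 := abs_beta_le_one (u p)
    by_cases hp : p ∈ strip d r R
    · simp only [Set.indicator_of_mem hp] at h1 ⊢
      refine mul_le_mul_of_nonneg_right ?_ (abs_nonneg _)
      calc _ ≤ K / r * 1 := by gcongr
        _ ≤ (K + L) * r⁻¹ := by rw [mul_one, div_eq_mul_inv]; gcongr; linarith
    · simp only [Set.indicator_of_notMem hp] at h1 ⊢
      rw [le_antisymm h1 (abs_nonneg _)]; simp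
  have htr : τ * ∫ p, betaPrim (u p) * transport (cutWeight τ r R) (amb p) ∂(measQ d)
      ≤ (K + L) / R * ∫ p, u p ^ 2 ∂(measQ d)
        + (K + L) * (r⁻¹ * ∫ p in strip d r R, |u p| ∂(measQ d)) := by
    rw [← integral_indicator (measurableSet_strip d r R), ← mul_assoc, ← integral_const_mul,
      ← integral_const_mul, ← integral_const_mul,
      ← integral_add (hu.integrable_sq.const_mul _) ((hint hu).const_mul _)]
    refine integral_mono ((integrable_mul_of_memLp (memLp_betaPrim_comp hu)
      ((isTestV_cutWeight τ r hR).transport.memLp _)).const_mul τ)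
      ((hu.integrable_sq.const_mul _).add ((hint hu).const_mul _)) fun p => ?_
    have h1 := hL τ r R hτ hr hR p
    have h3 : τ * (betaPrim (u p) * transport (cutWeight τ r R) (amb p))
        ≤ betaPrim (u p) * |transport (cutWeight τ r R) (amb p)| := by
      refine (le_abs_self _).trans ?_
      rw [abs_mul, hτ, one_mul, abs_mul, abs_of_nonneg (betaPrim_nonneg _)]
    refine h3.trans ((mul_le_mul_of_nonneg_left h1 (betaPrim_nonneg _)).trans ?_)
    rw [mul_add]
    refine add_le_add ?_ ?_
    · rw [mul_comm]
      refine mul_le_mul ?_ (betaPrim_le_sq _) (betaPrim_nonneg _) (by positivity)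
      gcongr; linarith
    · by_cases hp : p ∈ strip d r R
      · simp only [Set.indicator_of_mem hp]
        rw [mul_comm]
        refine mul_le_mul ?_ ((le_abs_self _).trans (abs_betaPrim_le _)) (betaPrim_nonneg _)
          (by positivity)
        rw [div_eq_mul_inv]; gcongr; linarith
      · simp [Set.indicator_of_notMem hp]
  have hsum := Finset.sum_le_sum fun i (_ : i ∈ Finset.univ) =>
    Finset.sum_le_sum fun l (_ : l ∈ Finset.univ) => hang i l
  simp only [Finset.sum_neg_distrib] at hsum
  linarith

/-- Uniqueness for the homogeneous problem, without any information on traces. -/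
theorem IsHomSol.eq_zero {τ : ℝ} (hτ : |τ| = 1) {u : L2Q d} {w : L2QVec d}
    (h : IsAngGrad u w) (ha : IsCoeff a A) (hb : IsCoeff b B) {b₀ : ℝ} (hb0 : 0 < b₀)
    (hbl : ∀ᵐ x ∂(volume.restrict (halfSpace d)), b₀ ≤ b x) (heq : IsHomSol τ a b u w) :
    u = 0 := by
  obtain ⟨K, hK0, hK⟩ := exists_cutWeight_estimate hτ h ha hb heq
  have hu : MemLp u 2 (measQ d) := Lp.memLp u
  have hint : Integrable (fun p => beta (u p) * (b p.1 * u p)) (measQ d) :=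
    integrable_mul_of_memLp (memLp_beta_comp hu) (hb.memLp hu)
  -- limit `r → 0`
  have h1 : ∀ R : ℝ, 0 < R → ∫ p, (bigCut R (amb p) * beta (u p)) * (b p.1 * u p) ∂(measQ d)
      ≤ K / R * ∫ p, u p ^ 2 ∂(measQ d) := by
    intro R hR
    have hinv : ∀ k : ℕ, (1 / ((k : ℝ) + 1))⁻¹ = (k : ℝ) + 1 := fun k => by simp
    have tL : Tendsto (fun k : ℕ => ∫ p, (cutWeight τ (1 / ((k : ℝ) + 1)) R (amb p) * beta (u p))
        * (b p.1 * u p) ∂(measQ d)) atTop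
        (𝓝 (∫ p, (bigCut R (amb p) * beta (u p)) * (b p.1 * u p) ∂(measQ d))) := by
      refine tendsto_integral_of_dominated_convergence (fun p => ‖beta (u p) * (b p.1 * u p)‖)
        (fun k => ?_) hint.norm (fun k => Eventually.of_forall fun p => ?_) ?_
      · simp only [mul_assoc]
        exact (((isTestV_cutWeight τ _ hR).memLp _).1).mul hint.1
      · rw [mul_assoc, norm_mul]
        exact mul_le_of_le_one_left (norm_nonneg _) (abs_cutWeight_le _ _ _ _)
      · filter_upwards [ae_measQ_mem d] with p hp
        refine tendsto_const_nhds.congr' ?_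
        have hlim : Tendsto (fun k : ℕ => (1 / ((k : ℝ) + 1)) ^ 2) atTop (𝓝 0) := by
          simpa using (tendsto_one_div_add_atTop_nhds_zero_nat (𝕜 := ℝ)).pow 2
        have hp' : 0 < p.1 (Fin.last d) := hp
        filter_upwards [hlim.eventually (gt_mem_nhds hp')] with k hk
        have : grazeCut τ (1 / ((k : ℝ) + 1)) (amb p) = 0 :=
          grazeCut_zero (q := amb p) τ (by positivity) hk.le
        rw [cutWeight, this, sub_zero, mul_one]
    have tR : Tendsto (fun k : ℕ => K / R * ∫ p, u p ^ 2 ∂(measQ d)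
        + K * (((k : ℝ) + 1) * ∫ p in strip d (1 / ((k : ℝ) + 1)) R, |u p| ∂(measQ d))
        + (1 / 2) * ∑ i, ∑ l, K * (((k : ℝ) + 1) * ∫ p in strip d (1 / ((k : ℝ) + 1)) R,
          |a p.1 * rotComp w i l p| ∂(measQ d))) atTop
        (𝓝 (K / R * ∫ p, u p ^ 2 ∂(measQ d) + K * 0
          + (1 / 2) * ∑ i : Fin (d + 1), ∑ l : Fin (d + 1), K * 0)) :=
      (tendsto_const_nhds.add ((tendsto_strip R hu).const_mul K)).add
        ((tendsto_finsetSum _ fun i _ => tendsto_finsetSum _ fun l _ =>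
          (tendsto_strip R (ha.memLp (memLp_rotComp w i l))).const_mul K).const_mul _)
    have := le_of_tendsto_of_tendsto' tL tR fun k => by
      have := hK (1 / ((k : ℝ) + 1)) R (by positivity) hR
      simpa only [hinv] using this
    simpa using this
  -- limit `R → ∞`
  have tL : Tendsto (fun k : ℕ => ∫ p, (bigCut ((k : ℝ) + 1) (amb p) * beta (u p))
      * (b p.1 * u p) ∂(measQ d)) atTop (𝓝 (∫ p, beta (u p) * (b p.1 * u p) ∂(measQ d))) := by
    refine tendsto_integral_of_dominated_convergence (fun p => ‖beta (u p) * (b p.1 * u p)‖)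
      (fun k => ?_) hint.norm (fun k => Eventually.of_forall fun p => ?_)
      (Eventually.of_forall fun p => ?_)
    · simp only [mul_assoc]
      exact (((isTestV_bigCut (by positivity)).memLp _).1).mul hint.1
    · rw [mul_assoc, norm_mul, Real.norm_of_nonneg (bigCut_nonneg _ _)]
      exact mul_le_of_le_one_left (norm_nonneg _) (bigCut_le_one _ _)
    · refine tendsto_const_nhds.congr' ?_
      filter_upwards [eventually_ge_atTop ⌈‖p.1‖⌉₊] with k hk
      have h2 : ‖p.1‖ ≤ (k : ℝ) + 1 := by
        have := Nat.ceil_le.1 hk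
        linarith
      have h4 : bigCut ((k : ℝ) + 1) (amb p) = 1 := bigCut_eq_one (q := amb p) h2 (by simp [amb])
      rw [h4, one_mul]
  have tR : Tendsto (fun k : ℕ => K / ((k : ℝ) + 1) * ∫ p, u p ^ 2 ∂(measQ d)) atTop (𝓝 0) := by
    have := ((tendsto_one_div_add_atTop_nhds_zero_nat (𝕜 := ℝ)).const_mul K).mul_const
      (∫ p, u p ^ 2 ∂(measQ d))
    simpa [div_eq_mul_inv] using this
  have hle : ∫ p, beta (u p) * (b p.1 * u p) ∂(measQ d) ≤ 0 :=
    le_of_tendsto_of_tendsto' tL tR fun k => h1 _ (by positivity)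
  have hnn : 0 ≤ᵐ[measQ d] fun p => beta (u p) * (b p.1 * u p) := by
    filter_upwards [ae_measQ_of_ae hb.nonneg] with p hp
    have := mul_nonneg hp (mul_beta_nonneg (u p))
    show 0 ≤ beta (u p) * (b p.1 * u p)
    linarith
  have hz := (integral_eq_zero_iff_of_nonneg_ae hnn hint).1
    (le_antisymm hle (integral_nonneg_of_ae hnn))
  refine (Lp.eq_zero_iff_ae_eq_zero).2 ?_
  filter_upwards [hz, ae_measQ_of_ae hbl] with p hp hbp
  have hbp0 : b p.1 ≠ 0 := (hb0.trans_le hbp).ne'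
  refine eq_zero_of_mul_beta ?_
  have hp' : beta (u p) * (b p.1 * u p) = 0 := hp
  have : b p.1 * (u p * beta (u p)) = 0 := by linarith
  exact (mul_eq_zero.1 this).resolve_left hbp0

end Uniqueness

section Density

variable {d : ℕ}

/-- A function of `L²` which is orthogonal to the smooth functions supported in `U` vanishes
in `U`. -/
theorem ae_eq_zero_of_integral_test {μ : Measure (E d × S d)} [IsFiniteMeasureOnCompacts μ]
    {U : Set (E d × E d)} (hU : IsOpen U) {f : E d × S d → ℝ} (hf : MemLp f 2 μ)
    (h : ∀ g : E d × E d → ℝ, IsTestV g → tsupport g ⊆ U → ∫ p, f p * g (amb p) ∂μ = 0) :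
    ∀ᵐ p ∂μ, amb p ∈ U → f p = 0 := by
  have hemb := (isClosedEmbedding_amb d).measurableEmbedding
  have hext : (Function.extend amb f 0) ∘ amb = f := by
    funext p
    simp [(isClosedEmbedding_amb d).injective.extend_apply]
  have hext' : ∀ p, Function.extend amb f 0 (amb p) = f p := fun p => congrFun hext p
  have hloc : LocallyIntegrable (Function.extend amb f 0) (Measure.map amb μ) := by
    rw [locallyIntegrable_iff]
    intro K hK
    rw [hemb.integrableOn_map_iff, hext]
    have hK' := (isClosedEmbedding_amb d).isCompact_preimage hK
    have : IsFiniteMeasure (μ.restrict (amb ⁻¹' K)) := ⟨by simpa using hK'.measure_lt_top⟩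
    exact (hf.restrict _).integrable (by norm_num)
  have key := hU.ae_eq_zero_of_integral_contDiff_smul_eq_zero (μ := Measure.map amb μ)
    (hloc.locallyIntegrableOn U) fun g hg hgc hgs => by
      rw [hemb.integral_map]
      simp only [hext', smul_eq_mul]
      rw [← h g ⟨hg, hgc⟩ hgs]
      exact integral_congr_ae (Eventually.of_forall fun p => mul_comm _ _)
  rw [hemb.ae_map_iff] at key
  simpa only [hext'] using key

theorem IsAngGrad.eq_zero {w : L2QVec d} (h : IsAngGrad (0 : L2Q d) w) : w = 0 := by
  have h0 : ∀ᵐ p ∂(measQ d), (0 : L2Q d) p = 0 := Lp.coeFn_zero ℝ 2 (measQ d)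
  have h1 : ∀ i l, ∀ᵐ p ∂(measQ d), rotComp w i l p = 0 := by
    intro i l
    have := ae_eq_zero_of_integral_test isOpen_univ (memLp_rotComp w i l) fun g hg _ => by
      have h2 := h.integral_rot hg i l
      rw [integral_eq_zero_of_ae (h0.mono fun p hp => by rw [hp, zero_mul]; rfl)] at h2
      exact neg_eq_zero.1 h2.symm
    simpa using this
  refine (Lp.eq_zero_iff_ae_eq_zero).2 ?_
  have h2 : ∀ᵐ p ∂(measQ d), ∀ i l, rotComp w i l p = 0 :=
    ae_all_iff.2 fun i => ae_all_iff.2 fun l => h1 i l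
  filter_upwards [h.1, h2] with p hp hr
  refine eq_of_inner_rotVec hp (inner_zero_left _) fun i l => ?_
  exact (hr i l).trans (inner_zero_left _).symm

end Density

section Spaces

variable {d : ℕ} {ε : ℝ}

theorem isAngGrad_hGrad (hε : ε ≠ 0) (u : H d ε) : IsAngGrad (hFn u) (hGrad u) := by
  obtain ⟨w, hw, hs⟩ := u.2
  rw [hGrad, hs, smul_smul, inv_mul_cancel₀ hε, one_smul]
  exact hw

theorem snd_eq_smul_hGrad (hε : ε ≠ 0) (u : H d ε) : u.1.snd = ε • hGrad u := by
  rw [hGrad, smul_smul, mul_inv_cancel₀ hε, one_smul]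

theorem eq_zero_of_hFn (hε : ε ≠ 0) {u : H d ε} (h : hFn u = 0) : u = 0 := by
  have h1 := isAngGrad_hGrad hε u
  rw [h] at h1
  have h2 := h1.eq_zero
  have h3 := snd_eq_smul_hGrad hε u
  rw [h2, smul_zero] at h3
  refine Subtype.ext ?_
  rw [WithLp.ext_iff, Prod.ext_iff]
  exact ⟨h, h3⟩

theorem hFn_injective (hε : ε ≠ 0) : Function.Injective (hFn (d := d) (ε := ε)) := by
  intro u v h
  have : hFn (u - v) = 0 := by
    have e : hFn (u - v) = hFn u - hFn v := rfl
    rw [e, h, sub_self]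
  exact sub_eq_zero.1 (eq_zero_of_hFn hε this)

theorem integral_mul_eq_inner {X : Type*} [MeasurableSpace X] {m : Measure X} (u : Lp ℝ 2 m)
    {G : X → ℝ} (hG : MemLp G 2 m) : ∫ x, u x * G x ∂m = inner ℝ hG.toLp u := by
  rw [L2.inner_def]
  refine integral_congr_ae ?_
  filter_upwards [hG.coeFn_toLp] with x hx
  rw [hx]; rfl

theorem isClosed_H (hε : ε ≠ 0) : IsClosed (H d ε : Set (WithLp 2 (L2Q d × L2QVec d))) := by
  refine IsSeqClosed.isClosed fun x p hx hp => ?_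
  have hfst : Tendsto (fun k => (x k).fst) atTop (𝓝 p.fst) :=
    ((WithLp.fstL 2 ℝ (L2Q d) (L2QVec d)).continuous.tendsto p).comp hp
  have hsnd : Tendsto (fun k => ε⁻¹ • (x k).snd) atTop (𝓝 (ε⁻¹ • p.snd)) :=
    (((WithLp.sndL 2 ℝ (L2Q d) (L2QVec d)).continuous.tendsto p).comp hp).const_smul _
  have hk : ∀ k, IsAngGrad (x k).fst (ε⁻¹ • (x k).snd) := fun k => isAngGrad_hGrad hε ⟨x k, hx k⟩
  refine ⟨ε⁻¹ • p.snd, ⟨?_, fun Φ hΦ ht => ?_⟩, by rw [smul_smul, mul_inv_cancel₀ hε, one_smul]⟩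
  · obtain ⟨n, -, hn⟩ := (tendstoInMeasure_of_tendsto_Lp hsnd).exists_seq_tendsto_ae
    have hall : ∀ᵐ p ∂(measQ d), ∀ k, inner ℝ ((ε⁻¹ • (x k).snd : L2QVec d) p) (p.2 : E d) = 0 :=
      ae_all_iff.2 fun k => (hk k).1
    filter_upwards [hn, hall] with q hq hq0
    refine tendsto_nhds_unique (hq.inner tendsto_const_nhds) ?_
    simp only [hq0]
    exact tendsto_const_nhds
  · have e1 : ∀ w : L2QVec d, ∫ q, inner ℝ (w q) (Φ (amb q)) ∂(measQ d)
        = inner ℝ w hΦ.memLp.toLp := by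
      intro w
      rw [L2.inner_def]
      refine integral_congr_ae ?_
      filter_upwards [hΦ.memLp.coeFn_toLp] with q hq
      rw [hq]
    have e2 : ∀ k, inner ℝ (ε⁻¹ • (x k).snd : L2QVec d) hΦ.memLp.toLp
        = - inner ℝ (memLp_angDiv hΦ).toLp (x k).fst := by
      intro k
      rw [← e1, ← integral_mul_eq_inner]
      exact (hk k).2 Φ hΦ ht
    rw [e1, integral_mul_eq_inner]
    refine tendsto_nhds_unique (hsnd.inner tendsto_const_nhds) ?_
    simp only [e2]
    exact (tendsto_const_nhds.inner hfst).neg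

theorem completeSpace_H (hε : ε ≠ 0) : CompleteSpace (H d ε) :=
  (isClosed_H hε).completeSpace_coe

/-- The element of `𝓗` given by a smooth function. -/
def smoothH (ε : ℝ) {φ : E d × E d → ℝ} (hs : ContDiff ℝ ∞ φ)
    (h1 : MemLp (fun p => φ (amb p)) 2 (measQ d))
    (h2 : MemLp (fun p => angGrad φ (amb p)) 2 (measQ d)) : H d ε :=
  ⟨WithLp.toLp 2 (h1.toLp, ε • h2.toLp), h2.toLp,
    isAngGrad_of_smooth hs h1.coeFn_toLp h2.coeFn_toLp, rfl⟩

theorem hFn_smoothH {φ : E d × E d → ℝ} (hs : ContDiff ℝ ∞ φ)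
    (h1 : MemLp (fun p => φ (amb p)) 2 (measQ d))
    (h2 : MemLp (fun p => angGrad φ (amb p)) 2 (measQ d)) :
    hFn (smoothH ε hs h1 h2) = h1.toLp := rfl

theorem snd_smoothH {φ : E d × E d → ℝ} (hs : ContDiff ℝ ∞ φ)
    (h1 : MemLp (fun p => φ (amb p)) 2 (measQ d))
    (h2 : MemLp (fun p => angGrad φ (amb p)) 2 (measQ d)) :
    (smoothH ε hs h1 h2).1.snd = ε • h2.toLp := rfl

theorem IsTestV.memLp_angGrad {φ : E d × E d → ℝ} (h : IsTestV φ) :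
    MemLp (fun p => angGrad φ (amb p)) 2 (measQ d) :=
  memLp_comp_amb (continuous_angGrad h.smooth)
    (HasCompactSupport.intro h.compact fun _ hq => angGrad_of_notMem_tsupport h.smooth hq)

/-- The element of `𝓗` given by a test function. -/
def testH (ε : ℝ) {φ : E d × E d → ℝ} (h : IsTestV φ) : H d ε :=
  smoothH ε h.smooth (h.memLp _) h.memLp_angGrad

theorem coeFn_testH {φ : E d × E d → ℝ} (h : IsTestV φ) :
    ∀ᵐ p ∂(measQ d), hFn (testH ε h) p = φ (amb p) :=
  (h.memLp (measQ d)).coeFn_toLp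

/-- `C_c^∞(Q)` is dense in `𝓗`. -/
theorem eq_zero_of_orthogonal_test (hε : ε ≠ 0) {u : H d ε}
    (h : ∀ φ : E d × E d → ℝ, ∀ hφ : IsTestQ φ, inner ℝ u (testH ε hφ.toV) = 0) : u = 0 := by
  have hG := isAngGrad_hGrad hε u
  obtain ⟨j, hj⟩ := exists_mollSeq d (s := 1) (by simp)
  have hu : MemLp (hFn u) 2 (measQ d) := Lp.memLp _
  have hum : MemLp ((phase d).indicator (hFn u)) 2 (fullMeasure d) := memLp_zeroExt hu
  have hv : ∀ k, ContDiff ℝ ∞ (moll (j k) ((phase d).indicator (hFn u))) := fun k =>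
    contDiff_moll (hj.test k) (locallyIntegrable_of_memLp hum)
  have hV : ∀ (R : ℝ), 0 < R → ∀ k,
      IsTestV fun q => bigCut R q * moll (j k) ((phase d).indicator (hFn u)) q := fun R hR k =>
    (isTestV_bigCut hR).mul_right (hv k)
  have hQ : ∀ (R : ℝ), 0 < R → ∀ k,
      IsTestQ fun q => bigCut R q * moll (j k) ((phase d).indicator (hFn u)) q := fun R hR k => by
    refine ⟨(hV R hR k).smooth, (hV R hR k).compact, fun q hq => ?_⟩
    have hcl : IsClosed {q : E d × E d | 1 / (2 * ((k : ℝ) + 1)) ≤ q.1 (Fin.last d)} :=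
      isClosed_le continuous_const (continuous_last.comp continuous_fst)
    have h1 : 1 / (2 * ((k : ℝ) + 1)) ≤ q.1 (Fin.last d) :=
      closure_minimal (fun q hq => by
        obtain ⟨p, hp, hjp⟩ := exists_of_moll_ne_zero (right_ne_zero_of_mul hq)
        have hmem0 : p ∈ phase d := Set.mem_of_indicator_ne_zero hp
        have hmem : 0 < p.1 (Fin.last d) := hmem0
        have h1 := hj.side k _ hjp
        have h2 : (q - amb p).1 (Fin.last d) = q.1 (Fin.last d) - p.1 (Fin.last d) := by
          rw [Prod.fst_sub, PiLp.sub_apply]; rfl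
        rw [h2] at h1
        simp only [Set.mem_ofPred_eq]
        linarith) hcl hq
    have h0 : (0 : ℝ) < 1 / (2 * ((k : ℝ) + 1)) := by positivity
    exact h0.trans_le h1
  -- the orthogonality relation
  have hrel : ∀ (R : ℝ), 0 < R → ∀ k,
      ∫ p, (bigCut R (amb p) * hFn u p) * moll (j k) ((phase d).indicator (hFn u)) (amb p)
        ∂(measQ d)
      + ε ^ 2 * ((1 / 2) * ∑ i, ∑ l, ∫ p, (bigCut R (amb p) * rotComp (hGrad u) i l p)
        * moll (j k) ((phase d).indicator (rotComp (hGrad u) i l)) (amb p) ∂(measQ d)) = 0 := by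
    intro R hR k
    rw [← h _ (hQ R hR k), show (inner ℝ u (testH ε (hQ R hR k).toV) : ℝ)
      = inner ℝ u.1.fst (testH ε (hQ R hR k).toV).1.fst
        + inner ℝ u.1.snd (testH ε (hQ R hR k).toV).1.snd from
      WithLp.prod_inner_apply u.1 (testH ε (hQ R hR k).toV).1]
    congr 1
    · rw [real_inner_comm]
      refine Eq.trans ?_ (integral_mul_eq_inner (hFn u) ((hV R hR k).memLp (measQ d)))
      refine integral_congr_ae (Eventually.of_forall fun p => ?_)
      simp only
      ring
    · rw [snd_eq_smul_hGrad hε u, testH, snd_smoothH, real_inner_smul_left, real_inner_smul_right,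
        ← mul_assoc ε ε, ← pow_two, L2.inner_def]
      congr 1
      have e1 : ∀ᵐ p ∂(measQ d), inner ℝ (hGrad u p) (((hV R hR k).memLp_angGrad.toLp _ : L2QVec d) p)
          = (1 / 2) * ∑ i, ∑ l, (bigCut R (amb p) * rotComp (hGrad u) i l p)
            * moll (j k) ((phase d).indicator (rotComp (hGrad u) i l)) (amb p) := by
        filter_upwards [inner_angGrad_eq_sum hG (hV R hR k).smooth,
          (hV R hR k).memLp_angGrad.coeFn_toLp] with p hp1 hp2
        rw [hp2, hp1]
        congr 1
        refine Finset.sum_congr rfl fun i _ => Finset.sum_congr rfl fun l _ => ?_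
        have e2 : rot i l (moll (j k) ((phase d).indicator (hFn u))) (amb p)
            = moll (j k) ((phase d).indicator (rotComp (hGrad u) i l)) (amb p) :=
          hj.rot_moll k (locallyIntegrable_of_memLp hum) (hG.isWeakRot i l) _
        rw [rot_mul (isTestV_bigCut hR).smooth (hv k), rot_bigCut, e2]
        ring
      rw [integral_congr_ae e1, integral_const_mul]
      have hi : ∀ i l, Integrable (fun p => (bigCut R (amb p) * rotComp (hGrad u) i l p)
            * moll (j k) ((phase d).indicator (rotComp (hGrad u) i l)) (amb p)) (measQ d) := by
        intro i l
        refine integrable_mul_of_memLp ?_ (hj.memLp_measQ k (memLp_rotComp _ i l))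
        exact FokkerPlanck.MeasureTheory.MemLp.bdd_mul' (memLp_rotComp _ i l)
          ((isTestV_bigCut hR).memLp _).1 (C := 1) (Eventually.of_forall fun p => by
            rw [abs_of_nonneg (bigCut_nonneg _ _)]; exact bigCut_le_one _ _)
      rw [integral_finsetSum _ fun i _ => integrable_finsetSum _ fun l _ => hi i l]
      congr 1
      exact (Finset.sum_congr rfl fun i _ => integral_finsetSum _ fun l _ => hi i l).symm
  have hlim : ∀ (R : ℝ), 0 < R → ∫ p, bigCut R (amb p) * hFn u p ^ 2 ∂(measQ d) ≤ 0 := by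
    intro R hR
    have hb : ∀ {f : E d × S d → ℝ}, MemLp f 2 (measQ d) →
        MemLp (fun p => bigCut R (amb p) * f p) 2 (measQ d) := fun hf =>
      FokkerPlanck.MeasureTheory.MemLp.bdd_mul' hf
          ((isTestV_bigCut hR).memLp _).1 (C := 1) (Eventually.of_forall fun p => by
            rw [abs_of_nonneg (bigCut_nonneg _ _)]; exact bigCut_le_one _ _)
    have t : ∀ {f : E d × S d → ℝ}, MemLp f 2 (measQ d) →
        Tendsto (fun k => ∫ p, (bigCut R (amb p) * f p) * moll (j k) ((phase d).indicator f) (amb p)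
          ∂(measQ d)) atTop (𝓝 (∫ p, (bigCut R (amb p) * f p) * f p ∂(measQ d))) := fun hf =>
      TendstoL2.integral_mul (fun _ => hb hf) (fun k => hj.memLp_measQ k hf) (hb hf) hf
        (TendstoL2.const _) (hj.tendstoL2_measQ hf)
    have tt := (t hu).add (((tendsto_finsetSum Finset.univ fun i _ =>
      tendsto_finsetSum Finset.univ fun l _ =>
        t (memLp_rotComp (hGrad u) i l)).const_mul (1 / 2)).const_mul (ε ^ 2))
    simp only [hrel R hR] at tt
    have h0 := tendsto_nhds_unique tt tendsto_const_nhds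
    have hnn : ∀ f : E d × S d → ℝ, 0 ≤ ∫ p, (bigCut R (amb p) * f p) * f p ∂(measQ d) := fun f =>
      integral_nonneg fun p => by
        show 0 ≤ (bigCut R (amb p) * f p) * f p
        rw [mul_assoc]
        exact mul_nonneg (bigCut_nonneg _ _) (mul_self_nonneg _)
    have h2 : 0 ≤ ε ^ 2 * ((1 / 2) * ∑ i, ∑ l, ∫ p, (bigCut R (amb p) * rotComp (hGrad u) i l p)
        * rotComp (hGrad u) i l p ∂(measQ d)) :=
      mul_nonneg (sq_nonneg _) (mul_nonneg (by norm_num)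
        (Finset.sum_nonneg fun i _ => Finset.sum_nonneg fun l _ => hnn _))
    have h3 : ∫ p, bigCut R (amb p) * hFn u p ^ 2 ∂(measQ d)
        = ∫ p, (bigCut R (amb p) * hFn u p) * hFn u p ∂(measQ d) :=
      integral_congr_ae (Eventually.of_forall fun p => by simp only; ring)
    rw [h3]
    linarith
  have hz : ∀ k : ℕ, ∀ᵐ p ∂(measQ d), bigCut ((k : ℝ) + 1) (amb p) * hFn u p ^ 2 = 0 := by
    intro k
    have hnn : 0 ≤ᵐ[measQ d] fun p => bigCut ((k : ℝ) + 1) (amb p) * hFn u p ^ 2 :=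
      Eventually.of_forall fun p => mul_nonneg (bigCut_nonneg _ _) (sq_nonneg _)
    refine (integral_eq_zero_iff_of_nonneg_ae hnn ?_).1
      (le_antisymm (hlim _ (by positivity)) (integral_nonneg_of_ae hnn))
    refine hu.integrable_sq.mono' (((isTestV_bigCut (by positivity)).memLp _).1.mul
      hu.integrable_sq.1) (Eventually.of_forall fun p => ?_)
    rw [Real.norm_of_nonneg (mul_nonneg (bigCut_nonneg _ _) (sq_nonneg _))]
    exact mul_le_of_le_one_left (sq_nonneg _) (bigCut_le_one _ _)
  refine eq_zero_of_hFn hε ((Lp.eq_zero_iff_ae_eq_zero).2 ?_)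
  filter_upwards [ae_all_iff.2 hz] with p hp
  have hk := hp ⌈‖p.1‖⌉₊
  rw [bigCut_eq_one] at hk
  · simpa using hk
  · have := Nat.le_ceil ‖p.1‖
    show ‖p.1‖ ≤ _
    linarith
  · show ‖(p.2 : E d)‖ ≤ 1
    simp

end Spaces

section Operators

variable {d : ℕ} {ε : ℝ} {a b : E d → ℝ} {A B : ℝ}

theorem IsTransport.unique (hε : ε ≠ 0) {u : H d ε} {ℓ ℓ' : HDual d ε} (h : IsTransport u ℓ)
    (h' : IsTransport u ℓ') : ℓ = ℓ' := by
  have := completeSpace_H (d := d) hε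
  have key : (InnerProductSpace.toDual ℝ (H d ε)).symm (ℓ - ℓ') = 0 := by
    refine eq_zero_of_orthogonal_test hε fun φ hφ => ?_
    rw [InnerProductSpace.toDual_symm_apply]
    show ℓ _ - ℓ' _ = 0
    rw [h φ hφ _ (coeFn_testH hφ.toV), h' φ hφ _ (coeFn_testH hφ.toV), sub_self]
  exact sub_eq_zero.1 ((LinearIsometryEquiv.map_eq_zero_iff _).1 key)

theorem isTransport_of_tendsto {u : ℕ → H d ε} {ℓ : ℕ → HDual d ε} {u₀ : H d ε} {ℓ₀ : HDual d ε}
    (h : ∀ k, IsTransport (u k) (ℓ k)) (hu : Tendsto u atTop (𝓝 u₀))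
    (hℓ : Tendsto ℓ atTop (𝓝 ℓ₀)) : IsTransport u₀ ℓ₀ := by
  intro φ hφ v hv
  have h1 : Tendsto (fun k => ℓ k v) atTop (𝓝 (ℓ₀ v)) :=
    ((ContinuousLinearMap.apply ℝ ℝ v).continuous.tendsto ℓ₀).comp hℓ
  have h2 : Tendsto (fun k => hFn (u k)) atTop (𝓝 (hFn u₀)) :=
    (((WithLp.fstL 2 ℝ (L2Q d) (L2QVec d)).continuous.comp continuous_subtype_val).tendsto u₀).comp
      hu
  refine tendsto_nhds_unique h1 ?_
  simp only [fun k => h k φ hφ v hv, integral_mul_eq_inner _ (memLp_transport hφ)]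
  exact (tendsto_const_nhds.inner h2).neg

section Multiplication

variable {F : Type*} [NormedAddCommGroup F] [InnerProductSpace ℝ F]

theorem IsCoeff.memLp_smul (ha : IsCoeff a A) (f : Lp F 2 (measQ d)) :
    MemLp (fun p => a p.1 • f p) 2 (measQ d) := by
  refine (Lp.memLp f).of_le_mul (c := A) (ha.aestronglyMeasurable.smul (Lp.memLp f).1) ?_
  filter_upwards [ha.ae_abs_le] with p hp
  rw [norm_smul]
  exact mul_le_mul_of_nonneg_right hp (norm_nonneg _)

/-- Multiplication by a bounded coefficient. -/
def IsCoeff.mulOp (ha : IsCoeff a A) : Lp F 2 (measQ d) →ₗ[ℝ] Lp F 2 (measQ d) where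
  toFun f := (ha.memLp_smul f).toLp
  map_add' f g := by
    refine Lp.ext ?_
    filter_upwards [(ha.memLp_smul (f + g)).coeFn_toLp, Lp.coeFn_add f g,
      Lp.coeFn_add (ha.memLp_smul f).toLp (ha.memLp_smul g).toLp, (ha.memLp_smul f).coeFn_toLp,
      (ha.memLp_smul g).coeFn_toLp] with p h1 h2 h3 h4 h5
    rw [h1, h2, h3, Pi.add_apply, Pi.add_apply, h4, h5, smul_add]
  map_smul' c f := by
    refine Lp.ext ?_
    filter_upwards [(ha.memLp_smul (c • f)).coeFn_toLp, Lp.coeFn_smul c f,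
      Lp.coeFn_smul c (ha.memLp_smul f).toLp, (ha.memLp_smul f).coeFn_toLp] with p h1 h2 h3 h4
    rw [h1, h2, RingHom.id_apply, h3, Pi.smul_apply, Pi.smul_apply, h4, smul_comm]

theorem IsCoeff.coeFn_mulOp (ha : IsCoeff a A) (f : Lp F 2 (measQ d)) :
    ∀ᵐ p ∂(measQ d), ha.mulOp f p = a p.1 • f p :=
  (ha.memLp_smul f).coeFn_toLp

theorem IsCoeff.norm_mulOp_le (ha : IsCoeff a A) (f : Lp F 2 (measQ d)) :
    ‖ha.mulOp f‖ ≤ A * ‖f‖ := by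
  refine Lp.norm_le_mul_norm_of_ae_le_mul ?_
  filter_upwards [ha.ae_abs_le, ha.coeFn_mulOp f] with p hp h
  rw [h, norm_smul]
  exact mul_le_mul_of_nonneg_right hp (norm_nonneg _)

theorem IsCoeff.inner_mulOp (ha : IsCoeff a A) (f g : Lp F 2 (measQ d)) :
    inner ℝ (ha.mulOp f) g = ∫ p, a p.1 * inner ℝ (f p) (g p) ∂(measQ d) := by
  rw [L2.inner_def]
  refine integral_congr_ae ?_
  filter_upwards [ha.coeFn_mulOp f] with p hp
  rw [hp, real_inner_smul_left]

theorem IsCoeff.integrable_inner (ha : IsCoeff a A) (f g : Lp F 2 (measQ d)) :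
    Integrable (fun p => a p.1 * inner ℝ (f p) (g p)) (measQ d) := by
  refine (L2.integrable_inner (𝕜 := ℝ) (ha.mulOp f) g).congr ?_
  filter_upwards [ha.coeFn_mulOp f] with p hp
  rw [hp, real_inner_smul_left]

theorem IsCoeff.le_inner_mulOp (ha : IsCoeff a A) {a₀ : ℝ}
    (h : ∀ᵐ x ∂(volume.restrict (halfSpace d)), a₀ ≤ a x) (f : Lp F 2 (measQ d)) :
    a₀ * ‖f‖ ^ 2 ≤ inner ℝ (ha.mulOp f) f := by
  rw [ha.inner_mulOp, ← real_inner_self_eq_norm_sq, L2.inner_def, ← integral_const_mul]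
  refine integral_mono_ae ((L2.integrable_inner (𝕜 := ℝ) f f).const_mul _)
    (ha.integrable_inner f f) ?_
  filter_upwards [ae_measQ_of_ae h] with p hp
  exact mul_le_mul_of_nonneg_right hp real_inner_self_nonneg

end Multiplication

theorem norm_hFn_le (u : H d ε) : ‖hFn u‖ ≤ ‖u‖ := by
  refine le_of_sq_le_sq ?_ (norm_nonneg _)
  have h : ‖u‖ ^ 2 = ‖hFn u‖ ^ 2 + ‖u.1.snd‖ ^ 2 := WithLp.prod_norm_sq_eq_of_L2 u.1
  rw [h]
  linarith [sq_nonneg ‖u.1.snd‖]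

theorem norm_snd_le_H (u : H d ε) : ‖u.1.snd‖ ≤ ‖u‖ := by
  refine le_of_sq_le_sq ?_ (norm_nonneg _)
  have h : ‖u‖ ^ 2 = ‖hFn u‖ ^ 2 + ‖u.1.snd‖ ^ 2 := WithLp.prod_norm_sq_eq_of_L2 u.1
  rw [h]
  linarith [sq_nonneg ‖hFn u‖]

/-- The functional `h ↦ ∫ G h` on `𝓗`. -/
def dualOf (d : ℕ) (ε : ℝ) : L2Q d →L[ℝ] HDual d ε :=
  LinearMap.mkContinuous₂ (LinearMap.mk₂ ℝ (fun (G : L2Q d) (h : H d ε) => inner ℝ G (hFn h))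
    (fun _ _ _ => inner_add_left _ _ _) (fun _ _ _ => real_inner_smul_left _ _ _)
    (fun _ _ _ => inner_add_right _ _ _) (fun _ _ _ => real_inner_smul_right _ _ _)) 1
    fun G h => by
      rw [one_mul]
      exact (norm_inner_le_norm _ _).trans
        (mul_le_mul_of_nonneg_left (norm_hFn_le h) (norm_nonneg _))

theorem dualOf_apply (G : L2Q d) (h : H d ε) : dualOf d ε G h = inner ℝ G (hFn h) := rfl

theorem norm_dualOf_le (G : L2Q d) : ‖dualOf d ε G‖ ≤ ‖G‖ := by
  refine ContinuousLinearMap.opNorm_le_bound _ (norm_nonneg _) fun h => ?_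
  exact (norm_inner_le_norm _ _).trans (mul_le_mul_of_nonneg_left (norm_hFn_le h) (norm_nonneg _))

theorem abs_form_le (ha : IsCoeff a A) (hb : IsCoeff b B) (hA : 0 ≤ A) (hB : 0 ≤ B)
    (u h : H d ε) : |inner ℝ (ha.mulOp u.1.snd) h.1.snd + inner ℝ (hb.mulOp (hFn u)) (hFn h)|
      ≤ (A + B) * ‖u‖ * ‖h‖ := by
  have h1 : |inner ℝ (ha.mulOp u.1.snd) h.1.snd| ≤ (A * ‖u‖) * ‖h‖ :=
    (abs_real_inner_le_norm _ _).trans (mul_le_mul ((ha.norm_mulOp_le _).trans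
      (mul_le_mul_of_nonneg_left (norm_snd_le_H u) hA)) (norm_snd_le_H h) (norm_nonneg _)
      (by positivity))
  have h2 : |inner ℝ (hb.mulOp (hFn u)) (hFn h)| ≤ (B * ‖u‖) * ‖h‖ :=
    (abs_real_inner_le_norm _ _).trans (mul_le_mul ((hb.norm_mulOp_le _).trans
      (mul_le_mul_of_nonneg_left (norm_hFn_le u) hB)) (norm_hFn_le h) (norm_nonneg _)
      (by positivity))
  refine (abs_add_le _ _).trans ?_
  linarith

/-- The operator `-ε² ∇_θ·(a ∇_θ u) + b u` from `𝓗` to `𝓗'`. -/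
def form (ε : ℝ) (ha : IsCoeff a A) (hb : IsCoeff b B) (hA : 0 ≤ A) (hB : 0 ≤ B) :
    H d ε →L[ℝ] HDual d ε :=
  LinearMap.mkContinuous₂ (LinearMap.mk₂ ℝ (fun u h : H d ε =>
      (inner ℝ (ha.mulOp u.1.snd) h.1.snd + inner ℝ (hb.mulOp (hFn u)) (hFn h) : ℝ))
    (fun u v h => by
      have e1 : (u + v).1.snd = u.1.snd + v.1.snd := rfl
      have e2 : hFn (u + v) = hFn u + hFn v := rfl
      rw [e1, e2, map_add, map_add, inner_add_left, inner_add_left]; ring)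
    (fun c u h => by
      have e1 : (c • u).1.snd = c • u.1.snd := rfl
      have e2 : hFn (c • u) = c • hFn u := rfl
      rw [e1, e2, map_smul, map_smul, real_inner_smul_left, real_inner_smul_left, smul_eq_mul]
      ring)
    (fun h u v => by
      have e1 : (u + v).1.snd = u.1.snd + v.1.snd := rfl
      have e2 : hFn (u + v) = hFn u + hFn v := rfl
      rw [e1, e2, inner_add_right, inner_add_right]; ring)
    (fun c h u => by
      have e1 : (c • u).1.snd = c • u.1.snd := rfl
      have e2 : hFn (c • u) = c • hFn u := rfl
      rw [e1, e2, real_inner_smul_right, real_inner_smul_right, smul_eq_mul]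
      ring)) (A + B) (fun u h => abs_form_le ha hb hA hB u h)

theorem form_apply (ha : IsCoeff a A) (hb : IsCoeff b B) (hA : 0 ≤ A) (hB : 0 ≤ B) (u h : H d ε) :
    form ε ha hb hA hB u h
      = inner ℝ (ha.mulOp u.1.snd) h.1.snd + inner ℝ (hb.mulOp (hFn u)) (hFn h) := rfl

theorem norm_form_le (ha : IsCoeff a A) (hb : IsCoeff b B) (hA : 0 ≤ A) (hB : 0 ≤ B) (u : H d ε) :
    ‖form ε ha hb hA hB u‖ ≤ (A + B) * ‖u‖ :=
  ContinuousLinearMap.opNorm_le_bound _ (by positivity) fun h => abs_form_le ha hb hA hB u h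

theorem le_form_self (ha : IsCoeff a A) (hb : IsCoeff b B) (hA : 0 ≤ A) (hB : 0 ≤ B) {a₀ b₀ : ℝ}
    (ha₀ : ∀ᵐ x ∂(volume.restrict (halfSpace d)), a₀ ≤ a x)
    (hb₀ : ∀ᵐ x ∂(volume.restrict (halfSpace d)), b₀ ≤ b x) (u : H d ε) :
    min a₀ b₀ * ‖u‖ ^ 2 ≤ form ε ha hb hA hB u u := by
  have h : ‖u‖ ^ 2 = ‖hFn u‖ ^ 2 + ‖u.1.snd‖ ^ 2 := WithLp.prod_norm_sq_eq_of_L2 u.1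
  have h1 := ha.le_inner_mulOp ha₀ u.1.snd
  have h2 := hb.le_inner_mulOp hb₀ (hFn u)
  have h3 := mul_le_mul_of_nonneg_right (min_le_left a₀ b₀) (sq_nonneg ‖u.1.snd‖)
  have h4 := mul_le_mul_of_nonneg_right (min_le_right a₀ b₀) (sq_nonneg ‖hFn u‖)
  rw [form_apply, h]
  linarith

end Operators

section Core

variable {d : ℕ} {ε : ℝ}

/-- The space `C_c^∞(Q̄ \ Γ₀)`. -/
def core (d : ℕ) : Submodule ℝ (E d × E d → ℝ) where
  carrier := {φ | IsTestNoGrazing φ}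
  zero_mem' := ⟨contDiff_const, HasCompactSupport.zero, by simp⟩
  add_mem' := fun {φ ψ} hφ hψ => ⟨hφ.smooth.add hψ.smooth, hφ.compact.add hψ.compact,
    (Set.disjoint_union_left.2 ⟨hφ.supp, hψ.supp⟩).mono_left (tsupport_add φ ψ)⟩
  smul_mem' := fun c φ hφ => ⟨hφ.smooth.const_smul c, hφ.compact.smul_left (f := fun _ => c),
    hφ.supp.mono_left (tsupport_smul_subset_right (fun _ => c) φ)⟩

theorem core.isTestV (φ : core d) : IsTestV φ.1 := IsTestNoGrazing.toV φ.2

theorem transport_smul {φ : E d × E d → ℝ} (h : ContDiff ℝ ∞ φ) (c : ℝ) (q : E d × E d) :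
    transport (c • φ) q = c * transport φ q := by
  rw [transport_eq h, show transport (c • φ) q = _ from transport_eq (h.const_smul c) q]
  rw [show fderiv ℝ (fun y => c • φ y) q = _ from ((hasFDerivAt_of_smooth h q).const_smul c).fderiv]
  simp

/-- The inclusion of the core in `𝓗`. -/
def coreH (hε : ε ≠ 0) : core d →ₗ[ℝ] H d ε where
  toFun φ := testH ε (core.isTestV φ)
  map_add' _ _ := hFn_injective hε rfl
  map_smul' _ _ := hFn_injective hε rfl

/-- The classical transport derivative on the core. -/
def coreT (d : ℕ) : core d →ₗ[ℝ] L2Q d where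
  toFun φ := ((core.isTestV φ).transport.memLp (measQ d)).toLp
  map_add' φ ψ := by
    rw [← MemLp.toLp_add]
    refine MemLp.toLp_congr _ _ (Eventually.of_forall fun p => ?_)
    exact transport_add (core.isTestV φ).smooth (core.isTestV ψ).smooth _
  map_smul' c φ := by
    rw [RingHom.id_apply, ← MemLp.toLp_const_smul]
    refine MemLp.toLp_congr _ _ (Eventually.of_forall fun p => ?_)
    exact transport_smul (core.isTestV φ).smooth c _

/-- The boundary values on the core. -/
def coreTr (G : Set (E d × S d)) : core d →ₗ[ℝ] Lp ℝ 2 (bdryMeasure d G) where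
  toFun φ := ((core.isTestV φ).memLp (bdryMeasure d G)).toLp
  map_add' _ _ := rfl
  map_smul' _ _ := rfl

theorem coeFn_coreTr (G : Set (E d × S d)) (φ : core d) :
    ∀ᵐ p ∂(bdryMeasure d G), coreTr G φ p = φ.1 (amb p) :=
  ((core.isTestV φ).memLp (bdryMeasure d G)).coeFn_toLp

theorem coeFn_coreT (φ : core d) : ∀ᵐ p ∂(measQ d), coreT d φ p = transport φ.1 (amb p) :=
  ((core.isTestV φ).transport.memLp (measQ d)).coeFn_toLp

theorem coeFn_coreH (hε : ε ≠ 0) (φ : core d) :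
    ∀ᵐ p ∂(measQ d), hFn (coreH hε φ) p = φ.1 (amb p) :=
  coeFn_testH (core.isTestV φ)

/-- Green's formula for a test function and a smooth function. -/
theorem green {φ χ : E d × E d → ℝ} (hφ : IsTestV φ) (hχ : ContDiff ℝ ∞ χ) :
    ∫ p, φ (amb p) * transport χ (amb p) ∂(measQ d)
      + ∫ p, transport φ (amb p) * χ (amb p) ∂(measQ d)
    = ∫ p, φ (amb p) * χ (amb p) ∂(bdryMeasure d (GammaPlus d))
      - ∫ p, φ (amb p) * χ (amb p) ∂(bdryMeasure d (GammaMinus d)) := by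
  rw [← integral_transport (hφ.mul_right hχ), ← integral_add
    ((hφ.mul_right (contDiff_transport hχ)).integrable _)
    ((hφ.transport.mul_right hχ).integrable _)]
  refine integral_congr_ae (Eventually.of_forall fun p => ?_)
  simp only
  rw [transport_mul hφ.smooth hχ]
  ring

theorem isTransport_core (hε : ε ≠ 0) (φ : core d) :
    IsTransport (coreH hε φ) (dualOf d ε (coreT d φ)) := by
  intro χ hχ h hh
  have hz : ∀ G : Set (E d × S d), MeasurableSet G → (∀ p ∈ G, p.1 (Fin.last d) = 0) →
      ∫ p, φ.1 (amb p) * χ (amb p) ∂(bdryMeasure d G) = 0 := by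
    intro G hG h0
    refine integral_eq_zero_of_ae ?_
    filter_upwards [ae_bdryMeasure_mem hG] with p hp
    have : χ (amb p) = 0 := by
      by_contra hne
      have : 0 < p.1 (Fin.last d) := hχ.supp (subset_tsupport _ hne)
      exact this.ne' (h0 p hp)
    simp [this]
  have hg := green (core.isTestV φ) hχ.smooth
  rw [hz _ (measurableSet_GammaPlus d) fun p hp => hp.1,
    hz _ (measurableSet_GammaMinus d) fun p hp => hp.1, sub_zero] at hg
  rw [dualOf_apply, L2.inner_def]
  have e1 : ∫ p, inner ℝ (coreT d φ p) (hFn h p) ∂(measQ d)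
      = ∫ p, transport φ.1 (amb p) * χ (amb p) ∂(measQ d) := by
    refine integral_congr_ae ?_
    filter_upwards [hh, coeFn_coreT φ] with p h1 h2
    rw [h1, h2]
    exact mul_comm _ _
  have e2 : ∫ p, hFn (coreH hε φ) p * transport χ (amb p) ∂(measQ d)
      = ∫ p, φ.1 (amb p) * transport χ (amb p) ∂(measQ d) := by
    refine integral_congr_ae ?_
    filter_upwards [coeFn_coreH hε φ] with p h1
    rw [h1]
  rw [e1, e2]
  linarith

/-- The inclusion of the core in `𝓨`. -/
def coreY (hε : ε ≠ 0) (φ : core d) : Y d ε :=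
  ⟨WithLp.toLp 2 (coreH hε φ, dualOf d ε (coreT d φ)), isTransport_core hε φ⟩

theorem sq_norm_eq_integral {X : Type*} [MeasurableSpace X] {m : Measure X} (f : Lp ℝ 2 m)
    {g : X → ℝ} (h : ∀ᵐ x ∂m, f x = g x) : ‖f‖ ^ 2 = ∫ x, g x * g x ∂m := by
  rw [← real_inner_self_eq_norm_sq, L2.inner_def]
  refine integral_congr_ae ?_
  filter_upwards [h] with x hx
  rw [hx]; rfl

theorem inner_coreT_coreH (hε : ε ≠ 0) (φ : core d) :
    dualOf d ε (coreT d φ) (coreH hε φ)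
      = (1 / 2) * (‖coreTr (GammaPlus d) φ‖ ^ 2 - ‖coreTr (GammaMinus d) φ‖ ^ 2) := by
  have hg := green (core.isTestV φ) (core.isTestV φ).smooth
  rw [sq_norm_eq_integral _ (coeFn_coreTr _ φ), sq_norm_eq_integral _ (coeFn_coreTr _ φ), ← hg,
    dualOf_apply, L2.inner_def]
  have e1 : ∫ p, inner ℝ (coreT d φ p) (hFn (coreH hε φ) p) ∂(measQ d)
      = ∫ p, transport φ.1 (amb p) * φ.1 (amb p) ∂(measQ d) := by
    refine integral_congr_ae ?_
    filter_upwards [coeFn_coreH hε φ, coeFn_coreT φ] with p h1 h2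
    rw [h1, h2]
    exact mul_comm _ _
  have e2 : ∫ p, φ.1 (amb p) * transport φ.1 (amb p) ∂(measQ d)
      = ∫ p, transport φ.1 (amb p) * φ.1 (amb p) ∂(measQ d) :=
    integral_congr_ae (Eventually.of_forall fun p => mul_comm _ _)
  rw [e1, e2]
  ring

end Core

section WeakForm

variable {d : ℕ} {ε : ℝ} {a b : E d → ℝ} {A B : ℝ}

theorem IsCoeff.const_mul (ha : IsCoeff a A) {c : ℝ} (hc : 0 ≤ c) :
    IsCoeff (fun x => c * a x) (c * A) :=
  ⟨ha.meas.const_mul c, ha.nonneg.mono fun _ h => mul_nonneg hc h,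
    ha.bound.mono fun _ h => mul_le_mul_of_nonneg_left h hc⟩

theorem form_comm (ha : IsCoeff a A) (hb : IsCoeff b B) (hA : 0 ≤ A) (hB : 0 ≤ B) (u h : H d ε) :
    form ε ha hb hA hB u h = form ε ha hb hA hB h u := by
  rw [form_apply, form_apply, ha.inner_mulOp, hb.inner_mulOp, ha.inner_mulOp, hb.inner_mulOp]
  congr 1
  · exact integral_congr_ae (Eventually.of_forall fun p => by
      simp only; rw [real_inner_comm])
  · exact integral_congr_ae (Eventually.of_forall fun p => by
      simp only; rw [real_inner_comm])

/-- The weak form of the equation, tested with a smooth function. -/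
theorem integral_weak_eq (hε : ε ≠ 0) (ha : IsCoeff a A) (hb : IsCoeff b B) (hA : 0 ≤ A)
    (hB : 0 ≤ B) (τ : ℝ) (u : H d ε) {φ : E d × E d → ℝ} (hs : ContDiff ℝ ∞ φ)
    (h1 : MemLp (fun p => φ (amb p)) 2 (measQ d))
    (h2 : MemLp (fun p => angGrad φ (amb p)) 2 (measQ d))
    (h3 : MemLp (fun p => transport φ (amb p)) 2 (measQ d)) :
    ∫ p, (ε ^ 2 * a p.1 * inner ℝ (hGrad u p) (angGrad φ (amb p))
        - τ * (hFn u p * transport φ (amb p)) + b p.1 * (hFn u p * φ (amb p))) ∂(measQ d)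
      = form ε ha hb hA hB u (smoothH ε hs h1 h2)
        - τ * ∫ p, hFn u p * transport φ (amb p) ∂(measQ d) := by
  have e1 : ∀ᵐ p ∂(measQ d), a p.1 * inner ℝ (u.1.snd p) ((smoothH ε hs h1 h2).1.snd p)
      = ε ^ 2 * a p.1 * inner ℝ (hGrad u p) (angGrad φ (amb p)) := by
    rw [snd_eq_smul_hGrad hε u, snd_smoothH]
    filter_upwards [Lp.coeFn_smul ε (hGrad u), Lp.coeFn_smul ε h2.toLp, h2.coeFn_toLp]
      with p p1 p2 p3
    rw [p1, p2, Pi.smul_apply, Pi.smul_apply, p3, real_inner_smul_left, real_inner_smul_right]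
    ring
  have e2 : ∀ᵐ p ∂(measQ d), b p.1 * inner ℝ (hFn u p) (hFn (smoothH ε hs h1 h2) p)
      = b p.1 * (hFn u p * φ (amb p)) := by
    filter_upwards [h1.coeFn_toLp] with p p1
    rw [hFn_smoothH, p1]
    congr 1
    exact mul_comm _ _
  have i1 := (ha.integrable_inner u.1.snd (smoothH ε hs h1 h2).1.snd).congr e1
  have i2 := (hb.integrable_inner (hFn u) (hFn (smoothH ε hs h1 h2))).congr e2
  have i3 : Integrable (fun p => hFn u p * transport φ (amb p)) (measQ d) :=
    integrable_mul_of_memLp (Lp.memLp _) h3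
  have i4 : Integrable (fun p => ε ^ 2 * a p.1 * inner ℝ (hGrad u p) (angGrad φ (amb p))
        - τ * (hFn u p * transport φ (amb p))) (measQ d) := i1.sub (i3.const_mul τ)
  rw [integral_add i4 i2, integral_sub i1 (i3.const_mul τ), integral_const_mul, form_apply,
    ha.inner_mulOp, hb.inner_mulOp, integral_congr_ae e1, integral_congr_ae e2]
  ring

theorem IsTestNoGrazing.of_tsupport {φ : E d × E d → ℝ} (h : IsTestV φ)
    (hs : ∀ q ∈ tsupport φ, q.1 (Fin.last d) = 0 → ‖q.2‖ = 1 → q.2 (Fin.last d) ≠ 0) :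
    IsTestNoGrazing φ := by
  refine ⟨h.smooth, h.compact, Set.disjoint_left.2 fun q hq h0 => ?_⟩
  obtain ⟨h1, h2, h3⟩ := h0
  rw [inner_normal, neg_eq_zero] at h3
  exact hs q hq h1 h2 h3

theorem GammaMinus_iff {p : E d × S d} :
    p ∈ GammaMinus d ↔ p.1 (Fin.last d) = 0 ∧ 0 < (p.2 : E d) (Fin.last d) := by
  rw [GammaMinus, Set.mem_ofPred_eq, inner_normal, neg_lt_zero]

theorem GammaPlus_iff {p : E d × S d} :
    p ∈ GammaPlus d ↔ p.1 (Fin.last d) = 0 ∧ (p.2 : E d) (Fin.last d) < 0 := by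
  rw [GammaPlus, Set.mem_ofPred_eq, inner_normal, neg_pos]

/-- An element of `L²(Γ±)` is determined by its integrals against the smooth functions supported
on the same side of the grazing set. -/
theorem trace_eq_zero {G : Set (E d × S d)} (hG : MeasurableSet G) {s : ℝ}
    (hs : ∀ p ∈ G, 0 < s * (p.2 : E d) (Fin.last d)) (m : Lp ℝ 2 (bdryMeasure d G))
    (h : ∀ g : E d × E d → ℝ, IsTestV g → tsupport g ⊆ {q | 0 < s * q.2 (Fin.last d)} →
      ∫ p, m p * g (amb p) ∂(bdryMeasure d G) = 0) : m = 0 := by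
  have hU : IsOpen {q : E d × E d | 0 < s * q.2 (Fin.last d)} :=
    isOpen_lt continuous_const (continuous_const.mul (continuous_last.comp continuous_snd))
  refine (Lp.eq_zero_iff_ae_eq_zero).2 ?_
  filter_upwards [ae_eq_zero_of_integral_test hU (Lp.memLp m) h, ae_bdryMeasure_mem hG]
    with p hp hpG
  exact hp (hs p hpG)

end WeakForm

section Load

variable {d : ℕ} {ε : ℝ} {a b : E d → ℝ} {A B : ℝ}

/-- The functional `Tφ - ε² ∇_θ·(a ∇_θ φ) + b φ` in `𝓗'`. -/
def loadDual (hε : ε ≠ 0) (ha : IsCoeff a A) (hb : IsCoeff b B) (hA : 0 ≤ A) (hB : 0 ≤ B) :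
    core d →ₗ[ℝ] HDual d ε :=
  (dualOf d ε).toLinearMap ∘ₗ coreT d + (form ε ha hb hA hB).toLinearMap ∘ₗ coreH hε

theorem loadDual_apply (hε : ε ≠ 0) (ha : IsCoeff a A) (hb : IsCoeff b B) (hA : 0 ≤ A)
    (hB : 0 ≤ B) (φ : core d) : loadDual hε ha hb hA hB φ
      = dualOf d ε (coreT d φ) + form ε ha hb hA hB (coreH hε φ) := rfl

theorem energy_bound {c x y N t : ℝ} (hc : 0 < c) (hN : 0 ≤ N) (ht : 0 ≤ t)
    (h : c * x ^ 2 + 1 / 2 * y ^ 2 ≤ N * x + 1 / 2 * t ^ 2) :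
    x ≤ (1 / c + 1) * (N + t) ∧ y ≤ (1 / c + 1) * (N + t) := by
  have hci : 0 < 1 / c := by positivity
  set e := 1 / c with he
  have hce : c * e = 1 := by rw [he]; field_simp
  have hyoung : 2 * (N * x) ≤ c * x ^ 2 + e * N ^ 2 := by
    have : 0 ≤ c * (x - e * N) ^ 2 := by positivity
    have h2 : c * (x - e * N) ^ 2 = c * x ^ 2 - 2 * (c * e) * (N * x) + (c * e) * e * N ^ 2 := by
      ring
    rw [h2, hce] at this
    linarith
  have h1 : c * x ^ 2 + y ^ 2 ≤ e * N ^ 2 + t ^ 2 := by linarith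
  have hNt := mul_nonneg hN ht
  constructor
  · refine abs_le_of_sq_le_sq' ?_ (by positivity) |>.2
    have h3 : e * (c * x ^ 2) ≤ e * (e * N ^ 2 + t ^ 2) :=
      mul_le_mul_of_nonneg_left (by linarith [sq_nonneg y]) hci.le
    have h4 : e * (c * x ^ 2) = x ^ 2 := by rw [← mul_assoc, mul_comm e c, hce, one_mul]
    rw [h4] at h3
    have h5 : ((e + 1) * (N + t)) ^ 2 = (e ^ 2 + 2 * e + 1) * (N ^ 2 + 2 * (N * t) + t ^ 2) := by
      ring
    rw [h5]
    nlinarith [mul_nonneg (sq_nonneg e) hNt, mul_nonneg hci.le hNt, sq_nonneg N, sq_nonneg t,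
      mul_nonneg hci.le (sq_nonneg N), mul_nonneg hci.le (sq_nonneg t),
      mul_nonneg (sq_nonneg e) (sq_nonneg t)]
  · refine abs_le_of_sq_le_sq' ?_ (by positivity) |>.2
    have h5 : ((e + 1) * (N + t)) ^ 2 = (e ^ 2 + 2 * e + 1) * (N ^ 2 + 2 * (N * t) + t ^ 2) := by
      ring
    rw [h5]
    nlinarith [mul_nonneg (sq_nonneg e) hNt, mul_nonneg hci.le hNt, sq_nonneg N, sq_nonneg t,
      mul_nonneg hci.le (sq_nonneg N), mul_nonneg hci.le (sq_nonneg t),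
      mul_nonneg (sq_nonneg e) (sq_nonneg t), mul_nonneg (sq_nonneg e) (sq_nonneg N),
      mul_nonneg hc.le (sq_nonneg x)]

/-- The energy estimate on the core. -/
theorem core_bound (hε : ε ≠ 0) (ha : IsCoeff a A) (hb : IsCoeff b B) (hA : 0 ≤ A) (hB : 0 ≤ B)
    {a₀ b₀ : ℝ} (ha0 : 0 < a₀) (hb0 : 0 < b₀)
    (ha₀ : ∀ᵐ x ∂(volume.restrict (halfSpace d)), a₀ ≤ a x)
    (hb₀ : ∀ᵐ x ∂(volume.restrict (halfSpace d)), b₀ ≤ b x) (φ : core d) :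
    ‖coreH hε φ‖ ≤ (1 / min a₀ b₀ + 1)
        * (‖loadDual hε ha hb hA hB φ‖ + ‖coreTr (GammaMinus d) φ‖) ∧
      ‖coreTr (GammaPlus d) φ‖ ≤ (1 / min a₀ b₀ + 1)
        * (‖loadDual hε ha hb hA hB φ‖ + ‖coreTr (GammaMinus d) φ‖) := by
  refine energy_bound (lt_min ha0 hb0)
    (ContinuousLinearMap.opNorm_nonneg _) (norm_nonneg _) ?_
  have h1 := le_form_self ha hb hA hB ha₀ hb₀ (coreH hε φ)
  have h2 := inner_coreT_coreH hε φ
  have h3 : loadDual hε ha hb hA hB φ (coreH hε φ)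
      = dualOf d ε (coreT d φ) (coreH hε φ) + form ε ha hb hA hB (coreH hε φ) (coreH hε φ) := rfl
  have h4 : loadDual hε ha hb hA hB φ (coreH hε φ) ≤ ‖loadDual hε ha hb hA hB φ‖ * ‖coreH hε φ‖ :=
    (le_abs_self _).trans ((loadDual hε ha hb hA hB φ).le_opNorm _)
  linarith

theorem exists_lim_of_norm_le {M V W X : Type*} [AddCommGroup M] [Module ℝ M]
    [NormedAddCommGroup V] [NormedSpace ℝ V] [CompleteSpace V] [NormedAddCommGroup W]
    [NormedSpace ℝ W] [NormedAddCommGroup X] [NormedSpace ℝ X]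
    (P : M →ₗ[ℝ] V) (L : M →ₗ[ℝ] StrongDual ℝ W) (N : M →ₗ[ℝ] X) {K : ℝ}
    (h : ∀ x, ‖P x‖ ≤ K * (‖L x‖ + ‖N x‖)) {x : ℕ → M} {l : StrongDual ℝ W} {n : X}
    (hL : Tendsto (fun k => L (x k)) atTop (𝓝 l)) (hN : Tendsto (fun k => N (x k)) atTop (𝓝 n)) :
    ∃ p, Tendsto (fun k => P (x k)) atTop (𝓝 p) := by
  refine cauchySeq_tendsto_of_complete ?_
  have h1 := cauchySeq_iff_tendsto_dist_atTop_0.1 hL.cauchySeq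
  have h2 := cauchySeq_iff_tendsto_dist_atTop_0.1 hN.cauchySeq
  rw [cauchySeq_iff_tendsto_dist_atTop_0]
  refine squeeze_zero (fun _ => dist_nonneg) (fun n => ?_) (by simpa using (h1.add h2).const_mul K)
  rw [dist_eq_norm, dist_eq_norm, dist_eq_norm, ← map_sub, ← map_sub, ← map_sub]
  exact h _

/-- The data of the boundary value problem solved by an element of the core. -/
def load (hε : ε ≠ 0) (ha : IsCoeff a A) (hb : IsCoeff b B) (hA : 0 ≤ A) (hB : 0 ≤ B)
    [CompleteSpace (H d ε)] : core d →ₗ[ℝ] WithLp 2 (H d ε × L2Minus d) where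
  toFun φ := WithLp.toLp 2 ((InnerProductSpace.toDual ℝ (H d ε)).symm (loadDual hε ha hb hA hB φ),
    coreTr (GammaMinus d) φ)
  map_add' φ ψ := by simp only [map_add]; rfl
  map_smul' c φ := by
    simp only [map_smul, RingHom.id_apply]
    rfl

theorem load_apply (hε : ε ≠ 0) (ha : IsCoeff a A) (hb : IsCoeff b B) (hA : 0 ≤ A) (hB : 0 ≤ B)
    [CompleteSpace (H d ε)] (φ : core d) : load hε ha hb hA hB φ
      = WithLp.toLp 2 ((InnerProductSpace.toDual ℝ (H d ε)).symm (loadDual hε ha hb hA hB φ),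
    coreTr (GammaMinus d) φ) := rfl

/-- The data which can be reached by the core are dense. -/
theorem dense_range_load (hε : ε ≠ 0) (ha : IsCoeff a A) (hb : IsCoeff b B) (hA : 0 ≤ A)
    (hB : 0 ≤ B) {b₀ : ℝ} (hb0 : 0 < b₀)
    (hb₀ : ∀ᵐ x ∂(volume.restrict (halfSpace d)), b₀ ≤ b x) [CompleteSpace (H d ε)] :
    (LinearMap.range (load hε ha hb hA hB)).topologicalClosure = ⊤ := by
  rw [Submodule.topologicalClosure_eq_top_iff, Submodule.eq_bot_iff]
  intro z hz
  have hrel : ∀ φ : core d, loadDual hε ha hb hA hB φ z.fst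
      + inner ℝ (coreTr (GammaMinus d) φ) z.snd = 0 := by
    intro φ
    have h := (Submodule.mem_orthogonal _ _).1 hz _ (LinearMap.mem_range_self _ φ)
    rw [WithLp.prod_inner_apply, load_apply] at h
    rw [← InnerProductSpace.toDual_symm_apply]
    exact h
  have hG := isAngGrad_hGrad hε z.fst
  have hsol : IsHomSol (-1) (fun x => ε ^ 2 * a x) b (hFn z.fst) (hGrad z.fst) := by
    intro φ hφ hs
    have hcore : φ ∈ core d := IsTestNoGrazing.of_tsupport hφ fun q hq h1 h2 h3 => by
      have := hs q hq h1 h2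
      rw [h3, mul_zero] at this
      exact lt_irrefl _ this
    have htr : coreTr (GammaMinus d) ⟨φ, hcore⟩ = 0 := by
      refine (Lp.eq_zero_iff_ae_eq_zero).2 ?_
      filter_upwards [coeFn_coreTr (GammaMinus d) ⟨φ, hcore⟩,
        ae_bdryMeasure_mem (measurableSet_GammaMinus d)] with p h1 h2
      rw [h1]
      rw [GammaMinus_iff] at h2
      by_contra hne
      have h3 : 0 < -1 * (p.2 : E d) (Fin.last d) :=
        hs (amb p) (subset_tsupport _ hne) h2.1 (by simp [amb])
      linarith [h2.2]
    have h := hrel ⟨φ, hcore⟩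
    rw [htr, inner_zero_left, add_zero] at h
    have h' : dualOf d ε (coreT d ⟨φ, hcore⟩) z.fst
        + form ε ha hb hA hB (coreH hε ⟨φ, hcore⟩) z.fst = 0 := h
    have e1 : dualOf d ε (coreT d ⟨φ, hcore⟩) z.fst
        = ∫ p, hFn z.fst p * transport φ (amb p) ∂(measQ d) :=
      (integral_mul_eq_inner (hFn z.fst) (hφ.transport.memLp (measQ d))).symm
    rw [e1, form_comm] at h'
    rw [integral_weak_eq hε ha hb hA hB (-1) z.fst hφ.smooth (hφ.memLp _) hφ.memLp_angGrad
      (hφ.transport.memLp _), neg_one_mul, sub_neg_eq_add, add_comm]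
    exact h'
  have h0 : z.fst = 0 := eq_zero_of_hFn hε
    (hsol.eq_zero (by simp) hG (ha.const_mul (sq_nonneg ε)) hb hb0 hb₀)
  have h1 : z.snd = 0 := by
    refine trace_eq_zero (measurableSet_GammaMinus d) (s := 1) (fun p hp => ?_) z.snd
      fun g hg hgs => ?_
    · rw [one_mul]; exact (GammaMinus_iff.1 hp).2
    · have hcore : g ∈ core d := IsTestNoGrazing.of_tsupport hg fun q hq _ _ h3 => by
        have h4 : 0 < 1 * q.2 (Fin.last d) := hgs hq
        rw [h3, mul_zero] at h4
        exact lt_irrefl _ h4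
      have h := hrel ⟨g, hcore⟩
      rw [h0, map_zero, zero_add] at h
      rw [← h]
      exact integral_mul_eq_inner z.snd (hg.memLp _)
  rw [WithLp.ext_iff, Prod.ext_iff]
  exact ⟨h0, h1⟩

theorem exists_load_seq (hε : ε ≠ 0) (ha : IsCoeff a A) (hb : IsCoeff b B) (hA : 0 ≤ A)
    (hB : 0 ≤ B) {b₀ : ℝ} (hb0 : 0 < b₀)
    (hb₀ : ∀ᵐ x ∂(volume.restrict (halfSpace d)), b₀ ≤ b x) (f : HDual d ε) (g : L2Minus d) :
    ∃ φ : ℕ → core d,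
      Tendsto (fun k => loadDual hε ha hb hA hB (φ k)) atTop (𝓝 f) ∧
      Tendsto (fun k => coreTr (GammaMinus d) (φ k)) atTop (𝓝 g) := by
  have := completeSpace_H (d := d) hε
  set z : WithLp 2 (H d ε × L2Minus d) :=
    WithLp.toLp 2 ((InnerProductSpace.toDual ℝ (H d ε)).symm f, g) with hz
  have hmem : z ∈ closure (LinearMap.range (load hε ha hb hA hB) : Set _) := by
    have := dense_range_load (d := d) hε ha hb hA hB hb0 hb₀
    rw [← Submodule.topologicalClosure_coe, this]
    trivial
  obtain ⟨y, hy, hyz⟩ := mem_closure_iff_seq_limit.1 hmem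
  choose φ hφ using hy
  have hlim : Tendsto (fun k => load hε ha hb hA hB (φ k)) atTop (𝓝 z) := by
    simpa only [hφ] using hyz
  refine ⟨φ, ?_, ((WithLp.sndL 2 ℝ (H d ε) (L2Minus d)).continuous.tendsto z).comp hlim⟩
  have h1 : Tendsto (fun k => (InnerProductSpace.toDual ℝ (H d ε)).symm
      (loadDual hε ha hb hA hB (φ k))) atTop
      (𝓝 ((InnerProductSpace.toDual ℝ (H d ε)).symm f)) :=
    ((WithLp.fstL 2 ℝ (H d ε) (L2Minus d)).continuous.tendsto z).comp hlim
  have h2 : Tendsto (fun k => InnerProductSpace.toDual ℝ (H d ε)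
      ((InnerProductSpace.toDual ℝ (H d ε)).symm (loadDual hε ha hb hA hB (φ k)))) atTop
      (𝓝 (InnerProductSpace.toDual ℝ (H d ε) ((InnerProductSpace.toDual ℝ (H d ε)).symm f))) :=
    ((InnerProductSpace.toDual ℝ (H d ε)).continuous.tendsto _).comp h1
  simp only [LinearIsometryEquiv.apply_symm_apply] at h2
  exact h2

/-- Solutions as limits of elements of the core. -/
theorem exists_core_seq (hε : ε ≠ 0) (ha : IsCoeff a A) (hb : IsCoeff b B) (hA : 0 ≤ A)
    (hB : 0 ≤ B) {a₀ b₀ : ℝ} (ha0 : 0 < a₀) (hb0 : 0 < b₀)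
    (ha₀ : ∀ᵐ x ∂(volume.restrict (halfSpace d)), a₀ ≤ a x)
    (hb₀ : ∀ᵐ x ∂(volume.restrict (halfSpace d)), b₀ ≤ b x) (f : HDual d ε) (g : L2Minus d) :
    ∃ (φ : ℕ → core d) (u : H d ε) (h : L2Plus d),
      Tendsto (fun k => coreH hε (φ k)) atTop (𝓝 u) ∧
      Tendsto (fun k => loadDual hε ha hb hA hB (φ k)) atTop (𝓝 f) ∧
      Tendsto (fun k => coreTr (GammaMinus d) (φ k)) atTop (𝓝 g) ∧
      Tendsto (fun k => coreTr (GammaPlus d) (φ k)) atTop (𝓝 h) := by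
  have := completeSpace_H (d := d) hε
  obtain ⟨φ, hF, hM⟩ := exists_load_seq (d := d) hε ha hb hA hB hb0 hb₀ f g
  have hbd := core_bound (d := d) hε ha hb hA hB ha0 hb0 ha₀ hb₀
  have h1 : ∃ u : H d ε, Tendsto (fun k => coreH hε (φ k)) atTop (𝓝 u) :=
    exists_lim_of_norm_le (V := H d ε) (W := H d ε) (X := L2Minus d) (coreH hε)
      (loadDual hε ha hb hA hB) (coreTr (GammaMinus d)) (fun x => (hbd x).1) hF hM
  have h2 : ∃ h : L2Plus d, Tendsto (fun k => coreTr (GammaPlus d) (φ k)) atTop (𝓝 h) :=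
    exists_lim_of_norm_le (V := L2Plus d) (W := H d ε) (X := L2Minus d) (coreTr (GammaPlus d))
      (loadDual hε ha hb hA hB) (coreTr (GammaMinus d)) (fun x => (hbd x).2) hF hM
  obtain ⟨u, hu⟩ := h1
  obtain ⟨h, hh⟩ := h2
  exact ⟨φ, u, h, hu, hF, hM, hh⟩

end Load

section Traces

variable {d : ℕ} {ε : ℝ}

theorem Y_ext {u v : Y d ε} (h1 : u.1.fst = v.1.fst) (h2 : u.1.snd = v.1.snd) : u = v :=
  Subtype.ext ((WithLp.ext_iff 2).2 (Prod.ext h1 h2))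

theorem Y_ext_yFn (hε : ε ≠ 0) {u v : Y d ε} (h : yFn u = yFn v) : u = v := by
  have h1 : u.1.fst = v.1.fst := hFn_injective hε h
  refine Y_ext h1 (IsTransport.unique hε u.2 ?_)
  rw [h1]
  exact v.2

theorem eq_coreY (hε : ε ≠ 0) (φ : core d) {v : Y d ε}
    (h : ∀ᵐ p ∂(measQ d), yFn v p = φ.1 (amb p)) : v = coreY hε φ := by
  refine Y_ext_yFn hε (Lp.ext ?_)
  filter_upwards [h, coeFn_coreH hε φ] with p h1 h2
  rw [h1]
  exact h2.symm

/-- Green's formula for elements of the core. -/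
theorem dualOf_coreT (hε : ε ≠ 0) (φ : core d) {χ : E d × E d → ℝ} (hs : ContDiff ℝ ∞ χ)
    (h1 : MemLp (fun p => χ (amb p)) 2 (measQ d))
    (h2 : MemLp (fun p => angGrad χ (amb p)) 2 (measQ d)) :
    dualOf d ε (coreT d φ) (smoothH ε hs h1 h2)
      + ∫ p, hFn (coreH hε φ) p * transport χ (amb p) ∂(measQ d)
    = ∫ p, coreTr (GammaPlus d) φ p * χ (amb p) ∂(bdryMeasure d (GammaPlus d))
      - ∫ p, coreTr (GammaMinus d) φ p * χ (amb p) ∂(bdryMeasure d (GammaMinus d)) := by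
  have e1 : dualOf d ε (coreT d φ) (smoothH ε hs h1 h2)
      = ∫ p, transport φ.1 (amb p) * χ (amb p) ∂(measQ d) := by
    rw [dualOf_apply, L2.inner_def]
    refine integral_congr_ae ?_
    filter_upwards [h1.coeFn_toLp, coeFn_coreT φ] with p p1 p2
    rw [hFn_smoothH, p1, p2]
    exact mul_comm _ _
  have e2 : ∫ p, hFn (coreH hε φ) p * transport χ (amb p) ∂(measQ d)
      = ∫ p, φ.1 (amb p) * transport χ (amb p) ∂(measQ d) := by
    refine integral_congr_ae ?_
    filter_upwards [coeFn_coreH hε φ] with p p1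
    rw [p1]
  have e3 : ∀ G : Set (E d × S d), ∫ p, coreTr G φ p * χ (amb p) ∂(bdryMeasure d G)
      = ∫ p, φ.1 (amb p) * χ (amb p) ∂(bdryMeasure d G) := by
    intro G
    refine integral_congr_ae ?_
    filter_upwards [coeFn_coreTr G φ] with p p1
    rw [p1]
  rw [e1, e2, e3, e3, ← green (core.isTestV φ) hs]
  ring

theorem integral_bdry_eq_zero {G : Set (E d × S d)} (hG : MeasurableSet G) {χ : E d × E d → ℝ}
    (h : ∀ p ∈ G, χ (amb p) = 0) (f : E d × S d → ℝ) :
    ∫ p, f p * χ (amb p) ∂(bdryMeasure d G) = 0 := by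
  refine integral_eq_zero_of_ae ?_
  filter_upwards [ae_bdryMeasure_mem hG] with p hp
  simp [h p hp]

theorem tendsto_hFn {u : ℕ → H d ε} {u₀ : H d ε} (hu : Tendsto u atTop (𝓝 u₀)) :
    Tendsto (fun k => hFn (u k)) atTop (𝓝 (hFn u₀)) :=
  (((WithLp.fstL 2 ℝ (L2Q d) (L2QVec d)).continuous.comp continuous_subtype_val).tendsto u₀).comp hu

theorem tendsto_integral_Lp {X : Type*} [MeasurableSpace X] {m : Measure X} {u : ℕ → Lp ℝ 2 m}
    {u₀ : Lp ℝ 2 m} (hu : Tendsto u atTop (𝓝 u₀)) {G : X → ℝ} (hG : MemLp G 2 m) :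
    Tendsto (fun k => ∫ x, u k x * G x ∂m) atTop (𝓝 (∫ x, u₀ x * G x ∂m)) := by
  simp only [integral_mul_eq_inner _ hG]
  exact tendsto_const_nhds.inner hu

theorem tendsto_dual {V : Type*} [NormedAddCommGroup V] [NormedSpace ℝ V] {ℓ : ℕ → StrongDual ℝ V}
    {ℓ₀ : StrongDual ℝ V} (h : Tendsto ℓ atTop (𝓝 ℓ₀)) (v : V) :
    Tendsto (fun k => ℓ k v) atTop (𝓝 (ℓ₀ v)) :=
  ((ContinuousLinearMap.apply ℝ ℝ v).continuous.tendsto ℓ₀).comp h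

theorem tendsto_Y_fst {v : ℕ → Y d ε} {u : Y d ε} (h : Tendsto v atTop (𝓝 u)) :
    Tendsto (fun k => (v k).1.fst) atTop (𝓝 u.1.fst) :=
  (((WithLp.fstL 2 ℝ (H d ε) (HDual d ε)).continuous.comp continuous_subtype_val).tendsto u).comp h

theorem tendsto_Y_snd {v : ℕ → Y d ε} {u : Y d ε} (h : Tendsto v atTop (𝓝 u)) :
    Tendsto (fun k => (v k).1.snd) atTop (𝓝 u.1.snd) :=
  (((WithLp.sndL 2 ℝ (H d ε) (HDual d ε)).continuous.comp continuous_subtype_val).tendsto u).comp h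

/-- The integrals of a trace against a smooth function are determined by the function. -/
theorem HasTrace.integral_eq (hε : ε ≠ 0) {G : Set (E d × S d)} {u : Y d ε}
    {h : Lp ℝ 2 (bdryMeasure d G)} (ht : HasTrace G u h) {χ : E d × E d → ℝ} (hχ : IsTestV χ)
    {s : ℝ} (hG : ∀ φ : core d, ∫ p, coreTr G φ p * χ (amb p) ∂(bdryMeasure d G)
      = s * (dualOf d ε (coreT d φ) (testH ε hχ)
        + ∫ p, hFn (coreH hε φ) p * transport χ (amb p) ∂(measQ d))) :
    ∫ p, h p * χ (amb p) ∂(bdryMeasure d G)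
      = s * (u.1.snd (testH ε hχ) + ∫ p, yFn u p * transport χ (amb p) ∂(measQ d)) := by
  obtain ⟨φ, v, hφ, hv, hh⟩ := ht
  have hvk : ∀ k, v k = coreY hε ⟨φ k, (hφ k).1⟩ := fun k => eq_coreY hε ⟨φ k, (hφ k).1⟩ (hφ k).2
  have h1 : Tendsto (fun k => coreTr G ⟨φ k, (hφ k).1⟩) atTop (𝓝 h) := by
    rw [Lp.tendsto_Lp_iff_tendsto_eLpNorm']
    refine hh.congr fun k => eLpNorm_congr_ae ?_
    filter_upwards [coeFn_coreTr G ⟨φ k, (hφ k).1⟩] with p hp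
    rw [Pi.sub_apply, hp]
  have t1 := tendsto_integral_Lp h1 (hχ.memLp (bdryMeasure d G))
  have t2 : Tendsto (fun k => s * ((v k).1.snd (testH ε hχ)
      + ∫ p, yFn (v k) p * transport χ (amb p) ∂(measQ d))) atTop
      (𝓝 (s * (u.1.snd (testH ε hχ) + ∫ p, yFn u p * transport χ (amb p) ∂(measQ d)))) :=
    ((tendsto_dual (tendsto_Y_snd hv) _).add
      (tendsto_integral_Lp (tendsto_hFn (tendsto_Y_fst hv)) (hχ.transport.memLp _))).const_mul s
  refine tendsto_nhds_unique t1 (t2.congr fun k => ?_)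
  rw [hG]
  exact congrArg (fun w : Y d ε => s * (w.1.snd (testH ε hχ)
    + ∫ p, yFn w p * transport χ (amb p) ∂(measQ d))) (hvk k)

theorem HasTrace.unique_of_side (hε : ε ≠ 0) {G : Set (E d × S d)} (hGm : MeasurableSet G)
    {u : Y d ε} {h h' : Lp ℝ 2 (bdryMeasure d G)} (ht : HasTrace G u h) (ht' : HasTrace G u h')
    {s t : ℝ} (hside : ∀ p ∈ G, 0 < s * (p.2 : E d) (Fin.last d))
    (hG : ∀ χ : E d × E d → ℝ, ∀ hχ : IsTestV χ, tsupport χ ⊆ {q | 0 < s * q.2 (Fin.last d)} →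
      ∀ φ : core d, ∫ p, coreTr G φ p * χ (amb p) ∂(bdryMeasure d G)
      = t * (dualOf d ε (coreT d φ) (testH ε hχ)
        + ∫ p, hFn (coreH hε φ) p * transport χ (amb p) ∂(measQ d))) : h = h' := by
  rw [← sub_eq_zero]
  refine trace_eq_zero hGm hside _ fun χ hχ hs => ?_
  have e : ∫ p, (h - h' : Lp ℝ 2 (bdryMeasure d G)) p * χ (amb p) ∂(bdryMeasure d G)
      = ∫ p, h p * χ (amb p) ∂(bdryMeasure d G) - ∫ p, h' p * χ (amb p) ∂(bdryMeasure d G) := by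
    simp only [integral_mul_eq_inner _ (hχ.memLp (bdryMeasure d G))]
    exact inner_sub_right _ _ _
  rw [e, ht.integral_eq hε hχ (hG χ hχ hs), ht'.integral_eq hε hχ (hG χ hχ hs), sub_self]

theorem HasTrace.unique_minus (hε : ε ≠ 0) {u : Y d ε} {h h' : L2Minus d}
    (ht : HasTrace (GammaMinus d) u h) (ht' : HasTrace (GammaMinus d) u h') : h = h' := by
  refine ht.unique_of_side hε (measurableSet_GammaMinus d) ht' (s := 1) (t := -1)
    (fun p hp => by rw [one_mul]; exact (GammaMinus_iff.1 hp).2) fun χ hχ hs φ => ?_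
  have hz : ∀ p ∈ GammaPlus d, χ (amb p) = 0 := by
    intro p hp
    by_contra hne
    have h1 : 0 < 1 * (p.2 : E d) (Fin.last d) := hs (subset_tsupport _ hne)
    linarith [(GammaPlus_iff.1 hp).2]
  have := dualOf_coreT hε φ hχ.smooth (hχ.memLp _) hχ.memLp_angGrad
  rw [integral_bdry_eq_zero (measurableSet_GammaPlus d) hz, zero_sub] at this
  rw [testH, this]
  ring

theorem HasTrace.unique_plus (hε : ε ≠ 0) {u : Y d ε} {h h' : L2Plus d}
    (ht : HasTrace (GammaPlus d) u h) (ht' : HasTrace (GammaPlus d) u h') : h = h' := by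
  refine ht.unique_of_side hε (measurableSet_GammaPlus d) ht' (s := -1) (t := 1)
    (fun p hp => by have := (GammaPlus_iff.1 hp).2; linarith) fun χ hχ hs φ => ?_
  have hz : ∀ p ∈ GammaMinus d, χ (amb p) = 0 := by
    intro p hp
    by_contra hne
    have h1 : 0 < -1 * (p.2 : E d) (Fin.last d) := hs (subset_tsupport _ hne)
    linarith [(GammaMinus_iff.1 hp).2]
  have := dualOf_coreT hε φ hχ.smooth (hχ.memLp _) hχ.memLp_angGrad
  rw [integral_bdry_eq_zero (measurableSet_GammaMinus d) hz, sub_zero] at this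
  rw [testH, this]
  ring

end Traces

section Solutions

variable {d : ℕ} {ε : ℝ} {a b : E d → ℝ} {A B : ℝ}

theorem IsTestIn.of_isTestV {φ : E d × E d → ℝ} (h : IsTestV φ)
    (hs : ∀ q ∈ tsupport φ, q.1 (Fin.last d) = 0 → ‖q.2‖ = 1 → 0 < q.2 (Fin.last d)) :
    IsTestIn φ := by
  refine ⟨h.smooth, fun p hp => ?_, h.memLp _, h.memLp_angGrad, h.transport.memLp _, h.memLp _⟩
  by_contra hne
  have h1 : 0 < (p.2 : E d) (Fin.last d) :=
    hs (amb p) (subset_tsupport _ hne) (GammaPlus_iff.1 hp).1 (by simp [amb])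
  exact lt_asymm h1 (GammaPlus_iff.1 hp).2

theorem isWeakSolution_iff (hε : ε ≠ 0) (ha : IsCoeff a A) (hb : IsCoeff b B) (hA : 0 ≤ A)
    (hB : 0 ≤ B) {f : L2Q d} {g : L2Minus d} {u : Y d ε} :
    IsWeakSolution a b f g u ↔ ∀ φ : E d × E d → ℝ, ∀ hφ : IsTestIn φ,
      form ε ha hb hA hB u.1.fst (smoothH ε hφ.smooth hφ.memLp hφ.memLp_grad)
        - ∫ p, yFn u p * transport φ (amb p) ∂(measQ d)
      = ∫ p, f p * φ (amb p) ∂(measQ d)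
        + ∫ p, g p * φ (amb p) ∂(bdryMeasure d (GammaMinus d)) := by
  refine forall_congr' fun φ => forall_congr' fun hφ => ?_
  have h := integral_weak_eq hε ha hb hA hB 1 u.1.fst hφ.smooth hφ.memLp hφ.memLp_grad
    hφ.memLp_transport
  simp only [one_mul, ← mul_assoc] at h
  have h' : ∫ p, (ε ^ 2 * a p.1 * inner ℝ (yGrad u p) (angGrad φ (amb p))
        - yFn u p * transport φ (amb p) + b p.1 * yFn u p * φ (amb p)) ∂(measQ d)
      = form ε ha hb hA hB u.1.fst (smoothH ε hφ.smooth hφ.memLp hφ.memLp_grad)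
        - ∫ p, yFn u p * transport φ (amb p) ∂(measQ d) := h
  rw [h']

theorem IsWeakSolution.unique (hε : ε ≠ 0) (ha : IsCoeff a A) (hb : IsCoeff b B) (hA : 0 ≤ A)
    (hB : 0 ≤ B) {b₀ : ℝ} (hb0 : 0 < b₀)
    (hb₀ : ∀ᵐ x ∂(volume.restrict (halfSpace d)), b₀ ≤ b x) {f : L2Q d} {g : L2Minus d}
    {u v : Y d ε} (hu : IsWeakSolution a b f g u) (hv : IsWeakSolution a b f g v) : u = v := by
  rw [isWeakSolution_iff hε ha hb hA hB] at hu hv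
  have hsol : IsHomSol 1 (fun x => ε ^ 2 * a x) b (hFn (u.1.fst - v.1.fst))
      (hGrad (u.1.fst - v.1.fst)) := by
    intro φ hφ hs
    have hin : IsTestIn φ := IsTestIn.of_isTestV hφ fun q hq h1 h2 => by
      simpa using hs q hq h1 h2
    have e1 := hu φ hin
    have e2 := hv φ hin
    have e3 : ∫ p, hFn (u.1.fst - v.1.fst) p * transport φ (amb p) ∂(measQ d)
        = ∫ p, yFn u p * transport φ (amb p) ∂(measQ d)
          - ∫ p, yFn v p * transport φ (amb p) ∂(measQ d) := by
      simp only [integral_mul_eq_inner _ hin.memLp_transport]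
      exact inner_sub_right _ _ _
    rw [integral_weak_eq hε ha hb hA hB 1 _ hin.smooth hin.memLp hin.memLp_grad
      hin.memLp_transport, map_sub, e3, one_mul, _root_.sub_apply]
    linarith
  have h0 : hFn (u.1.fst - v.1.fst) = 0 :=
    hsol.eq_zero (by simp) (isAngGrad_hGrad hε _) (ha.const_mul (sq_nonneg ε)) hb hb0 hb₀
  exact Y_ext_yFn hε (sub_eq_zero.1 h0)

theorem norm_Y_le (u : Y d ε) : ‖u‖ ≤ ‖u.1.fst‖ + ‖u.1.snd‖ := by
  refine abs_le_of_sq_le_sq' ?_ (by positivity) |>.2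
  have h : ‖u‖ ^ 2 = ‖u.1.fst‖ ^ 2 + ‖u.1.snd‖ ^ 2 := WithLp.prod_norm_sq_eq_of_L2 u.1
  rw [h]
  nlinarith [mul_nonneg (norm_nonneg u.1.fst) (norm_nonneg u.1.snd)]

theorem tendsto_coreY (hε : ε ≠ 0) {φ : ℕ → core d} {u : Y d ε}
    (h1 : Tendsto (fun k => coreH hε (φ k)) atTop (𝓝 u.1.fst))
    (h2 : Tendsto (fun k => dualOf d ε (coreT d (φ k))) atTop (𝓝 u.1.snd)) :
    Tendsto (fun k => coreY hε (φ k)) atTop (𝓝 u) := by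
  rw [tendsto_subtype_rng]
  exact ((WithLp.prod_continuous_toLp 2 (H d ε) (HDual d ε)).tendsto (u.1.fst, u.1.snd)).comp
    (h1.prodMk_nhds h2)

theorem hasTrace_of_tendsto (hε : ε ≠ 0) {φ : ℕ → core d} {u : Y d ε}
    (hu : Tendsto (fun k => coreY hε (φ k)) atTop (𝓝 u)) {G : Set (E d × S d)}
    {h : Lp ℝ 2 (bdryMeasure d G)} (hh : Tendsto (fun k => coreTr G (φ k)) atTop (𝓝 h)) :
    HasTrace G u h := by
  refine ⟨fun k => (φ k).1, fun k => coreY hε (φ k), fun k => ⟨(φ k).2, coeFn_coreH hε (φ k)⟩,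
    hu, ?_⟩
  rw [Lp.tendsto_Lp_iff_tendsto_eLpNorm'] at hh
  refine hh.congr fun k => eLpNorm_congr_ae ?_
  filter_upwards [coeFn_coreTr G (φ k)] with p hp
  rw [Pi.sub_apply, hp]

theorem norm_le_of_tendsto {X Z : Type*} [NormedAddCommGroup X] [NormedSpace ℝ X]
    [NormedAddCommGroup Z] {x : ℕ → X} {y : ℕ → StrongDual ℝ X} {z : ℕ → Z} {x₀ : X}
    {y₀ : StrongDual ℝ X} {z₀ : Z} {c : ℝ}
    (hx : Tendsto x atTop (𝓝 x₀)) (hy : Tendsto y atTop (𝓝 y₀)) (hz : Tendsto z atTop (𝓝 z₀))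
    (h : ∀ k, ‖x k‖ ≤ c * (‖y k‖ + ‖z k‖)) : ‖x₀‖ ≤ c * (‖y₀‖ + ‖z₀‖) :=
  le_of_tendsto_of_tendsto' hx.norm ((hy.norm.add hz.norm).const_mul _) h

theorem opNorm_sub_le_of_le {X : Type*} [NormedAddCommGroup X] [NormedSpace ℝ X]
    {y z : StrongDual ℝ X} {r s : ℝ} (hy : ‖y‖ ≤ r) (hz : ‖z‖ ≤ s) : ‖y - z‖ ≤ r + s :=
  norm_sub_le_of_le hy hz

/-- Existence of a weak solution, with its traces and the energy estimate. -/
theorem exists_weakSolution (hε : ε ≠ 0) (ha : IsCoeff a A) (hb : IsCoeff b B) (hA : 0 ≤ A)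
    (hB : 0 ≤ B) {a₀ b₀ : ℝ} (ha0 : 0 < a₀) (hb0 : 0 < b₀)
    (ha₀ : ∀ᵐ x ∂(volume.restrict (halfSpace d)), a₀ ≤ a x)
    (hb₀ : ∀ᵐ x ∂(volume.restrict (halfSpace d)), b₀ ≤ b x) (f : L2Q d) (g : L2Minus d) :
    ∃ (u : Y d ε) (h : L2Plus d), IsWeakSolution a b f g u ∧
      ‖u‖ ≤ (1 + (1 + A + B) * (1 / min a₀ b₀ + 1)) * (‖f‖ + ‖g‖) ∧
      HasTrace (GammaMinus d) u g ∧ HasTrace (GammaPlus d) u h := by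
  obtain ⟨φ, u₀, h, hu, hF, hM, hP⟩ :=
    exists_core_seq (d := d) hε ha hb hA hB ha0 hb0 ha₀ hb₀ (dualOf d ε f) g
  have hform : Tendsto (fun k => form ε ha hb hA hB (coreH hε (φ k))) atTop
      (𝓝 (form ε ha hb hA hB u₀)) := ((form ε ha hb hA hB).continuous.tendsto u₀).comp hu
  have hT : Tendsto (fun k => dualOf d ε (coreT d (φ k))) atTop
      (𝓝 (dualOf d ε f - form ε ha hb hA hB u₀)) := by
    refine (hF.sub hform).congr fun k => ?_
    rw [loadDual_apply, add_sub_cancel_right]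
  set u : Y d ε := ⟨WithLp.toLp 2 (u₀, dualOf d ε f - form ε ha hb hA hB u₀),
    isTransport_of_tendsto (fun k => isTransport_core hε (φ k)) hu hT⟩ with hudef
  have hY : Tendsto (fun k => coreY hε (φ k)) atTop (𝓝 u) := tendsto_coreY hε hu hT
  refine ⟨u, h, ?_, ?_, hasTrace_of_tendsto hε hY hM, hasTrace_of_tendsto hε hY hP⟩
  · rw [isWeakSolution_iff hε ha hb hA hB]
    intro χ hχ
    have t1 : Tendsto (fun k => loadDual hε ha hb hA hB (φ k)
        (smoothH ε hχ.smooth hχ.memLp hχ.memLp_grad)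
        + ∫ p, coreTr (GammaMinus d) (φ k) p * χ (amb p) ∂(bdryMeasure d (GammaMinus d))) atTop
        (𝓝 (dualOf d ε f (smoothH ε hχ.smooth hχ.memLp hχ.memLp_grad)
          + ∫ p, g p * χ (amb p) ∂(bdryMeasure d (GammaMinus d)))) :=
      (tendsto_dual hF _).add (tendsto_integral_Lp hM hχ.memLp_in)
    have t2 : Tendsto (fun k => form ε ha hb hA hB (coreH hε (φ k))
        (smoothH ε hχ.smooth hχ.memLp hχ.memLp_grad)
        - ∫ p, hFn (coreH hε (φ k)) p * transport χ (amb p) ∂(measQ d)) atTop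
        (𝓝 (form ε ha hb hA hB u₀ (smoothH ε hχ.smooth hχ.memLp hχ.memLp_grad)
        - ∫ p, hFn u₀ p * transport χ (amb p) ∂(measQ d))) :=
      (tendsto_dual hform _).sub (tendsto_integral_Lp (tendsto_hFn hu) hχ.memLp_transport)
    have t3 := tendsto_nhds_unique t2 (t1.congr fun k => by
      have hg := dualOf_coreT hε (φ k) hχ.smooth hχ.memLp hχ.memLp_grad
      rw [integral_bdry_eq_zero (measurableSet_GammaPlus d) hχ.zero_out, zero_sub] at hg
      rw [loadDual_apply, _root_.add_apply]
      linarith)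
    have e : ∫ p, f p * χ (amb p) ∂(measQ d)
        = dualOf d ε f (smoothH ε hχ.smooth hχ.memLp hχ.memLp_grad) := by
      rw [integral_mul_eq_inner _ hχ.memLp, real_inner_comm]
      rfl
    rw [e]
    exact t3
  · have hbd := core_bound (d := d) hε ha hb hA hB ha0 hb0 ha₀ hb₀
    have hc := lt_min ha0 hb0
    have h1 : ‖u₀‖ ≤ (1 / min a₀ b₀ + 1) * (‖dualOf d ε f‖ + ‖g‖) :=
      norm_le_of_tendsto hu hF hM fun k => (hbd (φ k)).1
    have h2 : ‖dualOf d ε f‖ ≤ ‖f‖ := norm_dualOf_le f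
    have h3 : ‖dualOf d ε f - form ε ha hb hA hB u₀‖ ≤ ‖f‖ + (A + B) * ‖u₀‖ :=
      opNorm_sub_le_of_le h2 (norm_form_le ha hb hA hB u₀)
    have h4 : ‖u₀‖ ≤ (1 / min a₀ b₀ + 1) * (‖f‖ + ‖g‖) :=
      h1.trans (mul_le_mul_of_nonneg_left (by linarith) (by positivity))
    have h5 : (1 + A + B) * ‖u₀‖ ≤ (1 + A + B) * ((1 / min a₀ b₀ + 1) * (‖f‖ + ‖g‖)) :=
      mul_le_mul_of_nonneg_left h4 (by positivity)
    calc ‖u‖ ≤ ‖u₀‖ + ‖dualOf d ε f - form ε ha hb hA hB u₀‖ := norm_Y_le u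
      _ ≤ ‖f‖ + (1 + A + B) * ‖u₀‖ := by linarith
      _ ≤ (‖f‖ + ‖g‖) + (1 + A + B) * ((1 / min a₀ b₀ + 1) * (‖f‖ + ‖g‖)) := by
        linarith [norm_nonneg g]
      _ = _ := by ring

theorem isCoeff_of_bounds (ha : AEMeasurable a (volume.restrict (halfSpace d))) {a₀ a₁ : ℝ}
    (h0 : 0 < a₀) (h : ∀ᵐ x ∂(volume.restrict (halfSpace d)), a₀ ≤ a x ∧ a x ≤ a₁) :
    IsCoeff a |a₁| :=
  ⟨ha, h.mono fun _ hx => h0.le.trans hx.1, h.mono fun _ hx => hx.2.trans (le_abs_self _)⟩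

end Solutions

end FokkerPlanck

end

theorem theorem2p1 (σ₀ σ₁ lam₀ lam₁ : ℝ) (hσ₀ : 0 < σ₀) (hlam₀ : 0 < lam₀) :
    ∃ C : ℝ, 0 < C ∧
      ∀ (d : ℕ), 1 ≤ d → ∀ (ε : ℝ), 0 < ε →
      ∀ (σ lam : E d → ℝ),
        AEMeasurable σ (volume.restrict (halfSpace d)) →
        AEMeasurable lam (volume.restrict (halfSpace d)) →
        (∀ᵐ x ∂(volume.restrict (halfSpace d)), σ₀ ≤ σ x ∧ σ x ≤ σ₁) →
        (∀ᵐ x ∂(volume.restrict (halfSpace d)), lam₀ ≤ lam x ∧ lam x ≤ lam₁) →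
      ∀ (f : L2Q d) (g : L2Minus d),
        (∃! u : Y d ε, IsWeakSolution σ lam f g u) ∧
        ∀ u : Y d ε, IsWeakSolution σ lam f g u →
          ‖u‖ ≤ C * (‖f‖ + ‖g‖) ∧
          HasTrace (GammaMinus d) u g ∧
          (∀ h : L2Minus d, HasTrace (GammaMinus d) u h → h = g) ∧
          (∃! h : L2Plus d, HasTrace (GammaPlus d) u h) := by
  have hmin := lt_min hσ₀ hlam₀
  refine ⟨1 + (1 + |σ₁| + |lam₁|) * (1 / min σ₀ lam₀ + 1), by positivity, ?_⟩
  intro d _ ε hε σ lam hσ hlam hσb hlamb f g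
  have ha := isCoeff_of_bounds hσ hσ₀ hσb
  have hb := isCoeff_of_bounds hlam hlam₀ hlamb
  have hl := hlamb.mono fun _ hx => hx.1
  obtain ⟨u, h, hu, hbound, hm, hp⟩ := exists_weakSolution hε.ne' ha hb (abs_nonneg _)
    (abs_nonneg _) hσ₀ hlam₀ (hσb.mono fun _ hx => hx.1) hl f g
  have huniq : ∀ v : Y d ε, IsWeakSolution σ lam f g v → v = u := fun v hv =>
    hv.unique hε.ne' ha hb (abs_nonneg _) (abs_nonneg _) hlam₀ hl hu
  refine ⟨⟨u, hu, huniq⟩, fun v hv => ?_⟩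
  obtain rfl := huniq v hv
  exact ⟨hbound, hm, fun h' hh' => hh'.unique_minus hε.ne' hm,
    h, hp, fun h' hh' => hh'.unique_plus hε.ne' hp⟩
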